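/- Let $(M,g)$ be a smooth Riemannian manifold of dimension $D=2n+\varepsilon$ with $\varepsilon\in\{0,1\}$, let $T$ be a smooth 3-form on $M$, and let $\nabla^T_XY=\nabla_XY+\tfrac12\sum_a T(X,Y,e_a)\,e_a$, where $\nabla$ is the Levi-Civita connection and $\{e_a\}$ is an orthonormal frame. For a 2-form $h$ put $d^Th=\sum_a e^a\wedge\nabla^T_{e_a}h$ and $\delta^Th=-\sum_a e_a\lrcorner\nabla^T_{e_a}h$. Let $h$ be a principal Killing--Yano (PKY) tensor with torsion $T$, that is, a smooth 2-form such that: 1. (GCKY) for every vector field $X$, $\nabla^T_Xh=\tfrac13X\lrcorner d^Th-\tfrac1{D-1}X^\flat\wedge\delta^Th$ (for $D=1$, where all 2-forms vanish, the factor $\tfrac1{D-1}$ is read as $0$); 2. ($d^T$-closed) $d^Th=0$; 3. (non-degenerate) the rank of $h$ as a $(1,1)$-tensor is $2n$ at every point, and its eigenvalues $\pm i x_\mu$ ($\mu=1,\dots,n$), together with $0$ if $\varepsilon=1$, are functionally independent: near every point they are given by smooth functions $x_1,\dots,x_n$ whose differentials are linearly independent at every point. Let $\xi=-\tfrac1{D-1}\delta^Th$.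 A canonical frame at a point is an orthonormal basis $\{e_\mu,e_{\hat\mu}\}_{\mu=1}^n$ of the tangent space there (completed by $e_0$ if $\varepsilon=1$), with dual basis $\{e^a\}$, for which there are real numbers $x_\mu$, $Q_\mu\ge0$ and $Q_0\ge0$ with $$h=\sum_{\mu}x_\mu\,e^\mu\wedge e^{\hat\mu},\qquad \xi=\sum_\mu\sqrt{Q_\mu}\,e^{\hat\mu}+\varepsilon\sqrt{Q_0}\,e^0 .$$ Then, with respect to every canonical frame at every point, the following hold. (a) The torsion has only $\mu\hat\mu\hat\nu$-components with $\mu\ne\nu$ and, if $\varepsilon=1$, $\mu\hat\mu0$-components: $$T=\sum_{\mu}\sum_{\nu\neq\mu}T_{\mu\hat\mu\hat\nu}\,e^\mu\wedge e^{\hat\mu}\wedge e^{\hat\nu}+\varepsilon\sum_\mu T_{\mu\hat\mu0}\,e^\mu\wedge e^{\hat\mu}\wedge e^0 .$$ (b) The exterior derivative of $h$ is $$dh=-\sum_\mu\sum_{\nu\ne\mu}x_\mu\,T_{\nu\hat\nu\hat\mu}\,e^\nu\wedge e^{\hat\nu}\wedge e^\mu .$$ (c) If $dh=0$ at the point, then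 there $T=\varepsilon\sum_\mu T_{\mu\hat\mu0}\,e^\mu\wedge e^{\hat\mu}\wedge e^0$. Consequently, if $D$ is even and $dh=0$ on $M$, then $T=0$ on $M$. -/

import Mathlib

open Bundle Manifold Polynomial
open scoped ContDiff

noncomputable section

namespace PKYTorsion

variable {D : ℕ} {M : Type*} [TopologicalSpace M] [ChartedSpace (EuclideanSpace ℝ (Fin D)) M]

/-- Vector fields on `M` (no regularity built in). -/
abbrev VecField (D : ℕ) (M : Type*) [TopologicalSpace M]
    [ChartedSpace (EuclideanSpace ℝ (Fin D)) M] : Type _ :=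
  ∀ p : M, TangentSpace (𝓡 D) p

/-- Fields of alternating `k`-linear forms on the tangent spaces of `M` (no regularity built in). -/
abbrev Form (D : ℕ) (M : Type*) [TopologicalSpace M]
    [ChartedSpace (EuclideanSpace ℝ (Fin D)) M] (k : ℕ) : Type _ :=
  ∀ p : M, TangentSpace (𝓡 D) p [⋀^Fin k]→L[ℝ] ℝ

/-- The derivative `v(f)` of a function `f` at `p` along a tangent vector `v` at `p`. -/
def dirDeriv (f : M → ℝ) (p : M) (v : TangentSpace (𝓡 D) p) : ℝ :=
  mvfderiv (𝓡 D) f p v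

variable [IsManifold (𝓡 D) ∞ M]

/-- `η` is a smooth differential form: `η(X₁, …, X_k)` is smooth wherever the vector fields
`X₁, …, X_k` are. -/
def IsSmoothForm {k : ℕ} (η : Form D M k) : Prop :=
  ∀ (X : Fin k → VecField D M) (p : M),
    (∀ i, ContMDiffAt (𝓡 D) (𝓡 D).tangent ∞
      (fun q ↦ (⟨q, X i q⟩ : TangentBundle (𝓡 D) M)) p) →
    ContMDiffAt (𝓡 D) 𝓘(ℝ, ℝ) ∞ (fun q ↦ η q (fun i ↦ X i q)) p

/-- An extension of a tangent vector at `p` to a vector field which is smooth near `p` (the field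
that has constant components in the preferred chart at `p`). The tensors defined below through `ext`
do not depend on the choice of the extension. -/
def ext {p : M} (v : TangentSpace (𝓡 D) p) : VecField D M :=
  FiberBundle.extend (EuclideanSpace ℝ (Fin D)) v

/-- The exterior derivative of a 2-form `h`, by the invariant formula
`dh(X,Y,Z) = X h(Y,Z) - Y h(X,Z) + Z h(X,Y) - h([X,Y],Z) + h([X,Z],Y) - h([Y,Z],X)`. -/
def extDeriv₂ (h : Form D M 2) (p : M) (u v w : TangentSpace (𝓡 D) p) : ℝ :=
  dirDeriv (fun q ↦ h q ![ext v q, ext w q]) p u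
    - dirDeriv (fun q ↦ h q ![ext u q, ext w q]) p v
    + dirDeriv (fun q ↦ h q ![ext u q, ext v q]) p w
    - h p ![VectorField.mlieBracket (𝓡 D) (ext u) (ext v) p, w]
    + h p ![VectorField.mlieBracket (𝓡 D) (ext u) (ext w) p, v]
    - h p ![VectorField.mlieBracket (𝓡 D) (ext v) (ext w) p, u]

variable [RiemannianBundle (fun p : M ↦ TangentSpace (𝓡 D) p)]

/-- An orthonormal basis of the tangent space at `p`. -/
def onb (p : M) : OrthonormalBasis (Fin (Module.finrank ℝ (TangentSpace (𝓡 D) p))) ℝ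
    (TangentSpace (𝓡 D) p) :=
  haveI : FiniteDimensional ℝ (TangentSpace (𝓡 D) p) :=
    inferInstanceAs (FiniteDimensional ℝ (EuclideanSpace ℝ (Fin D)))
  stdOrthonormalBasis ℝ (TangentSpace (𝓡 D) p)

/-- The right-hand side of the Koszul formula for `g(∇_X Y, Z)`. -/
def koszul (X Y Z : VecField D M) (p : M) : ℝ :=
  (1 / 2) * (dirDeriv (fun q ↦ inner ℝ (Y q) (Z q)) p (X p)
    + dirDeriv (fun q ↦ inner ℝ (X q) (Z q)) p (Y p)
    - dirDeriv (fun q ↦ inner ℝ (X q) (Y q)) p (Z p)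
    + inner ℝ (VectorField.mlieBracket (𝓡 D) X Y p) (Z p)
    - inner ℝ (VectorField.mlieBracket (𝓡 D) X Z p) (Y p)
    - inner ℝ (VectorField.mlieBracket (𝓡 D) Y Z p) (X p))

/-- The Levi-Civita covariant derivative `∇_v Y` at `p`. -/
def leviCivita (Y : VecField D M) (p : M) (v : TangentSpace (𝓡 D) p) : TangentSpace (𝓡 D) p :=
  ∑ a, koszul (ext v) Y (ext (onb p a)) p • onb p a

/-- The connection with skew-symmetric torsion `T`:
`∇ᵀ_v Y = ∇_v Y + (1/2) ∑ₐ T(v, Y, eₐ) eₐ`. -/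
def nablaT (T : Form D M 3) (Y : VecField D M) (p : M) (v : TangentSpace (𝓡 D) p) :
    TangentSpace (𝓡 D) p :=
  leviCivita Y p v + (1 / 2 : ℝ) • ∑ a, T p ![v, Y p, onb p a] • onb p a

/-- The covariant derivative of a 2-form, `(∇ᵀ_u h)(v, w)`, for the connection induced by `∇ᵀ`. -/
def nablaTForm (T : Form D M 3) (h : Form D M 2) (p : M) (u v w : TangentSpace (𝓡 D) p) : ℝ :=
  dirDeriv (fun q ↦ h q ![ext v q, ext w q]) p u
    - h p ![nablaT T (ext v) p u, w] - h p ![v, nablaT T (ext w) p u]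

/-- `dᵀh = ∑ₐ eᵃ ∧ ∇ᵀ_{eₐ} h` for a 2-form `h`. -/
def dT (T : Form D M 3) (h : Form D M 2) (p : M) (u v w : TangentSpace (𝓡 D) p) : ℝ :=
  nablaTForm T h p u v w - nablaTForm T h p v u w + nablaTForm T h p w u v

/-- `δᵀh = -∑ₐ eₐ ⌟ ∇ᵀ_{eₐ} h` for a 2-form `h`. -/
def deltaT (T : Form D M 3) (h : Form D M 2) (p : M) (w : TangentSpace (𝓡 D) p) : ℝ :=
  - ∑ a, nablaTForm T h p (onb p a) (onb p a) w

/-- `h` is a generalized conformal Killing-Yano tensor of rank `2` for the torsion `T`: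
`∇ᵀ_X h = (1/3) X ⌟ dᵀh - (1/(D-1)) X♭ ∧ δᵀh` for all `X`. -/
def IsGCKY (T : Form D M 3) (h : Form D M 2) : Prop :=
  ∀ (p : M) (u v w : TangentSpace (𝓡 D) p),
    nablaTForm T h p u v w = (1 / 3) * dT T h p u v w
      - (1 / ((D : ℝ) - 1)) * (inner ℝ u v * deltaT T h p w - inner ℝ u w * deltaT T h p v)

/-- The associated 1-form `ξ = -(1/(D-1)) δᵀh`. -/
def assocForm (T : Form D M 3) (h : Form D M 2) (p : M) (w : TangentSpace (𝓡 D) p) : ℝ :=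
  -(1 / ((D : ℝ) - 1)) * deltaT T h p w

/-- The matrix of `h`, regarded as a (1,1)-tensor by means of the metric, in an orthonormal basis of
the tangent space at `p`. -/
def formMatrix (h : Form D M 2) (p : M) :
    Matrix (Fin (Module.finrank ℝ (TangentSpace (𝓡 D) p)))
      (Fin (Module.finrank ℝ (TangentSpace (𝓡 D) p))) ℝ :=
  Matrix.of fun a b ↦ h p ![onb p a, onb p b]

/-- Non-degeneracy of a 2-form in dimension `D = 2n + ε`: as a (1,1)-tensor, `h` has maximal rank
`2n` at all points, and its eigenvalues `± i x_μ` (and `0` if `ε = 1`) are functionally independent,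
that is, near each point they are given by smooth functions `x_μ` whose differentials are linearly
independent. -/
def IsNondegenerate (n ε : ℕ) (h : Form D M 2) : Prop :=
  (∀ p : M, (formMatrix h p).rank = 2 * n) ∧
  ∀ p : M, ∃ U : Set M, IsOpen U ∧ p ∈ U ∧ ∃ x : Fin n → M → ℝ,
    (∀ μ, ContMDiffOn (𝓡 D) 𝓘(ℝ, ℝ) ∞ (x μ) U) ∧
    (∀ q ∈ U, (formMatrix h q).charpoly = X ^ ε * ∏ μ, (X ^ 2 + C (x μ q ^ 2))) ∧
    ∀ q ∈ U, LinearIndependent ℝ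
      (fun μ ↦ mvfderiv (𝓡 D) (x μ) q)

/-- A principal Killing-Yano tensor with torsion `T` in dimension `D = 2n + ε`: a non-degenerate
`dᵀ`-closed GCKY tensor of rank 2. -/
structure IsPKY (n ε : ℕ) (T : Form D M 3) (h : Form D M 2) : Prop where
  smooth : IsSmoothForm h
  gcky : IsGCKY T h
  closed : ∀ (p : M) (u v w : TangentSpace (𝓡 D) p), dT T h p u v w = 0
  nondegenerate : IsNondegenerate n ε h

/-- The labels `μ`, `μ̂` (`μ = 1, …, n`) and, if `ε = 1`, `0` of a Darboux frame. -/
abbrev Idx (n ε : ℕ) : Type := Fin n ⊕ Fin n ⊕ Fin ε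

/-- the label `μ` -/
abbrev un {n ε : ℕ} (μ : Fin n) : Idx n ε := Sum.inl μ

/-- the label `μ̂` -/
abbrev hat {n ε : ℕ} (μ : Fin n) : Idx n ε := Sum.inr (Sum.inl μ)

/-- the label `0` (there is one for `ε = 1` and none for `ε = 0`) -/
abbrev zer {n ε : ℕ} (k : Fin ε) : Idx n ε := Sum.inr (Sum.inr k)

/-- The dual basis: `coframe e a v = eᵃ(v)`. -/
def coframe {n ε : ℕ} {p : M} (e : OrthonormalBasis (Idx n ε) ℝ (TangentSpace (𝓡 D) p))
    (a : Idx n ε) (v : TangentSpace (𝓡 D) p) : ℝ :=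
  inner ℝ (e a) v

/-- `(eᵃ ∧ eᵇ)(u, v)` -/
def wedge₂ {n ε : ℕ} {p : M} (e : OrthonormalBasis (Idx n ε) ℝ (TangentSpace (𝓡 D) p))
    (a b : Idx n ε) (u v : TangentSpace (𝓡 D) p) : ℝ :=
  Matrix.det !![coframe e a u, coframe e a v; coframe e b u, coframe e b v]

/-- `(eᵃ ∧ eᵇ ∧ eᶜ)(u, v, w)` -/
def wedge₃ {n ε : ℕ} {p : M} (e : OrthonormalBasis (Idx n ε) ℝ (TangentSpace (𝓡 D) p))
    (a b c : Idx n ε) (u v w : TangentSpace (𝓡 D) p) : ℝ :=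
  Matrix.det !![coframe e a u, coframe e a v, coframe e a w;
    coframe e b u, coframe e b v, coframe e b w;
    coframe e c u, coframe e c v, coframe e c w]

/-- The orthonormal basis `e` of the tangent space at `p` is a canonical frame at `p`, and `x`, `Q`,
`Q₀` are the corresponding values of the eigenvalue functions and of the functions that describe the
associated 1-form:
`h = ∑_μ x_μ e^μ ∧ e^μ̂` and `ξ = ∑_μ √Q_μ e^μ̂ + ε √Q₀ e⁰`. -/
structure IsCanonicalFrame {n ε : ℕ} (T : Form D M 3) (h : Form D M 2) (p : M)
    (e : OrthonormalBasis (Idx n ε) ℝ (TangentSpace (𝓡 D) p))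
    (x Q : Fin n → ℝ) (Q₀ : ℝ) : Prop where
  darboux : ∀ u v, h p ![u, v] = ∑ μ, x μ * wedge₂ e (un μ) (hat μ) u v
  Q_nonneg : ∀ μ, 0 ≤ Q μ
  Q₀_nonneg : 0 ≤ Q₀
  assoc : ∀ w, assocForm T h p w
    = ∑ μ, √(Q μ) * coframe e (hat μ) w + ∑ k : Fin ε, √Q₀ * coframe e (zer k) w

end PKYTorsion

end

open PKYTorsion

/-! Notation: e_μ, e_μ̂, e_0 is a frame; "hatted" indices i, j, k, l range over the ν̂ and 0;
Γ_{abc} = g(∇ᵀ_a e_b, e_c); x_0 = 0. Since `dT T h` vanishes, the GCKY equation reads ∇ᵀ_X h = X♭ ∧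
ξ. The torsion is computed from this equation, from d(dx_μ) = 0 and from the Jacobi identity, in a
smooth local frame that extends the canonical frame.

Eigenvalues. A skew map has no nilpotent part at 0, so the rank condition makes every x_μ nonzero
(`eigenvalue_ne_zero`). Their squares are distinct (`eigenvalue_sq_ne`): if two coincided at a
point, independence of the differentials would give a direction X in which, after a choice of sign,
they move with speeds 1 and 2. But on an eigenspace of h the derivative of h acts as X♭ ∧ ξ, because
the connection contributes only a commutator with h, and the hermitian form obtained from X♭ ∧ ξ has
at most one positive eigenvalue.

Frame. Distinct eigenvalues yield smooth eigenvector fields. The μμ̂-component of the equation is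
dx_μ = ξ_μ̂ e^μ - ξ_μ e^μ̂. As dx_μ ≠ 0, a smooth rotation in each plane achieves ξ_μ = 0 and s_μ =
ξ_μ̂ > 0, hence dx_μ = s_μ e^μ (`IsEigenSystem.exists_adaptedFrame`).

First-order consequences (`FrameEqs`). The other components are linear equations for Γ, with
determinants x_μ² - x_ν² or with coefficient x_μ; they leave only the Γ_{aμμ̂} undetermined.
Closedness of dx_μ removes the e_μ-component of [e_a, e_b] for a, b ≠ μ. Together these give T_{abμ}
= 0 for a, b outside the μ-plane (`T_un_off`). Besides the components in the claim, only the purely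
hatted ones survive.

Hatted components (`torsion_hat_hat_hat`). Let i ≠ j be hatted and different from μ̂. Then [e_i,
e_j] = -∑ T_{ijk} e_k and [e_μ, e_i] = a_i e_i with a_i = -x_μ s_μ / (x_μ² - x_i²). Let b_i be the
e_i-component of [e_μ, e_μ̂]. The Jacobi identity for e_μ, e_i, e_j gives T_{μ̂ij} b_i = 0; the one
for e_μ, e_μ̂, e_i, added to itself with i and j exchanged, gives 2 (a_i - a_j) T_{μ̂ij} = -(e_i b_j
+ e_j b_i). If T_{μ̂ij} ≠ 0 at a point, then b_i and b_j vanish nearby, so a_i = a_j and x_i² =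
x_j², a contradiction.

Exterior derivative. Since ∇ᵀ has torsion T, dh is dᵀh minus T acted on by h as a derivation. That
derivation kills e^μ ∧ e^μ̂ and maps e^ν̂ to x_ν e^ν, which gives (b); (c) follows because x_ν ≠ 0.
-/

namespace PKYTorsion

open VectorField

/-! ### Derivatives of functions along vector fields, and Lie brackets. -/

section Calculus

variable {D : ℕ} {M : Type*} [TopologicalSpace M] [ChartedSpace (EuclideanSpace ℝ (Fin D)) M]

instance finiteDimensional_tangentSpace (p : M) :
    FiniteDimensional ℝ (TangentSpace (𝓡 D) p) :=
  inferInstanceAs (FiniteDimensional ℝ (EuclideanSpace ℝ (Fin D)))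

lemma finrank_tangentSpace (p : M) : Module.finrank ℝ (TangentSpace (𝓡 D) p) = D :=
  (finrank_euclideanSpace_fin (𝕜 := ℝ) (n := D))

/-- A function which is smooth at `p`. -/
abbrev SmoothFun (D : ℕ) {M : Type*} [TopologicalSpace M]
    [ChartedSpace (EuclideanSpace ℝ (Fin D)) M] (f : M → ℝ) (p : M) : Prop :=
  ContMDiffAt (𝓡 D) 𝓘(ℝ, ℝ) ∞ f p

/-- A function which is differentiable at `p`. -/
abbrev DiffFun (D : ℕ) {M : Type*} [TopologicalSpace M]
    [ChartedSpace (EuclideanSpace ℝ (Fin D)) M] (f : M → ℝ) (p : M) : Prop :=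
  MDifferentiableAt (𝓡 D) 𝓘(ℝ, ℝ) f p

lemma SmoothFun.diff {f : M → ℝ} {p : M} (h : SmoothFun D f p) : DiffFun D f p :=
  ContMDiffAt.mdifferentiableAt h (by simp)

lemma SmoothFun.inv {f : M → ℝ} {p : M} (hf : SmoothFun D f p) (h : f p ≠ 0) :
    SmoothFun D (fun q ↦ (f q)⁻¹) p :=
  ContMDiffAt.inv₀ hf h

lemma SmoothFun.mul {f g : M → ℝ} {p : M} (hf : SmoothFun D f p) (hg : SmoothFun D g p) :
    SmoothFun D (fun q ↦ f q * g q) p :=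
  ContMDiffAt.mul hf hg

lemma SmoothFun.sqrt {f : M → ℝ} {p : M} (hf : SmoothFun D f p) (h : f p ≠ 0) :
    SmoothFun D (fun q ↦ √(f q)) p :=
  ContMDiffAt.comp (I' := 𝓘(ℝ, ℝ)) p (Real.contDiffAt_sqrt h).contMDiffAt hf

lemma DiffFun.sum {ι : Type*} {s : Finset ι} {f : ι → M → ℝ} {p : M}
    (hf : ∀ i ∈ s, DiffFun D (f i) p) : DiffFun D (fun q ↦ ∑ i ∈ s, f i q) p := by
  classical
  induction s using Finset.induction_on with
  | empty => simpa using mdifferentiableAt_const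
  | insert a s ha ih =>
    simp only [Finset.mem_insert, forall_eq_or_imp] at hf
    simp only [Finset.sum_insert ha]
    exact MDifferentiableAt.add hf.1 (ih hf.2)

lemma SmoothFun.add {f g : M → ℝ} {p : M} (hf : SmoothFun D f p) (hg : SmoothFun D g p) :
    SmoothFun D (fun q ↦ f q + g q) p :=
  ContMDiffAt.add hf hg

lemma DiffFun.sub {f g : M → ℝ} {p : M} (hf : DiffFun D f p) (hg : DiffFun D g p) :
    DiffFun D (fun q ↦ f q - g q) p :=
  MDifferentiableAt.sub hf hg

lemma exists_ne_zero_field (hD : 0 < D) (p : M) : ∃ v : TangentSpace (𝓡 D) p, v ≠ 0 := by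
  have : Nontrivial (TangentSpace (𝓡 D) p) :=
    Module.nontrivial_of_finrank_pos (R := ℝ) (by
      rw [finrank_tangentSpace]; exact hD)
  exact exists_ne 0

lemma subsingleton_tangentSpace (hD : D = 0) (p : M) : Subsingleton (TangentSpace (𝓡 D) p) := by
  apply Module.finrank_zero_iff (R := ℝ).1
  rw [finrank_tangentSpace, hD]

lemma dirDeriv_add_fun {f g : M → ℝ} {p : M} (hf : DiffFun D f p) (hg : DiffFun D g p)
    (v : TangentSpace (𝓡 D) p) :
    dirDeriv (fun q ↦ f q + g q) p v = dirDeriv f p v + dirDeriv g p v := by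
  unfold dirDeriv
  rw [mvfderiv_fun_add hf hg]; rfl

lemma dirDeriv_sub_fun {f g : M → ℝ} {p : M} (hf : DiffFun D f p) (hg : DiffFun D g p)
    (v : TangentSpace (𝓡 D) p) :
    dirDeriv (fun q ↦ f q - g q) p v = dirDeriv f p v - dirDeriv g p v := by
  unfold dirDeriv
  rw [mvfderiv_fun_sub hf hg]; rfl

lemma dirDeriv_neg_fun {f : M → ℝ} {p : M}
    (v : TangentSpace (𝓡 D) p) :
    dirDeriv (fun q ↦ - f q) p v = - dirDeriv f p v := by
  unfold dirDeriv
  rw [mvfderiv_fun_neg]; rfl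

lemma dirDeriv_mul_fun {f g : M → ℝ} {p : M} (hf : DiffFun D f p) (hg : DiffFun D g p)
    (v : TangentSpace (𝓡 D) p) :
    dirDeriv (fun q ↦ f q * g q) p v = f p * dirDeriv g p v + g p * dirDeriv f p v := by
  unfold dirDeriv
  rw [mvfderiv_fun_mul hf hg]; rfl

@[simp] lemma dirDeriv_const (c : ℝ) (p : M) (v : TangentSpace (𝓡 D) p) :
    dirDeriv (fun _ : M ↦ c) p v = 0 := by
  unfold dirDeriv
  rw [mvfderiv_const]; rfl

lemma dirDeriv_congr {f g : M → ℝ} {p : M} (h : f =ᶠ[nhds p] g) (v : TangentSpace (𝓡 D) p) :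
    dirDeriv f p v = dirDeriv g p v := by
  unfold dirDeriv mvfderiv
  have := h.mfderiv_eq (I := 𝓡 D) (I' := 𝓘(ℝ, ℝ))
  have h0 := h.self_of_nhds
  simp only [ContinuousLinearMap.comp_apply]
  rw [this]
  rfl

lemma dirDeriv_add (f : M → ℝ) (p : M) (u v : TangentSpace (𝓡 D) p) :
    dirDeriv f p (u + v) = dirDeriv f p u + dirDeriv f p v := map_add _ _ _

lemma dirDeriv_smul (f : M → ℝ) (p : M) (c : ℝ) (u : TangentSpace (𝓡 D) p) :
    dirDeriv f p (c • u) = c * dirDeriv f p u := map_smul _ _ _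

lemma dirDeriv_sum {ι : Type*} (s : Finset ι) (f : M → ℝ) (p : M)
    (u : ι → TangentSpace (𝓡 D) p) :
    dirDeriv f p (∑ i ∈ s, u i) = ∑ i ∈ s, dirDeriv f p (u i) := map_sum _ _ _

variable [IsManifold (𝓡 D) ∞ M]

/-- A vector field which is smooth at `p`. -/
abbrev SmoothField (X : VecField D M) (p : M) : Prop :=
  ContMDiffAt (𝓡 D) (𝓡 D).tangent ∞ (fun q ↦ (⟨q, X q⟩ : TangentBundle (𝓡 D) M)) p

/-- A vector field which is differentiable at `p`. -/
abbrev DiffField (X : VecField D M) (p : M) : Prop :=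
  MDifferentiableAt (𝓡 D) (𝓡 D).tangent (fun q ↦ (⟨q, X q⟩ : TangentBundle (𝓡 D) M)) p

lemma SmoothField.diff {X : VecField D M} {p : M} (h : SmoothField X p) : DiffField X p :=
  ContMDiffAt.mdifferentiableAt h (by simp)

@[simp] lemma ext_apply_self {p : M} (v : TangentSpace (𝓡 D) p) : ext v p = v :=
  FiberBundle.extend_apply_self _ _

lemma smoothField_ext {p : M} (v : TangentSpace (𝓡 D) p) : SmoothField (ext v) p :=
  FiberBundle.contMDiffAt_extend (k := ∞) (𝓡 D) (EuclideanSpace ℝ (Fin D)) v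

lemma SmoothField.add {X Y : VecField D M} {p : M} (hX : SmoothField X p) (hY : SmoothField Y p) :
    SmoothField (fun q ↦ X q + Y q) p :=
  ContMDiffAt.add_section hX hY

lemma SmoothField.sub {X Y : VecField D M} {p : M} (hX : SmoothField X p) (hY : SmoothField Y p) :
    SmoothField (fun q ↦ X q - Y q) p :=
  ContMDiffAt.sub_section hX hY

lemma SmoothField.smul {f : M → ℝ} {X : VecField D M} {p : M} (hf : SmoothFun D f p)
    (hX : SmoothField X p) :
    SmoothField (fun q ↦ f q • X q) p :=
  ContMDiffAt.smul_section hf hX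

lemma SmoothField.sum {ι : Type*} {s : Finset ι} {X : ι → VecField D M} {p : M}
    (hX : ∀ i ∈ s, SmoothField (X i) p) :
    SmoothField (fun q ↦ ∑ i ∈ s, X i q) p :=
  ContMDiffAt.sum_section hX

lemma SmoothField.congr {X Y : VecField D M} {p : M} (hX : SmoothField X p)
    (h : ∀ᶠ q in nhds p, Y q = X q) : SmoothField Y p := by
  refine ContMDiffAt.congr_of_eventuallyEq hX ?_
  filter_upwards [h] with q hq
  rw [hq]

lemma eventually_smoothField_ext {p : M} (v : TangentSpace (𝓡 D) p) :
    ∀ᶠ q in nhds p, SmoothField (ext v) q := by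
  obtain ⟨s, hs, h⟩ := FiberBundle.exists_contMDiffOn_extend (k := ∞) (𝓡 D)
    (EuclideanSpace ℝ (Fin D)) v
  filter_upwards [eventually_mem_nhds_iff.2 hs] with q hq
  exact h.contMDiffAt hq

lemma SmoothField.lieBracket {X Y : VecField D M} {p : M} (hX : SmoothField X p)
    (hY : SmoothField Y p) : SmoothField (mlieBracket (𝓡 D) X Y) p := by
  have : IsManifold (𝓡 D) (((⊤ : ℕ∞) : WithTop ℕ∞) + 1) M := by
    simpa using (inferInstance : IsManifold (𝓡 D) ∞ M)
  have h2 : IsManifold (𝓡 D) (minSmoothness ℝ 2) M := by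
    rw [minSmoothness_of_isRCLikeNormedField]
    exact IsManifold.of_le (n := ∞) (WithTop.coe_le_coe.2 le_top)
  exact ContMDiffAt.mlieBracket_vectorField (n := ⊤) (m := ⊤) hX hY
    (by rw [minSmoothness_of_isRCLikeNormedField]; rfl)

lemma mlieBracket_smul_right' {f : M → ℝ} {X Y : VecField D M} {p : M} (hf : DiffFun D f p)
    (hY : DiffField Y p) :
    mlieBracket (𝓡 D) X (fun q ↦ f q • Y q) p =
      dirDeriv f p (X p) • Y p + f p • mlieBracket (𝓡 D) X Y p :=
  mlieBracket_smul_right hf hY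

variable [RiemannianBundle (fun p : M ↦ TangentSpace (𝓡 D) p)]
    [IsContMDiffRiemannianBundle (𝓡 D) ∞ (EuclideanSpace ℝ (Fin D))
      (fun p : M ↦ TangentSpace (𝓡 D) p)]

lemma SmoothField.innerFun {X Y : VecField D M} {p : M} (hX : SmoothField X p)
    (hY : SmoothField Y p) : SmoothFun D (fun q ↦ inner ℝ (X q) (Y q)) p :=
  ContMDiffAt.inner_bundle hX hY

lemma DiffField.innerFun {X Y : VecField D M} {p : M} (hX : DiffField X p)
    (hY : DiffField Y p) : DiffFun D (fun q ↦ inner ℝ (X q) (Y q)) p := by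
  have : IsContMDiffRiemannianBundle (𝓡 D) 1 (EuclideanSpace ℝ (Fin D))
      (fun p : M ↦ TangentSpace (𝓡 D) p) := IsContMDiffRiemannianBundle.of_le (n := ∞) (by simp)
  exact MDifferentiableAt.inner_bundle hX hY

/-- X(f) Y = [X, f Y] - f [X, Y] is smooth because brackets of smooth fields are. Pairing with a
field Y that is nonzero at `p` recovers X(f). Such a Y exists only for D > 0, whence the case
distinction. -/
lemma SmoothField.dirDerivFun {f : M → ℝ} {X : VecField D M} {p : M} (hX : SmoothField X p)
    (hf : SmoothFun D f p) (hf' : ∀ᶠ q in nhds p, SmoothFun D f q) :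
    SmoothFun D (fun q ↦ dirDeriv f q (X q)) p := by
  rcases Nat.eq_zero_or_pos D with hD | hD
  · have : (fun q ↦ dirDeriv f q (X q)) = fun _ ↦ 0 := by
      funext q
      have := subsingleton_tangentSpace hD q
      rw [Subsingleton.elim (X q) 0]
      exact map_zero _
    rw [this]
    exact contMDiffAt_const
  obtain ⟨v, hv⟩ := exists_ne_zero_field hD p
  have hY := smoothField_ext v
  have hpos : inner ℝ (ext v p) (ext v p) ≠ 0 := by simpa using hv
  have h1 : SmoothField (fun q ↦ dirDeriv f q (X q) • ext v q) p := by
    refine ((hX.lieBracket (hY.smul hf)).sub ((hX.lieBracket hY).smul hf)).congr ?_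
    filter_upwards [hf', eventually_smoothField_ext v] with q h1 h2
    rw [mlieBracket_smul_right' h1.diff h2.diff, add_sub_cancel_right]
  refine ContMDiffAt.congr_of_eventuallyEq
    ((h1.innerFun hY).mul ((hY.innerFun hY).inv hpos)) ?_
  have hc := (hY.innerFun hY).continuousAt.eventually_ne hpos
  filter_upwards [hc] with q hq
  rw [inner_smul_left]
  simp only [conj_trivial]
  field_simp

/-- The Lie bracket acts on functions as the commutator of derivations. -/
lemma dirDeriv_mlieBracket {f : M → ℝ} {X Y : VecField D M} {p : M}
    (hX : ∀ᶠ q in nhds p, SmoothField X q)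
    (hY : ∀ᶠ q in nhds p, SmoothField Y q) (hf : ∀ᶠ q in nhds p, SmoothFun D f q) :
    dirDeriv f p (mlieBracket (𝓡 D) X Y p) =
      dirDeriv (fun q ↦ dirDeriv f q (Y q)) p (X p)
        - dirDeriv (fun q ↦ dirDeriv f q (X q)) p (Y p) := by
  rcases Nat.eq_zero_or_pos D with hD | hD
  · have := subsingleton_tangentSpace hD p
    rw [Subsingleton.elim (X p) 0, Subsingleton.elim (Y p) 0,
      Subsingleton.elim (mlieBracket (𝓡 D) X Y p) 0]
    unfold dirDeriv
    simp
  obtain ⟨v, hv⟩ := exists_ne_zero_field hD p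
  set Z := ext v with hZdef
  have hZ := eventually_smoothField_ext v
  have h3 : IsManifold (𝓡 D) (minSmoothness ℝ 3) M := by
    rw [minSmoothness_of_isRCLikeNormedField]
    exact IsManifold.of_le (n := ∞) (WithTop.coe_le_coe.2 le_top)
  have h2 : minSmoothness ℝ 2 ≤ ∞ := by
    rw [minSmoothness_of_isRCLikeNormedField]; exact WithTop.coe_le_coe.2 le_top
  have hXp := hX.self_of_nhds
  have hYp := hY.self_of_nhds
  have hfp := hf.self_of_nhds
  have hZp := hZ.self_of_nhds
  -- The Jacobi identity for X, Y, f Z is expanded by the Leibniz rule. The terms with at most one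
  -- derivative on f cancel, except [X, Y](f) Z; what remains is the claimed identity times Z, and Z
  -- is nonzero at `p`.
  have J1 := leibniz_identity_mlieBracket_apply (I := 𝓡 D) (U := X) (V := Y)
    (W := fun q ↦ f q • Z q) (hXp.of_le h2) (hYp.of_le h2) ((hZp.smul hfp).of_le h2)
  have J2 := leibniz_identity_mlieBracket_apply (I := 𝓡 D) (U := X) (V := Y)
    (W := Z) (hXp.of_le h2) (hYp.of_le h2) (hZp.of_le h2)
  have key : ∀ {A B : VecField D M}, (∀ᶠ q in nhds p, SmoothField A q) →
      (∀ᶠ q in nhds p, SmoothField B q) →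
      mlieBracket (𝓡 D) A (mlieBracket (𝓡 D) B (fun q ↦ f q • Z q)) p =
        (dirDeriv (fun q ↦ dirDeriv f q (B q)) p (A p) • Z p
          + dirDeriv f p (B p) • mlieBracket (𝓡 D) A Z p)
        + (dirDeriv f p (A p) • mlieBracket (𝓡 D) B Z p
          + f p • mlieBracket (𝓡 D) A (mlieBracket (𝓡 D) B Z) p) := by
    intro A B hA hB
    have e : mlieBracket (𝓡 D) B (fun q ↦ f q • Z q) =ᶠ[nhds p]
        (fun q ↦ dirDeriv f q (B q) • Z q) + (fun q ↦ f q • mlieBracket (𝓡 D) B Z q) := by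
      filter_upwards [hf, hZ] with q h1 h2
      exact mlieBracket_smul_right' h1.diff h2.diff
    have hBf := (hB.self_of_nhds.dirDerivFun hfp hf)
    rw [Filter.EventuallyEq.mlieBracket_vectorField_eq (Filter.EventuallyEq.refl _ A) e,
      mlieBracket_add_right (hZp.smul hBf).diff
        ((hB.self_of_nhds.lieBracket hZp).smul hfp).diff,
      mlieBracket_smul_right' hBf.diff hZp.diff,
      mlieBracket_smul_right' hfp.diff (hB.self_of_nhds.lieBracket hZp).diff]
  rw [key hX hY, key hY hX, J2, mlieBracket_smul_right' hfp.diff hZp.diff] at J1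
  have : (dirDeriv f p (mlieBracket (𝓡 D) X Y p) -
      (dirDeriv (fun q ↦ dirDeriv f q (Y q)) p (X p)
        - dirDeriv (fun q ↦ dirDeriv f q (X q)) p (Y p))) • Z p = 0 := by
    rw [sub_smul, sub_smul]
    simp only [smul_add] at J1
    have := sub_eq_zero.2 J1
    rw [← neg_eq_zero, ← this]
    abel
  rcases smul_eq_zero.1 this with h | h
  · linarith
  · exact absurd (by simpa [hZdef] using h) hv

end Calculus

/-! ### Multilinear bookkeeping for 2-forms and 3-forms. -/

section AlternatingForms

variable {V : Type*} [AddCommGroup V] [Module ℝ V] [TopologicalSpace V]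

lemma form₂_swap (η : V [⋀^Fin 2]→L[ℝ] ℝ) (u v : V) : η ![v, u] = - η ![u, v] := by
  have := η.map_swap ![u, v] (i := 0) (j := 1) (by decide)
  refine Eq.trans (congrArg η ?_) this
  ext i; fin_cases i <;> rfl

/-- A 2-form as a bilinear map. -/
noncomputable def bil (η : V [⋀^Fin 2]→L[ℝ] ℝ) : V →ₗ[ℝ] V →ₗ[ℝ] ℝ :=
  LinearMap.mk₂ ℝ (fun u v ↦ η ![u, v])
    (fun u u' v ↦ η.map_vecCons_add ![v] u u')
    (fun c u v ↦ η.map_vecCons_smul ![v] c u)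
    (fun u v v' ↦ by
      have h : η ![v + v', u] = η ![v, u] + η ![v', u] := η.map_vecCons_add ![u] v v'
      rw [form₂_swap η (v + v') u, form₂_swap η v u, form₂_swap η v' u, h]; ring)
    (fun c u v ↦ by
      have h : η ![c • v, u] = c • η ![v, u] := η.map_vecCons_smul ![u] c v
      rw [form₂_swap η (c • v) u, form₂_swap η v u, h, smul_neg])

@[simp] lemma bil_apply (η : V [⋀^Fin 2]→L[ℝ] ℝ) (u v : V) : bil η u v = η ![u, v] := rfl

lemma form₃_swap₁₂ (η : V [⋀^Fin 3]→L[ℝ] ℝ) (u v w : V) : η ![v, u, w] = - η ![u, v, w] := by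
  have := η.map_swap ![u, v, w] (i := 0) (j := 1) (by decide)
  refine Eq.trans (congrArg η ?_) this
  ext i; fin_cases i <;> rfl

lemma form₃_swap₂₃ (η : V [⋀^Fin 3]→L[ℝ] ℝ) (u v w : V) : η ![u, w, v] = - η ![u, v, w] := by
  have := η.map_swap ![u, v, w] (i := 1) (j := 2) (by decide)
  refine Eq.trans (congrArg η ?_) this
  ext i; fin_cases i <;> rfl

lemma form₃_add (η : V [⋀^Fin 3]→L[ℝ] ℝ) (u u' v w : V) :
    η ![u + u', v, w] = η ![u, v, w] + η ![u', v, w] := η.map_vecCons_add ![v, w] u u'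

lemma form₃_smul (η : V [⋀^Fin 3]→L[ℝ] ℝ) (c : ℝ) (u v w : V) :
    η ![c • u, v, w] = c • η ![u, v, w] := η.map_vecCons_smul ![v, w] c u

/-- The contraction of a 3-form with a vector, as a bilinear map. -/
noncomputable def tri (η : V [⋀^Fin 3]→L[ℝ] ℝ) (u : V) : V →ₗ[ℝ] V →ₗ[ℝ] ℝ :=
  LinearMap.mk₂ ℝ (fun v w ↦ η ![u, v, w])
    (fun v v' w ↦ by
      rw [form₃_swap₁₂ η (v + v') u, form₃_swap₁₂ η v u, form₃_swap₁₂ η v' u, form₃_add]; ring)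
    (fun c v w ↦ by
      rw [form₃_swap₁₂ η (c • v) u, form₃_swap₁₂ η v u, form₃_smul, smul_neg])
    (fun v w w' ↦ by
      rw [form₃_swap₂₃ η u (w + w') v, form₃_swap₂₃ η u w v, form₃_swap₂₃ η u w' v,
        form₃_swap₁₂ η (w + w') u, form₃_swap₁₂ η w u, form₃_swap₁₂ η w' u,
        form₃_add]; ring)
    (fun c v w ↦ by
      rw [form₃_swap₂₃ η u (c • w) v, form₃_swap₂₃ η u w v,
        form₃_swap₁₂ η (c • w) u, form₃_swap₁₂ η w u,
        form₃_smul]; simp)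

@[simp] lemma tri_apply (η : V [⋀^Fin 3]→L[ℝ] ℝ) (u v w : V) : tri η u v w = η ![u, v, w] := rfl

end AlternatingForms

/-! ### The Koszul expression and the metric dual of the torsion. -/

section Metric

variable {D : ℕ} {M : Type*} [TopologicalSpace M] [ChartedSpace (EuclideanSpace ℝ (Fin D)) M]
  [RiemannianBundle (fun p : M ↦ TangentSpace (𝓡 D) p)]

lemma koszul_swap (X Y Z : VecField D M) (p : M) :
    koszul X Y Z p = koszul Y X Z p + inner ℝ (mlieBracket (𝓡 D) X Y p) (Z p) := by
  simp only [koszul]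
  rw [mlieBracket_swap_apply (V := Y) (W := X), inner_neg_left]
  simp only [real_inner_comm]
  ring

/-- Metric compatibility. It converts tensoriality in the third slot into the Leibniz rule in the
second. -/
lemma koszul_compat (X Y Z : VecField D M) (p : M) :
    koszul X Y Z p + koszul X Z Y p = dirDeriv (fun q ↦ inner ℝ (Y q) (Z q)) p (X p) := by
  simp only [koszul]
  rw [mlieBracket_swap_apply (V := Z) (W := Y), inner_neg_left]
  simp only [real_inner_comm]
  ring

/-- The vector which is metrically dual to the 1-form `T(u, v, ·)`. -/
noncomputable def torsionVec (T : Form D M 3) (p : M) (u v : TangentSpace (𝓡 D) p) :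
    TangentSpace (𝓡 D) p :=
  ∑ a, T p ![u, v, onb p a] • onb p a

lemma inner_torsionVec (T : Form D M 3) (p : M) (u v w : TangentSpace (𝓡 D) p) :
    inner ℝ (torsionVec T p u v) w = T p ![u, v, w] := by
  conv_rhs => rw [← (onb p).sum_repr' w, ← tri_apply]
  simp only [torsionVec, sum_inner, inner_smul_left, map_sum, map_smul, smul_eq_mul, conj_trivial,
    tri_apply]
  exact Finset.sum_congr rfl fun a _ ↦ by ring

lemma torsionVec_add (T : Form D M 3) (p : M) (u v w : TangentSpace (𝓡 D) p) :
    torsionVec T p u (v + w) = torsionVec T p u v + torsionVec T p u w := by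
  refine ext_inner_right ℝ fun z ↦ ?_
  simp only [inner_add_left, inner_torsionVec, ← tri_apply, map_add, LinearMap.add_apply]

lemma torsionVec_smul (T : Form D M 3) (p : M) (c : ℝ) (u v : TangentSpace (𝓡 D) p) :
    torsionVec T p u (c • v) = c • torsionVec T p u v := by
  refine ext_inner_right ℝ fun z ↦ ?_
  simp only [inner_smul_left, inner_torsionVec, ← tri_apply, map_smul, LinearMap.smul_apply,
    smul_eq_mul, conj_trivial]

end Metric

/-! ### Tensoriality of the connection and of the covariant derivative of h. -/

section Connection

variable {D : ℕ} {M : Type*} [TopologicalSpace M] [ChartedSpace (EuclideanSpace ℝ (Fin D)) M]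
  [IsManifold (𝓡 D) ∞ M]

lemma isManifold_one : IsManifold (𝓡 D) 1 M :=
  IsManifold.of_le (n := ∞) (by exact_mod_cast le_top)

/-- Smoothness of a form is tested on smooth fields only, whereas `TensorialAt` quantifies over
differentiable ones. Expansion in a smooth local frame bridges the gap. -/
lemma IsSmoothForm.diffFun {h : Form D M 2} (hh : IsSmoothForm h) {X Y : VecField D M} {p : M}
    (hX : DiffField X p) (hY : DiffField Y p) : DiffFun D (fun q ↦ h q ![X q, Y q]) p := by
  let t := trivializationAt (EuclideanSpace ℝ (Fin D)) (TangentSpace (𝓡 D) : M → Type _) p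
  have x_mem : p ∈ t.baseSet :=
    FiberBundle.mem_baseSet_trivializationAt (EuclideanSpace ℝ (Fin D)) (TangentSpace (𝓡 D)) p
  let b := Module.finBasis ℝ (EuclideanSpace ℝ (Fin D))
  let s := t.localFrame b
  let c := t.localFrameCoeff (𝓡 D) b
  have hs (i) : SmoothField (s i) p :=
    contMDiffAt_localFrame_of_mem (I := 𝓡 D) ∞ _ b i x_mem
  have hc {σ : VecField D M} (hσ : DiffField σ p) (i) : DiffFun D (fun q ↦ c i q (σ q)) p :=
    mdifferentiableAt_localFrameCoeff b x_mem hσ i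
  have he (σ : VecField D M) : ∀ᶠ q in nhds p, σ q = ∑ i, c i q (σ q) • s i q :=
    t.eventually_eq_localFrame_sum_coeff_smul b x_mem
  have key : (fun q ↦ h q ![X q, Y q]) =ᶠ[nhds p]
      fun q ↦ ∑ i, ∑ j, c i q (X q) * (c j q (Y q) * h q ![s i q, s j q]) := by
    filter_upwards [he X, he Y] with q h1 h2
    conv_lhs => rw [h1, h2, ← bil_apply]
    simp only [map_sum, map_smul, LinearMap.sum_apply, LinearMap.smul_apply, smul_eq_mul,
      Finset.mul_sum, bil_apply]
    rw [Finset.sum_comm]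
    refine Finset.sum_congr rfl fun i _ ↦ Finset.sum_congr rfl fun j _ ↦ by ring
  refine MDifferentiableAt.congr_of_eventuallyEq ?_ key
  refine DiffFun.sum fun i _ ↦ DiffFun.sum fun j _ ↦ ?_
  have h3 : SmoothFun D (fun q ↦ h q ![s i q, s j q]) p := by
    have := hh ![s i, s j] p (fun k ↦ by fin_cases k <;> exact hs _)
    convert this using 3 with q
    ext k; fin_cases k <;> rfl
  exact (hc hX i).mul ((hc hY j).mul h3.diff)

lemma IsSmoothForm.smoothFun {h : Form D M 2} (hh : IsSmoothForm h) {X Y : VecField D M} {p : M}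
    (hX : SmoothField X p) (hY : SmoothField Y p) : SmoothFun D (fun q ↦ h q ![X q, Y q]) p := by
  have := hh ![X, Y] p (fun k ↦ by fin_cases k <;> assumption)
  convert this using 3 with q
  ext k; fin_cases k <;> rfl

lemma IsSmoothForm.smoothFun₃ {T : Form D M 3} (hT : IsSmoothForm T) {X Y Z : VecField D M} {p : M}
    (hX : SmoothField X p) (hY : SmoothField Y p) (hZ : SmoothField Z p) :
    SmoothFun D (fun q ↦ T q ![X q, Y q, Z q]) p := by
  have := hT ![X, Y, Z] p (fun k ↦ by fin_cases k <;> assumption)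
  convert this using 3 with q
  ext k; fin_cases k <;> rfl

variable [RiemannianBundle (fun p : M ↦ TangentSpace (𝓡 D) p)]

lemma nablaT_eq (T : Form D M 3) (Y : VecField D M) (p : M) (v : TangentSpace (𝓡 D) p) :
    nablaT T Y p v = leviCivita Y p v + (1 / 2 : ℝ) • torsionVec T p v (Y p) := rfl

variable [IsContMDiffRiemannianBundle (𝓡 D) ∞ (EuclideanSpace ℝ (Fin D))
      (fun p : M ↦ TangentSpace (𝓡 D) p)]

lemma dirDeriv_inner_add {X Y Z : VecField D M} {p : M} (hX : DiffField X p) (hY : DiffField Y p)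
    (hZ : DiffField Z p) (v : TangentSpace (𝓡 D) p) :
    dirDeriv (fun q ↦ inner ℝ (X q) ((Y + Z) q)) p v =
      dirDeriv (fun q ↦ inner ℝ (X q) (Y q)) p v + dirDeriv (fun q ↦ inner ℝ (X q) (Z q)) p v := by
  rw [← dirDeriv_add_fun (hX.innerFun hY) (hX.innerFun hZ)]
  simp only [Pi.add_apply, inner_add_right]

lemma dirDeriv_inner_smul {X Y : VecField D M} {f : M → ℝ} {p : M} (hX : DiffField X p)
    (hY : DiffField Y p) (hf : DiffFun D f p) (v : TangentSpace (𝓡 D) p) :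
    dirDeriv (fun q ↦ inner ℝ (X q) ((f • Y) q)) p v =
      f p * dirDeriv (fun q ↦ inner ℝ (X q) (Y q)) p v + inner ℝ (X p) (Y p) * dirDeriv f p v := by
  rw [← dirDeriv_mul_fun hf (hX.innerFun hY)]
  simp only [Pi.smul_apply', inner_smul_right]

lemma koszul_tensorial_right {X Y : VecField D M} {p : M} (hX : DiffField X p)
    (hY : DiffField Y p) :
    TensorialAt (𝓡 D) (EuclideanSpace ℝ (Fin D)) (fun Z ↦ koszul X Y Z p) p where
  smul {f Z} hf hZ := by
    simp only [koszul]
    rw [dirDeriv_inner_smul hY hZ hf, dirDeriv_inner_smul hX hZ hf,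
      mlieBracket_smul_right hf hZ, mlieBracket_smul_right hf hZ]
    simp only [Pi.smul_apply', inner_add_left, inner_smul_left, inner_smul_right, conj_trivial,
      dirDeriv_smul, smul_eq_mul]
    simp only [dirDeriv, real_inner_comm]
    ring
  add {Z W} hZ hW := by
    simp only [koszul]
    rw [dirDeriv_inner_add hY hZ hW, dirDeriv_inner_add hX hZ hW,
      mlieBracket_add_right hZ hW, mlieBracket_add_right hZ hW]
    simp only [Pi.add_apply, inner_add_left, inner_add_right, dirDeriv_add]
    ring

lemma koszul_add_mid {X Y Z W : VecField D M} {p : M} (hY : DiffField Y p)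
    (hZ : DiffField Z p) (hX : DiffField X p) (hW : DiffField W p) :
    koszul X (Y + Z) W p = koszul X Y W p + koszul X Z W p := by
  have h := koszul_compat X W (Y + Z) p
  have h1 := koszul_compat X W Y p
  have h2 := koszul_compat X W Z p
  have h3 := (koszul_tensorial_right hX hW).add hY hZ
  rw [dirDeriv_inner_add hW hY hZ, h3] at h
  linarith

lemma koszul_smul_mid {X Y W : VecField D M} {f : M → ℝ} {p : M} (hY : DiffField Y p)
    (hf : DiffFun D f p) (hX : DiffField X p) (hW : DiffField W p) :
    koszul X (f • Y) W p = f p * koszul X Y W p + dirDeriv f p (X p) * inner ℝ (Y p) (W p) := by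
  have h := koszul_compat X W (f • Y) p
  have h1 := koszul_compat X W Y p
  have h3 := (koszul_tensorial_right hX hW).smul hf hY
  simp only [smul_eq_mul] at h3
  rw [real_inner_comm]
  rw [dirDeriv_inner_smul hW hY hf, h3] at h
  linear_combination h - f p * h1

/-- By `koszul_swap` the first slot is the second plus a bracket; the derivative terms of the two
Leibniz rules cancel. -/
lemma koszul_tensorial_left {Y Z : VecField D M} {p : M} (hY : DiffField Y p)
    (hZ : DiffField Z p) :
    TensorialAt (𝓡 D) (EuclideanSpace ℝ (Fin D)) (fun X ↦ koszul X Y Z p) p where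
  smul {f X} hf hX := by
    rw [koszul_swap, koszul_smul_mid hX hf hY hZ, koszul_swap X, mlieBracket_smul_left hf hX,
      inner_add_left, inner_smul_left, inner_smul_left]
    simp only [smul_eq_mul, conj_trivial, dirDeriv]
    ring
  add {X W} hX hW := by
    rw [koszul_swap, koszul_add_mid hX hW hY hZ, koszul_swap X, koszul_swap W,
      mlieBracket_add_left hX hW, inner_add_left]
    ring

/-- Frees `leviCivita` from the particular extensions in its definition: the outer slots of the
Koszul expression depend only on values at `p`. -/
lemma inner_leviCivita {V Y W : VecField D M} {p : M} (hV : DiffField V p) (hY : DiffField Y p)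
    (hW : DiffField W p) : inner ℝ (leviCivita Y p (V p)) (W p) = koszul V Y W p := by
  have := isManifold_one (D := D) (M := M)
  have hE : DiffField (ext (V p)) p := (smoothField_ext _).diff
  rw [(koszul_tensorial_left hY hW).pointwise hV hE (by simp)]
  have hT := koszul_tensorial_right hE hY
  have hs : ∀ a ∈ Finset.univ, DiffField
      ((fun _ ↦ inner ℝ (onb p a) (W p) : M → ℝ) • ext (onb p a)) p := fun a _ ↦
    (SmoothField.smul contMDiffAt_const (smoothField_ext _)).diff
  rw [hT.pointwise (σ' := fun q ↦ ∑ a, ((fun _ ↦ inner ℝ (onb p a) (W p) : M → ℝ) •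
    ext (onb p a)) q) hW (MDifferentiableAt.sum_section hs)]
  · rw [hT.sum _ hs]
    simp only [leviCivita, sum_inner, inner_smul_left, conj_trivial]
    refine Finset.sum_congr rfl fun a _ ↦ ?_
    rw [hT.smul mdifferentiableAt_const (smoothField_ext _).diff, smul_eq_mul, mul_comm]
  · simpa using ((onb p).sum_repr' (W p)).symm

lemma leviCivita_add {Y Z : VecField D M} {p : M} (hY : DiffField Y p) (hZ : DiffField Z p)
    (v : TangentSpace (𝓡 D) p) : leviCivita (Y + Z) p v = leviCivita Y p v + leviCivita Z p v := by
  simp only [leviCivita, ← Finset.sum_add_distrib, ← add_smul]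
  refine Finset.sum_congr rfl fun a _ ↦ ?_
  rw [koszul_add_mid hY hZ (smoothField_ext _).diff (smoothField_ext _).diff]

lemma leviCivita_smul {Y : VecField D M} {f : M → ℝ} {p : M} (hY : DiffField Y p)
    (hf : DiffFun D f p) (v : TangentSpace (𝓡 D) p) :
    leviCivita (f • Y) p v = f p • leviCivita Y p v + dirDeriv f p v • Y p := by
  have : Y p = ∑ a, inner ℝ (onb p a) (Y p) • onb p a := ((onb p).sum_repr' (Y p)).symm
  conv_rhs => rw [this]
  simp only [leviCivita, Finset.smul_sum, ← Finset.sum_add_distrib, ← add_smul, smul_smul]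
  refine Finset.sum_congr rfl fun a _ ↦ ?_
  rw [koszul_smul_mid hY hf (smoothField_ext _).diff (smoothField_ext _).diff]
  simp [real_inner_comm]

lemma nablaT_add (T : Form D M 3) {Y Z : VecField D M} {p : M} (hY : DiffField Y p)
    (hZ : DiffField Z p) (v : TangentSpace (𝓡 D) p) :
    nablaT T (Y + Z) p v = nablaT T Y p v + nablaT T Z p v := by
  simp only [nablaT_eq, leviCivita_add hY hZ, Pi.add_apply, torsionVec_add, smul_add]
  abel

lemma nablaT_smul (T : Form D M 3) {Y : VecField D M} {f : M → ℝ} {p : M} (hY : DiffField Y p)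
    (hf : DiffFun D f p) (v : TangentSpace (𝓡 D) p) :
    nablaT T (f • Y) p v = f p • nablaT T Y p v + dirDeriv f p v • Y p := by
  simp only [nablaT_eq, leviCivita_smul hY hf, Pi.smul_apply', torsionVec_smul, smul_add]
  rw [smul_comm (1 / 2 : ℝ)]
  abel

lemma covDeriv_tensorial (T : Form D M 3) {h : Form D M 2} (hh : IsSmoothForm h) {p : M}
    (u : TangentSpace (𝓡 D) p) {W : VecField D M} (hW : DiffField W p) :
    TensorialAt (𝓡 D) (EuclideanSpace ℝ (Fin D))
      (fun V ↦ dirDeriv (fun q ↦ h q ![V q, W q]) p u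
        - h p ![nablaT T V p u, W p] - h p ![V p, nablaT T W p u]) p where
  smul {f V} hf hV := by
    rw [nablaT_smul T hV hf]
    simp only [← bil_apply, Pi.smul_apply', map_smul, LinearMap.smul_apply, map_add,
      LinearMap.add_apply, smul_eq_mul]
    simp only [bil_apply]
    rw [dirDeriv_mul_fun hf (hh.diffFun hV hW)]
    ring
  add {V V'} hV hV' := by
    rw [nablaT_add T hV hV']
    simp only [← bil_apply, Pi.add_apply, map_add, LinearMap.add_apply]
    simp only [bil_apply]
    rw [dirDeriv_add_fun (hh.diffFun hV hW) (hh.diffFun hV' hW)]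
    ring

/-- The covariant derivative of a 2-form can be computed with arbitrary extensions of its
arguments. -/
lemma nablaTForm_eq (T : Form D M 3) {h : Form D M 2} (hh : IsSmoothForm h) {p : M}
    (u : TangentSpace (𝓡 D) p) {V W : VecField D M} (hV : DiffField V p) (hW : DiffField W p) :
    nablaTForm T h p u (V p) (W p) = dirDeriv (fun q ↦ h q ![V q, W q]) p u
        - h p ![nablaT T V p u, W p] - h p ![V p, nablaT T W p u] := by
  have := isManifold_one (D := D) (M := M)
  -- Antisymmetry of h transfers tensoriality from the first argument to the second.
  have swap : ∀ A B : VecField D M, dirDeriv (fun q ↦ h q ![A q, B q]) p u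
        - h p ![nablaT T A p u, B p] - h p ![A p, nablaT T B p u] =
      - (dirDeriv (fun q ↦ h q ![B q, A q]) p u
        - h p ![nablaT T B p u, A p] - h p ![B p, nablaT T A p u]) := by
    intro A B
    simp only [form₂_swap _ (A _) (B _), form₂_swap _ (nablaT T B p u) (A p),
      form₂_swap _ (nablaT T A p u) (B p), dirDeriv_neg_fun]
    ring
  have hV' : DiffField (ext (V p)) p := (smoothField_ext _).diff
  have hW' : DiffField (ext (W p)) p := (smoothField_ext _).diff
  have h1 := (covDeriv_tensorial T hh u hW).pointwise hV hV' (by simp)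
  have h2 := (covDeriv_tensorial T hh u hV').pointwise hW hW' (by simp)
  beta_reduce at h1 h2
  rw [h1, swap, h2, ← swap]
  simp [nablaTForm]

lemma inner_nablaT (T : Form D M 3) {V Y W : VecField D M} {p : M} (hV : DiffField V p)
    (hY : DiffField Y p) (hW : DiffField W p) :
    inner ℝ (nablaT T Y p (V p)) (W p) = koszul V Y W p + (1 / 2) * T p ![V p, Y p, W p] := by
  rw [nablaT_eq, inner_add_left, inner_leviCivita hV hY hW, inner_smul_left, inner_torsionVec]
  simp

end Connection

/-! ### Pointwise algebra: connection coefficients, brackets and torsion in an adapted frame. -/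

section FrameAlgebra

variable {n ε : ℕ}

/-- The pointwise relations between the connection coefficients `Γ`, the torsion `T` and the
structure functions `c` of a canonical frame: `Γ a b d = g(∇ᵀ_a e_b, e_d)`, `x` are the
eigenvalues, `s` and `s₀` the components of the associated 1-form, and `ds μ a` is the derivative of
`s μ` along `e_a`. -/
structure FrameEqs (Γ T c : Idx n ε → Idx n ε → Idx n ε → ℝ) (x s : Fin n → ℝ) (s₀ : Fin ε → ℝ)
    (ds : Fin n → Idx n ε → ℝ) : Prop where
  skew : ∀ a b d, Γ a b d = - Γ a d b
  T_swap₁₂ : ∀ a b d, T b a d = - T a b d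
  T_swap₂₃ : ∀ a b d, T a d b = - T a b d
  bracket : ∀ a b d, c a b d = Γ a b d - Γ b a d - T a b d
  x_ne : ∀ μ, x μ ≠ 0
  x_sq_ne : ∀ μ ν, μ ≠ ν → x μ ^ 2 - x ν ^ 2 ≠ 0
  s_ne : ∀ μ, s μ ≠ 0
  un_un : ∀ a μ ν, μ ≠ ν → x ν * Γ a (un μ) (hat ν) = x μ * Γ a (un ν) (hat μ)
  hat_hat : ∀ a μ ν, μ ≠ ν → x ν * Γ a (un ν) (hat μ) - x μ * Γ a (un μ) (hat ν) =
    (if a = hat μ then s ν else 0) - (if a = hat ν then s μ else 0)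
  un_hat : ∀ a μ ν, μ ≠ ν → - x ν * Γ a (un μ) (un ν) + x μ * Γ a (hat μ) (hat ν) =
    (if a = un μ then s ν else 0)
  un_zer : ∀ a μ k, - x μ * Γ a (zer k) (hat μ) = if a = un μ then s₀ k else 0
  hat_zer : ∀ a μ k, x μ * Γ a (zer k) (un μ) =
    (if a = hat μ then s₀ k else 0) - (if a = zer k then s μ else 0)
  closed : ∀ a b μ, c a b (un μ) * s μ =
    (if b = un μ then ds μ a else 0) - (if a = un μ then ds μ b else 0)

namespace FrameEqs

variable {Γ T c : Idx n ε → Idx n ε → Idx n ε → ℝ} {x s : Fin n → ℝ} {s₀ : Fin ε → ℝ}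
    {ds : Fin n → Idx n ε → ℝ}

lemma T_self₁₂ (hF : FrameEqs Γ T c x s s₀ ds) (a b : Idx n ε) : T a a b = 0 := by
  linarith [hF.T_swap₁₂ a a b]

lemma T_self₂₃ (hF : FrameEqs Γ T c x s s₀ ds) (a b : Idx n ε) : T a b b = 0 := by
  linarith [hF.T_swap₂₃ a b b]

lemma T_self₁₃ (hF : FrameEqs Γ T c x s s₀ ds) (a b : Idx n ε) : T a b a = 0 := by
  rw [hF.T_swap₂₃, hF.T_self₁₂, neg_zero]

lemma Γ_self (hF : FrameEqs Γ T c x s s₀ ds) (a b : Idx n ε) : Γ a b b = 0 := by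
  linarith [hF.skew a b b]

lemma c_swap (hF : FrameEqs Γ T c x s s₀ ds) (a b d : Idx n ε) : c b a d = - c a b d := by
  rw [hF.bracket, hF.bracket, hF.T_swap₁₂ a b d]; ring

/-- `un_hat` for (μ, ν) and for (ν, μ) is a 2×2 linear system for Γ_{aμν} and Γ_{aμ̂ν̂} with
determinant x_μ² - x_ν², up to sign; `Γ_un_un` is its other solution. -/
lemma Γ_hat_hat (hF : FrameEqs Γ T c x s s₀ ds) (a : Idx n ε) {μ ν : Fin n} (h : μ ≠ ν) :
    (x μ ^ 2 - x ν ^ 2) * Γ a (hat μ) (hat ν) =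
      x μ * (if a = un μ then s ν else 0) + x ν * (if a = un ν then s μ else 0) := by
  have h1 := hF.un_hat a μ ν h
  have h2 := hF.un_hat a ν μ h.symm
  rw [hF.skew a (un ν) (un μ), hF.skew a (hat ν) (hat μ)] at h2
  linear_combination x μ * h1 + x ν * h2

lemma Γ_un_un (hF : FrameEqs Γ T c x s s₀ ds) (a : Idx n ε) {μ ν : Fin n} (h : μ ≠ ν) :
    (x μ ^ 2 - x ν ^ 2) * Γ a (un μ) (un ν) =
      x ν * (if a = un μ then s ν else 0) + x μ * (if a = un ν then s μ else 0) := by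
  have h1 := hF.un_hat a μ ν h
  have h2 := hF.un_hat a ν μ h.symm
  rw [hF.skew a (un ν) (un μ), hF.skew a (hat ν) (hat μ)] at h2
  linear_combination x ν * h1 + x μ * h2

lemma Γ_un_hat (hF : FrameEqs Γ T c x s s₀ ds) (a : Idx n ε) {μ ν : Fin n} (h : μ ≠ ν) :
    (x μ ^ 2 - x ν ^ 2) * Γ a (un μ) (hat ν) =
      x μ * ((if a = hat ν then s μ else 0) - (if a = hat μ then s ν else 0)) := by
  have h1 := hF.un_un a μ ν h
  have h2 := hF.hat_hat a μ ν h
  linear_combination - x μ * h2 - x ν * h1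

lemma eq_zero_of_mul (hF : FrameEqs Γ T c x s s₀ ds) {μ ν : Fin n} (h : μ ≠ ν) {r : ℝ}
    (hr : (x μ ^ 2 - x ν ^ 2) * r = 0) : r = 0 :=
  (mul_eq_zero.1 hr).resolve_left (hF.x_sq_ne μ ν h)

lemma Γ_hat_hat_zero (hF : FrameEqs Γ T c x s s₀ ds) {a : Idx n ε} {μ ν : Fin n} (h : μ ≠ ν)
    (h1 : a ≠ un μ) (h2 : a ≠ un ν) : Γ a (hat μ) (hat ν) = 0 :=
  hF.eq_zero_of_mul h (by rw [hF.Γ_hat_hat a h, if_neg h1, if_neg h2]; ring)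

lemma Γ_un_un_zero (hF : FrameEqs Γ T c x s s₀ ds) {a : Idx n ε} {μ ν : Fin n} (h : μ ≠ ν)
    (h1 : a ≠ un μ) (h2 : a ≠ un ν) : Γ a (un μ) (un ν) = 0 :=
  hF.eq_zero_of_mul h (by rw [hF.Γ_un_un a h, if_neg h1, if_neg h2]; ring)

lemma Γ_un_hat_zero (hF : FrameEqs Γ T c x s s₀ ds) {a : Idx n ε} {μ ν : Fin n} (h : μ ≠ ν)
    (h1 : a ≠ hat ν) (h2 : a ≠ hat μ) : Γ a (un μ) (hat ν) = 0 :=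
  hF.eq_zero_of_mul h (by rw [hF.Γ_un_hat a h, if_neg h1, if_neg h2]; ring)

lemma Γ_hat_zer_zero (hF : FrameEqs Γ T c x s s₀ ds) {a : Idx n ε} {μ : Fin n} {k : Fin ε}
    (h1 : a ≠ un μ) : Γ a (hat μ) (zer k) = 0 := by
  have h := hF.un_zer a μ k
  rw [if_neg h1, hF.skew] at h
  simpa [hF.x_ne μ] using h

lemma Γ_un_zer_zero (hF : FrameEqs Γ T c x s s₀ ds) {a : Idx n ε} {μ : Fin n} {k : Fin ε}
    (h1 : a ≠ hat μ) (h2 : a ≠ zer k) : Γ a (un μ) (zer k) = 0 := by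
  have h := hF.hat_zer a μ k
  rw [if_neg h1, if_neg h2, hF.skew] at h
  simpa [hF.x_ne μ] using h

/-- This is d(dx_μ) = 0, with dx_μ = s_μ e^μ and s_μ ≠ 0. -/
lemma c_un_zero (hF : FrameEqs Γ T c x s s₀ ds) {a b : Idx n ε} {μ : Fin n}
    (h1 : a ≠ un μ) (h2 : b ≠ un μ) : c a b (un μ) = 0 := by
  have h := hF.closed a b μ
  rw [if_neg h1, if_neg h2, sub_zero] at h
  exact (mul_eq_zero.1 h).resolve_right (hF.s_ne μ)

/-- Connection coefficients `Γ a (un μ) b` with `a`, `b` outside of the `μ`-plane. -/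
lemma Γ_un_off (hF : FrameEqs Γ T c x s s₀ ds) {a b : Idx n ε} {μ : Fin n} (hab : a ≠ b)
    (ha : a ≠ un μ) (ha' : a ≠ hat μ) (hb : b ≠ un μ) (hb' : b ≠ hat μ) :
    Γ a (un μ) b = 0 := by
  rcases b with ν | ν | k
  · exact hF.Γ_un_un_zero (fun h ↦ hb (by rw [h])) ha hab
  · exact hF.Γ_un_hat_zero (fun h ↦ hb' (by rw [h])) hab ha'
  · exact hF.Γ_un_zer_zero ha' hab

/-- The torsion has no components with precisely one index in a Darboux plane if that index is
unhatted. -/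
lemma T_un_off (hF : FrameEqs Γ T c x s s₀ ds) {a b : Idx n ε} {μ : Fin n}
    (ha : a ≠ un μ) (ha' : a ≠ hat μ) (hb : b ≠ un μ) (hb' : b ≠ hat μ) :
    T a b (un μ) = 0 := by
  rcases eq_or_ne a b with rfl | hab
  · exact hF.T_self₁₂ _ _
  have h := hF.bracket a b (un μ)
  rw [hF.c_un_zero ha hb, hF.skew a b, hF.skew b a, hF.Γ_un_off hab ha ha' hb hb',
    hF.Γ_un_off hab.symm hb hb' ha ha'] at h
  linarith

/-- Unless b = μ̂, both ν and b lie outside the μ-plane or b = μ. If b = μ̂, then b ≠ ν̂ and the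
roles of μ and ν are exchanged. -/
lemma T_un_un (hF : FrameEqs Γ T c x s s₀ ds) (b : Idx n ε) {μ ν : Fin n} (h : μ ≠ ν) :
    T (un μ) (un ν) b = 0 := by
  have key : ∀ (b : Idx n ε) {μ ν : Fin n}, μ ≠ ν → b ≠ hat μ → T (un μ) (un ν) b = 0 := by
    intro b μ ν h hb
    rcases eq_or_ne b (un μ) with rfl | hb'
    · exact hF.T_self₁₃ _ _
    rw [hF.T_swap₁₂, hF.T_swap₂₃, hF.T_un_off (a := un ν) (b := b)]
    · simp
    · simpa using h.symm
    · simp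
    · exact hb'
    · exact hb
  rcases eq_or_ne b (hat μ) with rfl | hb
  · rw [hF.T_swap₁₂, key _ h.symm (by simpa using h), neg_zero]
  · exact key b h hb

/-- The inhomogeneous terms for hatted pairs are supported on unhatted derivative directions. Two
labels `zer` coincide since ε ≤ 1, and skewness covers that case. -/
lemma Γ_hat_off (hF : FrameEqs Γ T c x s s₀ ds) (i j k : Fin n ⊕ Fin ε) (hε : ε ≤ 1) :
    Γ (Sum.inr i) (Sum.inr j) (Sum.inr k) = 0 := by
  rcases eq_or_ne j k with rfl | hjk
  · exact hF.Γ_self _ _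
  rcases j with j | j <;> rcases k with k | k
  · exact hF.Γ_hat_hat_zero (fun h ↦ hjk (by rw [h])) (by simp) (by simp)
  · exact hF.Γ_hat_zer_zero (by simp)
  · rw [hF.skew, neg_eq_zero]; exact hF.Γ_hat_zer_zero (by simp)
  · exact absurd (by congr 1; apply Fin.ext; omega) hjk

/-- The hatted vector fields bracket to minus the torsion. -/
lemma c_hat_hat_hat (hF : FrameEqs Γ T c x s s₀ ds) (hε : ε ≤ 1) (i j k : Fin n ⊕ Fin ε) :
    c (Sum.inr i) (Sum.inr j) (Sum.inr k) = - T (Sum.inr i) (Sum.inr j) (Sum.inr k) := by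
  rw [hF.bracket, hF.Γ_hat_off _ _ _ hε, hF.Γ_hat_off _ _ _ hε]; ring

/-- Only Γ_{ν̂μν̂} contributes: Γ_{μν̂ν̂} vanishes by skewness and the torsion by its repeated
index. -/
lemma c_un_hat_self (hF : FrameEqs Γ T c x s s₀ ds) {μ ν : Fin n} (h : μ ≠ ν) :
    c (un μ) (hat ν) (hat ν) * (x μ ^ 2 - x ν ^ 2) = - x μ * s μ := by
  have h1 := hF.Γ_un_hat (hat ν) h
  rw [if_pos rfl, if_neg (by simpa using h.symm)] at h1
  rw [hF.bracket, hF.Γ_self, hF.T_self₂₃]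
  linear_combination -h1

lemma c_un_zer_self (hF : FrameEqs Γ T c x s s₀ ds) (μ : Fin n) (k : Fin ε) :
    c (un μ) (zer k) (zer k) * x μ ^ 2 = - x μ * s μ := by
  have h1 := hF.hat_zer (zer k) μ k
  rw [if_neg (by simp), if_pos rfl] at h1
  rw [hF.bracket, hF.Γ_self, hF.T_self₂₃, hF.skew]
  linear_combination x μ * h1

/-- `[e_μ, e_i]` is proportional to `e_i` for hatted `i ≠ μ`. -/
lemma c_un_hat_off (hF : FrameEqs Γ T c x s s₀ ds) (hε : ε ≤ 1) {μ : Fin n} {i : Fin n ⊕ Fin ε}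
    (hi : i ≠ Sum.inl μ) {b : Idx n ε} (hb : b ≠ Sum.inr i) :
    c (un μ) (Sum.inr i) b = 0 := by
  have hi' : (Sum.inr i : Idx n ε) ≠ hat μ := fun h ↦ hi (Sum.inr_injective h)
  rcases b with ν | j
  · rcases eq_or_ne ν μ with rfl | hνμ
    · -- `b = un μ`
      rw [hF.bracket, hF.T_self₁₃, hF.Γ_self, hF.skew]
      rcases i with ν' | k
      · have : ν ≠ ν' := fun h ↦ hi (by rw [h])
        rw [hF.Γ_un_hat_zero this (by simp) (by simp)]; ring
      · rw [hF.Γ_un_zer_zero (by simp) (by simp)]; ring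
    · exact hF.c_un_zero (by simpa using hνμ.symm) (by simp)
  · have hji : j ≠ i := fun h ↦ hb (by rw [h])
    rcases eq_or_ne j (Sum.inl μ) with rfl | hj
    · -- `b = hat μ`
      have h0 : c (hat μ) (Sum.inr i) (un μ) = 0 := hF.c_un_zero (by simp) (by simp)
      rw [hF.bracket] at h0
      -- The coefficient Γ_{iμμ̂} is undetermined and T_{μiμ̂} need not vanish. Both cancel when the
      -- known zero c(μ̂, i, μ) is added to c(μ, i, μ̂), so only this sum of two determined
      -- coefficients is needed.
      have h2 : Γ (un μ) (Sum.inr i) (hat μ) + Γ (hat μ) (Sum.inr i) (un μ) = 0 := by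
        rcases i with ν | k
        · have hν : μ ≠ ν := fun h ↦ hi (by rw [h])
          have g1 := hF.Γ_hat_hat (un μ) hν
          have g2 := hF.Γ_un_hat (hat μ) hν
          rw [if_pos rfl, if_neg (by simpa using hν)] at g1
          rw [if_neg (by simpa using hν), if_pos rfl] at g2
          rw [hF.skew (un μ), hF.skew (hat μ)]
          apply hF.eq_zero_of_mul hν
          linear_combination - g1 - g2
        · have g1 := hF.un_zer (un μ) μ k
          have g2 := hF.hat_zer (hat μ) μ k
          rw [if_pos rfl] at g1
          rw [if_pos rfl, if_neg (by simp)] at g2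
          apply (mul_eq_zero.1 (?_ : x μ * _ = 0)).resolve_left (hF.x_ne μ)
          linear_combination - g1 + g2
      rw [hF.bracket]
      rw [hF.skew (Sum.inr i) (hat μ) (un μ)] at h0
      have t1 : T (hat μ) (Sum.inr i) (un μ) = - T (un μ) (Sum.inr i) (hat μ) := by
        rw [hF.T_swap₁₂, hF.T_swap₂₃, hF.T_swap₁₂]
        ring
      linear_combination h2 - h0 - t1
    · -- `b` is a hatted index different from `μ` and `i`
      have hj' : (Sum.inr j : Idx n ε) ≠ hat μ := fun h ↦ hj (Sum.inr_injective h)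
      rw [hF.bracket, hF.Γ_un_off (by simpa using hji.symm) (by simp) hi' (by simp) hj',
        hF.T_swap₁₂, hF.T_swap₂₃, hF.T_un_off (by simp) hi' (by simp) hj']
      have : Γ (un μ) (Sum.inr i) (Sum.inr j) = 0 := by
        rcases i with ν | k <;> rcases j with ν' | k'
        · exact hF.Γ_hat_hat_zero (fun h ↦ hji (by rw [h]))
            (fun h ↦ hi (by rw [Sum.inl_injective h])) (fun h ↦ hj (by rw [Sum.inl_injective h]))
        · exact hF.Γ_hat_zer_zero (fun h ↦ hi (by rw [Sum.inl_injective h]))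
        · rw [hF.skew, neg_eq_zero]
          exact hF.Γ_hat_zer_zero (fun h ↦ hj (by rw [Sum.inl_injective h]))
        · exact absurd (by congr 1; apply Fin.ext; omega) hji
      rw [this]; ring

/-- `s μ` is constant along the hatted directions other than `μ`. -/
lemma ds_off (hF : FrameEqs Γ T c x s s₀ ds) (hε : ε ≤ 1) {μ : Fin n} {i : Fin n ⊕ Fin ε}
    (hi : i ≠ Sum.inl μ) : ds μ (Sum.inr i) = 0 := by
  have h := hF.closed (un μ) (Sum.inr i) μ
  rw [hF.c_un_hat_off hε hi (by simp), if_neg (by simp), if_pos rfl] at h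
  linarith

end FrameEqs

end FrameAlgebra

/-! ### Smooth orthonormal frames and their structure functions. -/

section Frames

variable {D : ℕ} {M : Type*} [TopologicalSpace M] [ChartedSpace (EuclideanSpace ℝ (Fin D)) M]
  [IsManifold (𝓡 D) ∞ M] [RiemannianBundle (fun p : M ↦ TangentSpace (𝓡 D) p)]

/-- A smooth orthonormal frame on an open set. -/
structure IsONFrame {ι : Type*} [Fintype ι] [DecidableEq ι] (E : ι → VecField D M) (U : Set M) :
    Prop where
  isOpen : IsOpen U
  smooth : ∀ q ∈ U, ∀ a, SmoothField (E a) q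
  inner_eq : ∀ q ∈ U, ∀ a b, inner ℝ (E a q) (E b q) = if a = b then 1 else 0
  card : Fintype.card ι = D

/-- The structure functions of a frame. -/
noncomputable def structFun {ι : Type*} (E : ι → VecField D M) (a b d : ι) (q : M) : ℝ :=
  inner ℝ (mlieBracket (𝓡 D) (E a) (E b) q) (E d q)

/-- The connection coefficients `g(∇ᵀ_a e_b, e_d)` of a frame. -/
noncomputable def connFun (T : Form D M 3) {ι : Type*} (E : ι → VecField D M) (a b d : ι) (q : M) :
    ℝ :=
  inner ℝ (nablaT T (E b) q (E a q)) (E d q)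

namespace IsONFrame

variable {ι : Type*} [Fintype ι] [DecidableEq ι] {E : ι → VecField D M} {U : Set M}

lemma orthonormal (hE : IsONFrame E U) {q : M} (hq : q ∈ U) :
    Orthonormal ℝ (fun a ↦ E a q) :=
  orthonormal_iff_ite.2 (hE.inner_eq q hq)

/-- The frame as an orthonormal basis at a point. -/
noncomputable def basis (hE : IsONFrame E U) {q : M} (hq : q ∈ U) :
    OrthonormalBasis ι ℝ (TangentSpace (𝓡 D) q) :=
  OrthonormalBasis.mk (hE.orthonormal hq) (by
    rw [(hE.orthonormal hq).linearIndependent.span_eq_top_of_card_eq_finrank'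
      (by rw [finrank_tangentSpace, hE.card])])

@[simp] lemma basis_apply (hE : IsONFrame E U) {q : M} (hq : q ∈ U) (a : ι) :
    hE.basis hq a = E a q := by
  simp [basis]

lemma sum_inner_smul (hE : IsONFrame E U) {q : M} (hq : q ∈ U) (v : TangentSpace (𝓡 D) q) :
    ∑ a, inner ℝ (E a q) v • E a q = v := by
  simpa using (hE.basis hq).sum_repr' v

lemma bracket_eq (hE : IsONFrame E U) {q : M} (hq : q ∈ U) (a b : ι) :
    mlieBracket (𝓡 D) (E a) (E b) q = ∑ d, structFun E a b d q • E d q := by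
  conv_lhs => rw [← hE.sum_inner_smul hq (mlieBracket (𝓡 D) (E a) (E b) q)]
  simp only [structFun, real_inner_comm]

lemma eventually_mem (hE : IsONFrame E U) {q : M} (hq : q ∈ U) : ∀ᶠ r in nhds q, r ∈ U :=
  hE.isOpen.mem_nhds hq

lemma eventually_smooth (hE : IsONFrame E U) {q : M} (hq : q ∈ U) (a : ι) :
    ∀ᶠ r in nhds q, SmoothField (E a) r := by
  filter_upwards [hE.eventually_mem hq] with r hr using hE.smooth r hr a

lemma dirDeriv_inner (hE : IsONFrame E U) {q : M} (hq : q ∈ U) (a b : ι)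
    (v : TangentSpace (𝓡 D) q) : dirDeriv (fun r ↦ inner ℝ (E a r) (E b r)) q v = 0 := by
  rw [dirDeriv_congr (g := fun _ ↦ if a = b then (1 : ℝ) else 0), dirDeriv_const]
  filter_upwards [hE.eventually_mem hq] with r hr using hE.inner_eq r hr a b

lemma mlieBracket_sum_smul (hE : IsONFrame E U) {q : M} (hq : q ∈ U) (X : VecField D M)
    {f : ι → M → ℝ} (hf : ∀ a, SmoothFun D (f a) q) :
    mlieBracket (𝓡 D) X (fun r ↦ ∑ a, f a r • E a r) q =
      ∑ a, (dirDeriv (f a) q (X q) • E a q + f a q • mlieBracket (𝓡 D) X (E a) q) := by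
  have key : ∀ s : Finset ι, mlieBracket (𝓡 D) X (fun r ↦ ∑ a ∈ s, f a r • E a r) q =
      ∑ a ∈ s, (dirDeriv (f a) q (X q) • E a q + f a q • mlieBracket (𝓡 D) X (E a) q) := by
    intro s
    induction s using Finset.induction_on with
    | empty =>
      simp only [Finset.sum_empty]
      have := congrFun (mlieBracket_zero_right (I := 𝓡 D) (W := X)) q
      exact this
    | insert a s ha ih =>
      simp only [Finset.sum_insert ha]
      rw [← ih, ← mlieBracket_smul_right' (hf a).diff (hE.smooth q hq a).diff]
      have h1 := ((hE.smooth q hq a).smul (hf a)).diff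
      have h2 := (SmoothField.sum (s := s) fun b _ ↦ (hE.smooth q hq b).smul (hf b)).diff
      exact mlieBracket_add_right h1 h2
  exact key Finset.univ

variable [IsContMDiffRiemannianBundle (𝓡 D) ∞ (EuclideanSpace ℝ (Fin D))
      (fun p : M ↦ TangentSpace (𝓡 D) p)]

lemma structFun_smooth (hE : IsONFrame E U) {q : M} (hq : q ∈ U) (a b d : ι) :
    SmoothFun D (structFun E a b d) q :=
  ((hE.smooth q hq a).lieBracket (hE.smooth q hq b)).innerFun (hE.smooth q hq d)

lemma connFun_skew (hE : IsONFrame E U) {q : M} (hq : q ∈ U) (T : Form D M 3) (a b d : ι) :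
    connFun T E a b d q = - connFun T E a d b q := by
  have h := koszul_compat (E a) (E b) (E d) q
  rw [hE.dirDeriv_inner hq] at h
  have hs := fun a ↦ (hE.smooth q hq a).diff
  unfold connFun
  rw [inner_nablaT T (hs a) (hs b) (hs d), inner_nablaT T (hs a) (hs d) (hs b),
    form₃_swap₂₃ (T q) (E a q) (E b q) (E d q)]
  linarith

lemma structFun_eq (hE : IsONFrame E U) {q : M} (hq : q ∈ U) (T : Form D M 3) (a b d : ι) :
    structFun E a b d q = connFun T E a b d q - connFun T E b a d q
      - T q ![E a q, E b q, E d q] := by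
  have h := koszul_swap (E a) (E b) (E d) q
  have hs := fun a ↦ (hE.smooth q hq a).diff
  unfold connFun structFun
  rw [inner_nablaT T (hs a) (hs b) (hs d), inner_nablaT T (hs b) (hs a) (hs d),
    form₃_swap₁₂ (T q) (E a q) (E b q) (E d q)]
  linarith

lemma nablaTForm_frame (hE : IsONFrame E U) {q : M} (hq : q ∈ U) (T : Form D M 3) {h : Form D M 2}
    (hh : IsSmoothForm h) (a b c : ι) :
    nablaTForm T h q (E a q) (E b q) (E c q) =
      dirDeriv (fun r ↦ h r ![E b r, E c r]) q (E a q)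
      - ∑ d, connFun T E a b d q * h q ![E d q, E c q]
      - ∑ d, connFun T E a c d q * h q ![E b q, E d q] := by
  have hs := fun a ↦ (hE.smooth q hq a).diff
  rw [nablaTForm_eq T hh (E a q) (hs b) (hs c)]
  conv_lhs => rw [← hE.sum_inner_smul hq (nablaT T (E b) q (E a q)),
    ← hE.sum_inner_smul hq (nablaT T (E c) q (E a q))]
  simp only [← bil_apply, map_sum, map_smul, LinearMap.sum_apply, LinearMap.smul_apply, smul_eq_mul]
  simp only [connFun, real_inner_comm]

lemma inner_mlieBracket_mlieBracket (hE : IsONFrame E U) {q : M} (hq : q ∈ U) (a b c d : ι) :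
    inner ℝ (mlieBracket (𝓡 D) (E a) (mlieBracket (𝓡 D) (E b) (E c)) q) (E d q) =
      dirDeriv (structFun E b c d) q (E a q) + ∑ k, structFun E b c k q * structFun E a k d q := by
  have e : mlieBracket (𝓡 D) (E b) (E c) =ᶠ[nhds q] fun r ↦ ∑ k, structFun E b c k r • E k r := by
    filter_upwards [hE.eventually_mem hq] with r hr using hE.bracket_eq hr b c
  have h := (Filter.EventuallyEq.mlieBracket_vectorField_eq
    (Filter.EventuallyEq.refl _ (E a)) e).trans
    (hE.mlieBracket_sum_smul hq _ (fun k ↦ hE.structFun_smooth hq b c k))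
  rw [h, sum_inner]
  simp only [inner_add_left, inner_smul_left, conj_trivial, Finset.sum_add_distrib,
    hE.inner_eq q hq]
  congr 1
  simp

/-- The Jacobi identity for the structure functions of a frame. -/
lemma jacobi (hE : IsONFrame E U) {q : M} (hq : q ∈ U) (a b c d : ι) :
    (dirDeriv (structFun E b c d) q (E a q) + ∑ k, structFun E b c k q * structFun E a k d q) +
    (dirDeriv (structFun E c a d) q (E b q) + ∑ k, structFun E c a k q * structFun E b k d q) +
    (dirDeriv (structFun E a b d) q (E c q) + ∑ k, structFun E a b k q * structFun E c k d q)
      = 0 := by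
  have h3 : IsManifold (𝓡 D) (minSmoothness ℝ 3) M := by
    rw [minSmoothness_of_isRCLikeNormedField]
    exact IsManifold.of_le (n := ∞) (WithTop.coe_le_coe.2 le_top)
  have h2 : minSmoothness ℝ 2 ≤ ∞ := by
    rw [minSmoothness_of_isRCLikeNormedField]; exact WithTop.coe_le_coe.2 le_top
  have J := leibniz_identity_mlieBracket_apply (I := 𝓡 D) (U := E a) (V := E b)
    (W := E c) ((hE.smooth q hq a).of_le h2) ((hE.smooth q hq b).of_le h2)
    ((hE.smooth q hq c).of_le h2)
  have e : mlieBracket (𝓡 D) (E b) (mlieBracket (𝓡 D) (E c) (E a)) q =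
      - mlieBracket (𝓡 D) (E b) (mlieBracket (𝓡 D) (E a) (E c)) q := by
    have h1 := mlieBracket_const_smul_right (I := 𝓡 D) (c := (-1 : ℝ)) (V := E b)
      ((hE.smooth q hq a).lieBracket (hE.smooth q hq c)).diff
    rw [mlieBracket_swap (V := E c) (W := E a)]
    simpa using h1
  rw [← hE.inner_mlieBracket_mlieBracket hq, ← hE.inner_mlieBracket_mlieBracket hq,
    ← hE.inner_mlieBracket_mlieBracket hq, J, e,
    mlieBracket_swap_apply (V := E c), ← inner_add_left, ← inner_add_left]
  convert inner_zero_left _ using 2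
  abel

/-- The commutator identity for the second derivatives of a function in a frame. -/
lemma dirDeriv_comm (hE : IsONFrame E U) {q : M} (hq : q ∈ U) {f : M → ℝ}
    (hf : ∀ r ∈ U, SmoothFun D f r) (a b : ι) :
    ∑ d, structFun E a b d q * dirDeriv f q (E d q) =
      dirDeriv (fun r ↦ dirDeriv f r (E b r)) q (E a q)
        - dirDeriv (fun r ↦ dirDeriv f r (E a r)) q (E b q) := by
  rw [← dirDeriv_mlieBracket (hE.eventually_smooth hq a) (hE.eventually_smooth hq b),
    hE.bracket_eq hq, dirDeriv_sum]
  · simp only [dirDeriv_smul]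
  · filter_upwards [hE.eventually_mem hq] with r hr using hf r hr

end IsONFrame

/-! ### Existence of local orthonormal frames. -/

section GramSchmidt

variable [IsContMDiffRiemannianBundle (𝓡 D) ∞ (EuclideanSpace ℝ (Fin D))
      (fun p : M ↦ TangentSpace (𝓡 D) p)]

open InnerProductSpace in
lemma exists_isONFrame (p : M) :
    ∃ (E : Fin D → VecField D M) (U : Set M), IsONFrame E U ∧ p ∈ U := by
  let e := (onb (D := D) p).reindex (finCongr (finrank_tangentSpace p))
  let G : Fin D → VecField D M := fun a q ↦ gramSchmidt ℝ (fun b ↦ ext (e b) q) a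
  have hG0 : ∀ a, G a p ≠ 0 := fun a ↦ by
    have : (fun b ↦ ext (e b) p) = e := by funext b; simp
    simp only [G, this]
    exact gramSchmidt_ne_zero a e.orthonormal.linearIndependent
  have hG : ∀ a, ∀ᶠ q in nhds p, SmoothField (G a) q ∧ inner ℝ (G a q) (G a q) ≠ 0 := by
    intro a
    -- The Gram–Schmidt recursion divides by the square norms of the earlier vectors, so smoothness
    -- and non-vanishing near `p` are proved together by strong induction.
    induction a using WellFoundedLT.induction with
    | _ a ih =>
      have h1 : ∀ᶠ q in nhds p, ∀ b ∈ Finset.Iio a,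
          SmoothField (G b) q ∧ inner ℝ (G b q) (G b q) ≠ 0 := by
        rw [Filter.eventually_all_finset]
        intro b hb
        exact ih b (by simpa using hb)
      have h2 : ∀ᶠ q in nhds p, SmoothField (G a) q := by
        filter_upwards [h1, eventually_smoothField_ext (e a)] with q hq hq'
        have : G a = fun r ↦ ext (e a) r - ∑ b ∈ Finset.Iio a,
            (inner ℝ (G b r) (ext (e a) r) * (inner ℝ (G b r) (G b r))⁻¹) • G b r := by
          funext r
          simp only [G]
          rw [gramSchmidt_def]
          congr 1
          refine Finset.sum_congr rfl fun b _ ↦ ?_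
          rw [Submodule.starProjection_singleton, ← real_inner_self_eq_norm_sq, div_eq_mul_inv]
          rfl
        rw [this]
        refine hq'.sub (SmoothField.sum fun b hb ↦ ?_)
        have := hq b hb
        exact this.1.smul ((this.1.innerFun hq').mul ((this.1.innerFun this.1).inv this.2))
      have hp := h2.self_of_nhds
      have h3 := (hp.innerFun hp).continuousAt.eventually_ne (inner_self_ne_zero.2 (hG0 a))
      filter_upwards [h2, h3] with q hq hq'
      exact ⟨hq, hq'⟩
  have hall := Filter.eventually_all.2 hG
  obtain ⟨U, hU, hUo, hpU⟩ := eventually_nhds_iff.1 hall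
  refine ⟨fun a q ↦ (√(inner ℝ (G a q) (G a q)))⁻¹ • G a q, U, ⟨hUo, ?_, ?_, by simp⟩, hpU⟩
  · intro q hq a
    have := hU q hq a
    refine this.1.smul (((this.1.innerFun this.1).sqrt this.2).inv ?_)
    exact (Real.sqrt_pos.2 (lt_of_le_of_ne real_inner_self_nonneg this.2.symm)).ne'
  · intro q hq a b
    rw [inner_smul_left, inner_smul_right]
    split_ifs with h
    · subst h
      have h1 : 0 < inner ℝ (G a q) (G a q) :=
        lt_of_le_of_ne real_inner_self_nonneg (hU q hq a).2.symm
      have h2 := Real.sq_sqrt h1.le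
      have h3 := (Real.sqrt_pos.2 h1).ne'
      simp only [conj_trivial]
      field_simp
      exact h2.symm
    · have : inner ℝ (G a q) (G b q) = 0 := gramSchmidt_orthogonal ℝ _ h
      rw [this]; simp

end GramSchmidt

end Frames

/-! ### Adapted frames: first-order equations and the Jacobi identity. -/

section Adapted

variable {D : ℕ} {M : Type*} [TopologicalSpace M] [ChartedSpace (EuclideanSpace ℝ (Fin D)) M]
  [IsManifold (𝓡 D) ∞ M] [RiemannianBundle (fun p : M ↦ TangentSpace (𝓡 D) p)]

/-- The components of a 2-form `∑ x_μ e^μ ∧ e^μ̂`. -/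
def darbouxMat {n ε : ℕ} (x : Fin n → ℝ) : Idx n ε → Idx n ε → ℝ
  | Sum.inl μ, Sum.inr (Sum.inl ν) => if μ = ν then x μ else 0
  | Sum.inr (Sum.inl μ), Sum.inl ν => if μ = ν then - x μ else 0
  | _, _ => 0

/-- Only the trace part X♭ ∧ ξ of the GCKY equation survives. The equation enters every later
argument in this form. -/
lemma nablaTForm_of_closed {T : Form D M 3} {h : Form D M 2} (hg : IsGCKY T h)
    (hc : ∀ (p : M) (u v w : TangentSpace (𝓡 D) p), dT T h p u v w = 0) (p : M)
    (u v w : TangentSpace (𝓡 D) p) :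
    nablaTForm T h p u v w = inner ℝ u v * assocForm T h p w - inner ℝ u w * assocForm T h p v := by
  rw [hg, hc]
  simp only [assocForm]
  ring

/-- A smooth orthonormal frame on an open set in which `h` has Darboux form, with eigenvalues whose
differentials are dual to the frame and to the associated 1-form. -/
structure IsAdaptedFrame {n ε : ℕ} (T : Form D M 3) (h : Form D M 2) (E : Idx n ε → VecField D M)
    (U : Set M) (x s : Fin n → M → ℝ) : Prop where
  frame : IsONFrame E U
  x_smooth : ∀ q ∈ U, ∀ μ, SmoothFun D (x μ) q
  s_smooth : ∀ q ∈ U, ∀ μ, SmoothFun D (s μ) q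
  x_ne : ∀ q ∈ U, ∀ μ, x μ q ≠ 0
  x_sq_ne : ∀ q ∈ U, ∀ μ ν, μ ≠ ν → x μ q ^ 2 - x ν q ^ 2 ≠ 0
  s_ne : ∀ q ∈ U, ∀ μ, s μ q ≠ 0
  darboux : ∀ q ∈ U, ∀ a b, h q ![E a q, E b q] = darbouxMat (fun μ ↦ x μ q) a b
  assoc_un : ∀ q ∈ U, ∀ μ, assocForm T h q (E (un μ) q) = 0
  assoc_hat : ∀ q ∈ U, ∀ μ, assocForm T h q (E (hat μ) q) = s μ q
  deriv_x : ∀ q ∈ U, ∀ μ a, dirDeriv (x μ) q (E a q) = if a = un μ then s μ q else 0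

namespace IsAdaptedFrame

variable {n ε : ℕ} {T : Form D M 3} {h : Form D M 2} {E : Idx n ε → VecField D M}
    {U : Set M} {x s : Fin n → M → ℝ}

/-- The eigenvalue attached to a hatted index. -/
def hatVal {n ε : ℕ} {M : Type*} (x : Fin n → M → ℝ) : Fin n ⊕ Fin ε → M → ℝ
  | Sum.inl μ => x μ
  | Sum.inr _ => fun _ ↦ 0

lemma hatVal_sq_ne (hA : IsAdaptedFrame T h E U x s) {q : M} (hq : q ∈ U) {μ : Fin n}
    {i : Fin n ⊕ Fin ε} (hi : i ≠ Sum.inl μ) : x μ q ^ 2 - hatVal x i q ^ 2 ≠ 0 := by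
  rcases i with ν | k
  · exact hA.x_sq_ne q hq _ _ (fun h ↦ hi (by rw [h]))
  · simpa [hatVal] using hA.x_ne q hq μ

lemma hatVal_smooth (hA : IsAdaptedFrame T h E U x s) {q : M} (hq : q ∈ U)
    (i : Fin n ⊕ Fin ε) : SmoothFun D (hatVal x i) q := by
  rcases i with ν | k
  · exact hA.x_smooth q hq ν
  · exact contMDiffAt_const

lemma dirDeriv_hatVal (hA : IsAdaptedFrame T h E U x s) {q : M} (hq : q ∈ U)
    (i j : Fin n ⊕ Fin ε) : dirDeriv (hatVal x i) q (E (Sum.inr j) q) = 0 := by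
  rcases i with ν | k
  · simp [hatVal, hA.deriv_x q hq ν]
  · exact dirDeriv_const _ _ _

end IsAdaptedFrame

variable [IsContMDiffRiemannianBundle (𝓡 D) ∞ (EuclideanSpace ℝ (Fin D))
      (fun p : M ↦ TangentSpace (𝓡 D) p)]

/-- The components of ∇ᵀ_X h = X♭ ∧ ξ, the source of all linear relations for Γ and of the
differentials of the eigenvalues. -/
lemma IsONFrame.gcky_frame {ι : Type*} [Fintype ι] [DecidableEq ι] {E : ι → VecField D M}
    {U : Set M} (hE : IsONFrame E U) {q : M} (hq : q ∈ U) {T : Form D M 3} {h : Form D M 2}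
    (hh : IsSmoothForm h) (hg : IsGCKY T h)
    (hc : ∀ (p : M) (u v w : TangentSpace (𝓡 D) p), dT T h p u v w = 0) (a b c : ι) :
    dirDeriv (fun r ↦ h r ![E b r, E c r]) q (E a q)
      - ∑ d, connFun T E a b d q * h q ![E d q, E c q]
      - ∑ d, connFun T E a c d q * h q ![E b q, E d q] =
    (if a = b then assocForm T h q (E c q) else 0)
      - (if a = c then assocForm T h q (E b q) else 0) := by
  rw [← hE.nablaTForm_frame hq T hh, nablaTForm_of_closed hg hc, hE.inner_eq q hq,
    hE.inner_eq q hq]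
  simp only [ite_mul, one_mul, zero_mul]

namespace IsAdaptedFrame

variable {n ε : ℕ} {T : Form D M 3} {h : Form D M 2} {E : Idx n ε → VecField D M}
    {U : Set M} {x s : Fin n → M → ℝ}

lemma frameEqs (hA : IsAdaptedFrame T h E U x s) (hh : IsSmoothForm h) (hg : IsGCKY T h)
    (hc : ∀ (p : M) (u v w : TangentSpace (𝓡 D) p), dT T h p u v w = 0) {q : M} (hq : q ∈ U) :
    FrameEqs (fun a b d ↦ connFun T E a b d q) (fun a b d ↦ T q ![E a q, E b q, E d q])
      (fun a b d ↦ structFun E a b d q) (fun μ ↦ x μ q) (fun μ ↦ s μ q)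
      (fun k ↦ assocForm T h q (E (zer k) q)) (fun μ a ↦ dirDeriv (s μ) q (E a q)) := by
  have N := hA.frame.gcky_frame hq hh hg hc
  have hd : ∀ b c, (∀ y : Fin n → ℝ, darbouxMat y b c = 0) →
      ∀ v : TangentSpace (𝓡 D) q,
      dirDeriv (fun r ↦ h r ![E b r, E c r]) q v = 0 := by
    intro b c hbc v
    rw [dirDeriv_congr (g := fun _ ↦ 0), dirDeriv_const]
    filter_upwards [hA.frame.eventually_mem hq] with r hr
    rw [hA.darboux r hr, hbc]
  simp only [hA.darboux q hq] at N
  refine ⟨fun a b d ↦ hA.frame.connFun_skew hq T a b d, fun a b d ↦ form₃_swap₁₂ _ _ _ _,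
    fun a b d ↦ form₃_swap₂₃ _ _ _ _, fun a b d ↦ hA.frame.structFun_eq hq T a b d,
    hA.x_ne q hq, hA.x_sq_ne q hq, hA.s_ne q hq, ?_, ?_, ?_, ?_, ?_, ?_⟩
  · intro a μ ν hμν
    have := N a (un μ) (un ν)
    rw [hd _ _ (by simp [darbouxMat])] at this
    simp [Fintype.sum_sum_type, darbouxMat, hA.assoc_un q hq] at this
    linarith
  · intro a μ ν hμν
    have := N a (hat μ) (hat ν)
    rw [hd _ _ (by simp [darbouxMat])] at this
    simp [Fintype.sum_sum_type, darbouxMat, hA.assoc_hat q hq] at this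
    simp only [hA.frame.connFun_skew hq T a (un _) (hat _)]
    linarith
  · intro a μ ν hμν
    have := N a (un μ) (hat ν)
    rw [hd _ _ (by simp [darbouxMat, hμν])] at this
    simp [Fintype.sum_sum_type, darbouxMat, hA.assoc_un q hq, hA.assoc_hat q hq] at this
    simp only [hA.frame.connFun_skew hq T a (hat μ) (hat ν)]
    linarith
  · intro a μ k
    have := N a (un μ) (zer k)
    rw [hd _ _ (by simp [darbouxMat])] at this
    simp [Fintype.sum_sum_type, darbouxMat, hA.assoc_un q hq] at this
    linarith
  · intro a μ k
    have := N a (hat μ) (zer k)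
    rw [hd _ _ (by simp [darbouxMat])] at this
    simp [Fintype.sum_sum_type, darbouxMat, hA.assoc_hat q hq] at this
    linarith
  · intro a b μ
    -- The second derivatives of x_μ reduce to first derivatives of s_μ. Inserted into the
    -- commutator identity for x_μ, they express that s_μ e^μ is closed.
    have hd : ∀ a b : Idx n ε, dirDeriv (fun r ↦ dirDeriv (x μ) r (E b r)) q (E a q) =
        if b = un μ then dirDeriv (s μ) q (E a q) else 0 := by
      intro a b
      rw [dirDeriv_congr (g := fun r ↦ if b = un μ then s μ r else 0)]
      · split_ifs with h
        · rfl
        · exact dirDeriv_const _ _ _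
      · filter_upwards [hA.frame.eventually_mem hq] with r hr using hA.deriv_x r hr μ b
    have := hA.frame.dirDeriv_comm hq (f := x μ) (fun r hr ↦ hA.x_smooth r hr μ) a b
    rw [hd, hd] at this
    simpa [hA.deriv_x q hq] using this

lemma structFun_un_hat_self (hA : IsAdaptedFrame T h E U x s) (hh : IsSmoothForm h)
    (hg : IsGCKY T h) (hc : ∀ (p : M) (u v w : TangentSpace (𝓡 D) p), dT T h p u v w = 0)
    {q : M} (hq : q ∈ U) {μ : Fin n} {i : Fin n ⊕ Fin ε} (hi : i ≠ Sum.inl μ) :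
    structFun E (un μ) (Sum.inr i) (Sum.inr i) q * (x μ q ^ 2 - hatVal x i q ^ 2) =
      - x μ q * s μ q := by
  have hF := hA.frameEqs hh hg hc hq
  rcases i with ν | k
  · exact hF.c_un_hat_self (fun h ↦ hi (by rw [h]))
  · simpa [hatVal] using hF.c_un_zer_self μ k

/-- The function `a` with `[e_μ, e_i] = a e_i` is constant along the hatted directions different
from `μ`. -/
lemma dirDeriv_structFun_un_hat (hA : IsAdaptedFrame T h E U x s) (hε : ε ≤ 1)
    (hh : IsSmoothForm h)
    (hg : IsGCKY T h) (hc : ∀ (p : M) (u v w : TangentSpace (𝓡 D) p), dT T h p u v w = 0)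
    {q : M} (hq : q ∈ U) {μ : Fin n} {i j : Fin n ⊕ Fin ε} (hi : i ≠ Sum.inl μ)
    (hj : j ≠ Sum.inl μ) :
    dirDeriv (structFun E (un μ) (Sum.inr i) (Sum.inr i)) q (E (Sum.inr j) q) = 0 := by
  have hx := (hA.x_smooth q hq μ)
  have hy := hA.hatVal_smooth hq i
  have hs := hA.s_smooth q hq μ
  have hcs := hA.frame.structFun_smooth hq (un μ) (Sum.inr i) (Sum.inr i)
  -- Differentiating this identity along e_j leaves only the derivative of the structure function,
  -- because x_μ, the eigenvalue of i and s_μ are all constant in that direction.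
  have e : (fun r ↦ structFun E (un μ) (Sum.inr i) (Sum.inr i) r *
      (x μ r * x μ r - hatVal x i r * hatVal x i r)) =ᶠ[nhds q] fun r ↦ - (x μ r * s μ r) := by
    filter_upwards [hA.frame.eventually_mem hq] with r hr
    have := hA.structFun_un_hat_self hh hg hc hr hi
    linarith
  have key := dirDeriv_congr e (E (Sum.inr j) q)
  have hxx := (hx.mul hx).diff
  have hyy := (hy.mul hy).diff
  rw [dirDeriv_mul_fun hcs.diff (DiffFun.sub hxx hyy), dirDeriv_sub_fun hxx hyy,
    dirDeriv_mul_fun hx.diff hx.diff, dirDeriv_mul_fun hy.diff hy.diff, dirDeriv_neg_fun,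
    dirDeriv_mul_fun hx.diff hs.diff, hA.dirDeriv_hatVal hq, hA.deriv_x q hq,
    (hA.frameEqs hh hg hc hq).ds_off hε hj] at key
  have h2 := hA.hatVal_sq_ne hq hi
  simp only [reduceCtorEq, if_false, mul_zero, add_zero, sub_zero, zero_add, neg_zero] at key
  exact (mul_eq_zero.1 key).resolve_left (by rw [← sq, ← sq]; exact h2)

lemma torsion_mul_structFun (hA : IsAdaptedFrame T h E U x s) (hε : ε ≤ 1) (hh : IsSmoothForm h)
    (hg : IsGCKY T h) (hc : ∀ (p : M) (u v w : TangentSpace (𝓡 D) p), dT T h p u v w = 0)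
    {q : M} (hq : q ∈ U) {μ : Fin n} {i j : Fin n ⊕ Fin ε} (hi : i ≠ Sum.inl μ)
    (hj : j ≠ Sum.inl μ) (hij : i ≠ j) :
    T q ![E (hat μ) q, E (Sum.inr i) q, E (Sum.inr j) q] *
      structFun E (un μ) (hat μ) (Sum.inr i) q = 0 := by
  have F := fun r (hr : r ∈ U) ↦ hA.frameEqs hh hg hc hr
  have J := hA.frame.jacobi hq (un μ) (Sum.inr i) (Sum.inr j) (Sum.inr i)
  have d1 : dirDeriv (structFun E (Sum.inr i) (Sum.inr j) (Sum.inr i)) q (E (un μ) q) = 0 := by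
    rw [dirDeriv_congr (g := fun _ ↦ 0), dirDeriv_const]
    filter_upwards [hA.frame.eventually_mem hq] with r hr
    have := (F r hr).c_hat_hat_hat hε i j i
    rw [(F r hr).T_self₁₃, neg_zero] at this
    exact this
  have d2 : dirDeriv (structFun E (Sum.inr j) (un μ) (Sum.inr i)) q (E (Sum.inr i) q) = 0 := by
    rw [dirDeriv_congr (g := fun _ ↦ 0), dirDeriv_const]
    filter_upwards [hA.frame.eventually_mem hq] with r hr
    have := (F r hr).c_swap (un μ) (Sum.inr j) (Sum.inr i)
    rw [(F r hr).c_un_hat_off hε hj (by simpa using hij), neg_zero] at this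
    exact this
  have G := F q hq
  -- [e_i, e_j] has no unhatted part. Among its hatted components only e_μ̂ can bracket with e_μ
  -- into e_i, apart from e_i itself, whose coefficient T_{iji} is zero.
  have s1 : ∑ k, structFun E (Sum.inr i) (Sum.inr j) k q * structFun E (un μ) k (Sum.inr i) q =
      - T q ![E (hat μ) q, E (Sum.inr i) q, E (Sum.inr j) q] *
        structFun E (un μ) (hat μ) (Sum.inr i) q := by
    rw [Fintype.sum_eq_single (hat μ)]
    · rw [G.c_hat_hat_hat hε i j (Sum.inl μ), form₃_swap₂₃, form₃_swap₁₂]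
      simp
    · rintro (ν | l) hk
      · rw [G.c_un_zero (by simp) (by simp), zero_mul]
      · have hl : l ≠ Sum.inl μ := fun h ↦ hk (by rw [h])
        rcases eq_or_ne l i with rfl | hli
        · rw [G.c_hat_hat_hat hε, G.T_self₁₃, neg_zero, zero_mul]
        · rw [G.c_un_hat_off hε hl (by simpa using hli.symm), mul_zero]
  have s2 : ∑ k, structFun E (Sum.inr j) (un μ) k q *
      structFun E (Sum.inr i) k (Sum.inr i) q = 0 := by
    refine Finset.sum_eq_zero fun k _ ↦ ?_
    rcases eq_or_ne k (Sum.inr j) with rfl | hk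
    · rw [G.c_hat_hat_hat hε i j i, G.T_self₁₃, neg_zero, mul_zero]
    · rw [G.c_swap, G.c_un_hat_off hε hj hk, neg_zero, zero_mul]
  have s3 : ∑ k, structFun E (un μ) (Sum.inr i) k q *
      structFun E (Sum.inr j) k (Sum.inr i) q = 0 := by
    refine Finset.sum_eq_zero fun k _ ↦ ?_
    rcases eq_or_ne k (Sum.inr i) with rfl | hk
    · rw [G.c_hat_hat_hat hε j i i, G.T_self₂₃, neg_zero, mul_zero]
    · rw [G.c_un_hat_off hε hi hk, zero_mul]
  rw [d1, d2, hA.dirDeriv_structFun_un_hat hε hh hg hc hq hi hj, s1, s2, s3] at J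
  linarith

lemma jacobi_torsion (hA : IsAdaptedFrame T h E U x s) (hε : ε ≤ 1) (hh : IsSmoothForm h)
    (hg : IsGCKY T h) (hc : ∀ (p : M) (u v w : TangentSpace (𝓡 D) p), dT T h p u v w = 0)
    {q : M} (hq : q ∈ U) {μ : Fin n} {i j : Fin n ⊕ Fin ε} (hi : i ≠ Sum.inl μ)
    (hj : j ≠ Sum.inl μ) (hij : i ≠ j) :
    - dirDeriv (fun r ↦ T r ![E (hat μ) r, E (Sum.inr i) r, E (Sum.inr j) r]) q (E (un μ) q)
      + (structFun E (un μ) (Sum.inr i) (Sum.inr i) q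
        - structFun E (un μ) (Sum.inr j) (Sum.inr j) q) *
          T q ![E (hat μ) q, E (Sum.inr i) q, E (Sum.inr j) q]
      + dirDeriv (structFun E (un μ) (hat μ) (Sum.inr j)) q (E (Sum.inr i) q)
      - ∑ l : Fin n ⊕ Fin ε, structFun E (un μ) (hat μ) (Sum.inr l) q *
          T q ![E (Sum.inr i) q, E (Sum.inr l) q, E (Sum.inr j) q] = 0 := by
  have F := fun r (hr : r ∈ U) ↦ hA.frameEqs hh hg hc hr
  have J := hA.frame.jacobi hq (un μ) (hat μ) (Sum.inr i) (Sum.inr j)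
  have d1 : dirDeriv (structFun E (hat μ) (Sum.inr i) (Sum.inr j)) q (E (un μ) q) =
      - dirDeriv (fun r ↦ T r ![E (hat μ) r, E (Sum.inr i) r, E (Sum.inr j) r]) q (E (un μ) q) := by
    rw [← dirDeriv_neg_fun]
    refine dirDeriv_congr ?_ _
    filter_upwards [hA.frame.eventually_mem hq] with r hr
    exact (F r hr).c_hat_hat_hat hε (Sum.inl μ) i j
  have d2 : dirDeriv (structFun E (Sum.inr i) (un μ) (Sum.inr j)) q (E (hat μ) q) = 0 := by
    rw [dirDeriv_congr (g := fun _ ↦ 0), dirDeriv_const]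
    filter_upwards [hA.frame.eventually_mem hq] with r hr
    have := (F r hr).c_swap (un μ) (Sum.inr i) (Sum.inr j)
    rw [(F r hr).c_un_hat_off hε hi (by simpa using hij.symm), neg_zero] at this
    exact this
  have G := F q hq
  have s1 : ∑ k, structFun E (hat μ) (Sum.inr i) k q * structFun E (un μ) k (Sum.inr j) q =
      - T q ![E (hat μ) q, E (Sum.inr i) q, E (Sum.inr j) q] *
        structFun E (un μ) (Sum.inr j) (Sum.inr j) q := by
    rw [Fintype.sum_eq_single (Sum.inr j)]
    · rw [G.c_hat_hat_hat hε (Sum.inl μ) i j]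
    · rintro (ν | l) hk
      · rw [G.c_un_zero (by simp) (by simp), zero_mul]
      · rcases eq_or_ne l (Sum.inl μ) with rfl | hl
        · rw [G.c_hat_hat_hat hε (Sum.inl μ) i (Sum.inl μ), G.T_self₁₃, neg_zero, zero_mul]
        · rw [G.c_un_hat_off hε hl hk.symm, mul_zero]
  have s2 : ∑ k, structFun E (Sum.inr i) (un μ) k q * structFun E (hat μ) k (Sum.inr j) q =
      structFun E (un μ) (Sum.inr i) (Sum.inr i) q *
        T q ![E (hat μ) q, E (Sum.inr i) q, E (Sum.inr j) q] := by
    rw [Fintype.sum_eq_single (Sum.inr i)]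
    · rw [G.c_hat_hat_hat hε (Sum.inl μ) i j, G.c_swap (un μ)]
      ring
    · intro k hk
      rw [G.c_swap, G.c_un_hat_off hε hi hk, neg_zero, zero_mul]
  have s3 : ∑ k, structFun E (un μ) (hat μ) k q * structFun E (Sum.inr i) k (Sum.inr j) q =
      - ∑ l : Fin n ⊕ Fin ε, structFun E (un μ) (hat μ) (Sum.inr l) q *
          T q ![E (Sum.inr i) q, E (Sum.inr l) q, E (Sum.inr j) q] := by
    rw [Fintype.sum_sum_type, Finset.sum_eq_zero, zero_add, ← Finset.sum_neg_distrib]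
    · refine Finset.sum_congr rfl fun l _ ↦ ?_
      rw [G.c_hat_hat_hat hε i l j, mul_neg]
    · intro ν _
      rcases eq_or_ne ν μ with rfl | hν
      · rw [G.c_swap (un ν) (Sum.inr i) (Sum.inr j),
          G.c_un_hat_off hε hi (by simpa using hij.symm), neg_zero, mul_zero]
      · rw [G.c_un_zero (by simpa using hν.symm) (by simp), zero_mul]
  rw [d1, d2, s1, s2, s3] at J
  linarith

/-- The torsion has no purely hatted components. -/
lemma torsion_hat_hat_hat (hA : IsAdaptedFrame T h E U x s) (hε : ε ≤ 1) (hT : IsSmoothForm T)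
    (hh : IsSmoothForm h)
    (hg : IsGCKY T h) (hc : ∀ (p : M) (u v w : TangentSpace (𝓡 D) p), dT T h p u v w = 0)
    {q : M} (hq : q ∈ U) {μ : Fin n} {i j : Fin n ⊕ Fin ε} (hi : i ≠ Sum.inl μ)
    (hj : j ≠ Sum.inl μ) (hij : i ≠ j) :
    T q ![E (hat μ) q, E (Sum.inr i) q, E (Sum.inr j) q] = 0 := by
  by_contra ht
  have ts : ∀ i j : Fin n ⊕ Fin ε,
      SmoothFun D (fun r ↦ T r ![E (hat μ) r, E (Sum.inr i) r, E (Sum.inr j) r]) q := fun i j ↦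
    hT.smoothFun₃ (hA.frame.smooth q hq _) (hA.frame.smooth q hq _) (hA.frame.smooth q hq _)
  -- T_{μ̂ij} ≠ 0 persists near q, so the e_i-component of [e_μ, e_μ̂] vanishes on a neighbourhood;
  -- hence its derivatives vanish, not just its value.
  have key : ∀ {i j : Fin n ⊕ Fin ε}, i ≠ Sum.inl μ → j ≠ Sum.inl μ → i ≠ j →
      T q ![E (hat μ) q, E (Sum.inr i) q, E (Sum.inr j) q] ≠ 0 →
      dirDeriv (structFun E (un μ) (hat μ) (Sum.inr i)) q (E (Sum.inr j) q) = 0 := by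
    intro i j hi hj hij ht
    rw [dirDeriv_congr (g := fun _ ↦ 0), dirDeriv_const]
    filter_upwards [hA.frame.eventually_mem hq, (ts i j).continuousAt.eventually_ne ht]
      with r hr ht
    exact (mul_eq_zero.1 (hA.torsion_mul_structFun hε hh hg hc hr hi hj hij)).resolve_left ht
  have J1 := hA.jacobi_torsion hε hh hg hc hq hi hj hij
  have J2 := hA.jacobi_torsion hε hh hg hc hq hj hi hij.symm
  rw [key hj hi hij.symm (by rw [form₃_swap₂₃]; simpa using ht)] at J1
  rw [key hi hj hij ht, dirDeriv_congr
    (g := fun r ↦ - T r ![E (hat μ) r, E (Sum.inr i) r, E (Sum.inr j) r])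
    (Filter.Eventually.of_forall fun r ↦ form₃_swap₂₃ _ _ _ _), dirDeriv_neg_fun,
    form₃_swap₂₃ (T q) (E (hat μ) q) (E (Sum.inr i) q)] at J2
  -- The sum is antisymmetric in i, j, like T_{μ̂ij} and its derivative. Adding the two Jacobi
  -- identities therefore leaves only (a_i - a_j) T_{μ̂ij}.
  have hsum : ∑ l : Fin n ⊕ Fin ε, structFun E (un μ) (hat μ) (Sum.inr l) q *
          T q ![E (Sum.inr j) q, E (Sum.inr l) q, E (Sum.inr i) q] =
      - ∑ l : Fin n ⊕ Fin ε, structFun E (un μ) (hat μ) (Sum.inr l) q *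
          T q ![E (Sum.inr i) q, E (Sum.inr l) q, E (Sum.inr j) q] := by
    rw [← Finset.sum_neg_distrib]
    refine Finset.sum_congr rfl fun l _ ↦ ?_
    rw [form₃_swap₁₂ (T q) (E (Sum.inr l) q), form₃_swap₂₃ (T q) (E (Sum.inr l) q),
      form₃_swap₁₂ (T q) (E (Sum.inr i) q)]
    ring
  rw [hsum] at J2
  have h0 : (structFun E (un μ) (Sum.inr i) (Sum.inr i) q
        - structFun E (un μ) (Sum.inr j) (Sum.inr j) q) *
          T q ![E (hat μ) q, E (Sum.inr i) q, E (Sum.inr j) q] = 0 := by linarith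
  have h1 := (mul_eq_zero.1 h0).resolve_right ht
  have h2 := hA.structFun_un_hat_self hh hg hc hq hi
  have h3 := hA.structFun_un_hat_self hh hg hc hq hj
  have hne : x μ q * s μ q ≠ 0 := mul_ne_zero (hA.x_ne q hq μ) (hA.s_ne q hq μ)
  have ha : structFun E (un μ) (Sum.inr i) (Sum.inr i) q ≠ 0 := by
    intro h
    rw [h, zero_mul] at h2
    exact hne (by linarith)
  have h4 : structFun E (un μ) (Sum.inr i) (Sum.inr i) q *
      (hatVal x i q ^ 2 - hatVal x j q ^ 2) = 0 := by
    have : structFun E (un μ) (Sum.inr j) (Sum.inr j) q =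
      structFun E (un μ) (Sum.inr i) (Sum.inr i) q := by linarith
    rw [this] at h3
    linarith
  have h5 := (mul_eq_zero.1 h4).resolve_left ha
  rcases i with ν | k <;> rcases j with ν' | k'
  · exact hA.x_sq_ne q hq ν ν' (fun h ↦ hij (by rw [h])) h5
  · simp [hatVal, hA.x_ne q hq] at h5
  · simp [hatVal, hA.x_ne q hq] at h5
  · exact hij (by congr 1; apply Fin.ext; omega)

end IsAdaptedFrame

end Adapted

/-! ### Characteristic polynomials of Darboux matrices and their roots. -/

section Charpoly

/-- Multiplication by a block lower triangular matrix of determinant X^n makes the characteristic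
matrix block upper triangular; X^n is then cancelled. -/
lemma charpoly_darbouxMat {n ε : ℕ} (x : Fin n → ℝ) :
    (Matrix.of (darbouxMat (ε := ε) x)).charpoly = X ^ ε * ∏ μ, (X ^ 2 + C (x μ ^ 2)) := by
  classical
  let B : Matrix (Fin n) (Fin n ⊕ Fin ε) ℝ[X] :=
    Matrix.fromCols (Matrix.diagonal fun μ ↦ C (x μ)) 0
  let B' : Matrix (Fin n ⊕ Fin ε) (Fin n) ℝ[X] :=
    Matrix.fromRows (Matrix.diagonal fun μ ↦ - C (x μ)) 0
  have h1 : (Matrix.of (darbouxMat (ε := ε) x)).charmatrix =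
      Matrix.fromBlocks (Matrix.scalar _ X) (-B) (-B') (Matrix.scalar _ X) := by
    ext1 a b
    rcases a with μ | μ | k <;> rcases b with ν | ν | l <;>
      simp [Matrix.charmatrix, darbouxMat, B, B', Matrix.diagonal_apply] <;>
      split_ifs <;> simp_all
  have h2 : Matrix.fromBlocks (Matrix.scalar _ X) (-B) (-B') (Matrix.scalar _ X) *
      Matrix.fromBlocks (Matrix.scalar _ X) 0 B' 1 =
      Matrix.fromBlocks (Matrix.diagonal fun μ ↦ X ^ 2 + C (x μ ^ 2)) (-B) 0
        (Matrix.scalar (Fin n ⊕ Fin ε) X) := by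
    rw [Matrix.fromBlocks_multiply]
    congr 1
    · ext1 μ ν
      simp [B, B', Matrix.fromCols_mul_fromRows, Matrix.diagonal_apply]
      split_ifs <;> ring
    · simp
    · ext1 a μ
      simp [Matrix.scalar_apply, Matrix.mul_diagonal, Matrix.diagonal_mul, mul_comm]
    · simp
  have h3 := congrArg Matrix.det h2
  rw [Matrix.det_mul, Matrix.det_fromBlocks_zero₁₂, Matrix.det_fromBlocks_zero₂₁, ← h1] at h3
  simp only [Matrix.scalar_apply, Matrix.det_diagonal, Finset.prod_const, Matrix.det_one, mul_one,
    Finset.card_univ, Fintype.card_sum, Fintype.card_fin, pow_add] at h3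
  have hX : (X : ℝ[X]) ^ n ≠ 0 := pow_ne_zero _ X_ne_zero
  apply mul_right_cancel₀ hX
  rw [Matrix.charpoly, h3]
  ring

/-- Equal multiplicities make fibres over the same value equinumerous; bijections of the fibres are
glued. -/
lemma exists_perm_of_map_univ_eq {ι α : Type*} [Fintype ι] {f g : ι → α}
    (h : Finset.univ.val.map f = Finset.univ.val.map g) :
    ∃ σ : Equiv.Perm ι, ∀ i, f i = g (σ i) := by
  classical
  have hc : ∀ a, Fintype.card {i // f i = a} = Fintype.card {i // g i = a} := by
    intro a
    have := congrArg (Multiset.count a) h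
    rw [Multiset.count_map, Multiset.count_map] at this
    rw [Fintype.card_subtype, Fintype.card_subtype]
    simpa [Finset.card, Finset.filter_val, eq_comm] using this
  let e : ∀ a, {i // f i = a} ≃ {i // g i = a} := fun a ↦ Fintype.equivOfCardEq (hc a)
  refine ⟨(Equiv.sigmaFiberEquiv f).symm.trans
    ((Equiv.sigmaCongrRight e).trans (Equiv.sigmaFiberEquiv g)), fun i ↦ ?_⟩
  exact (e (f i) ⟨i, rfl⟩).2.symm

/-- The products are polynomials in X²; after undoing that substitution the roots are the negated
squares. -/
lemma exists_perm_of_prod_eq {n ε : ℕ} {x y : Fin n → ℝ}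
    (h : (X ^ ε * ∏ μ, (X ^ 2 + C (x μ ^ 2)) : ℝ[X]) = X ^ ε * ∏ μ, (X ^ 2 + C (y μ ^ 2))) :
    ∃ σ : Equiv.Perm (Fin n), ∀ μ, x μ ^ 2 = y (σ μ) ^ 2 := by
  have h1 := mul_left_cancel₀ (pow_ne_zero ε (X_ne_zero (R := ℝ))) h
  have e : ∀ z : Fin n → ℝ, (∏ μ, (X ^ 2 + C (z μ ^ 2)) : ℝ[X]) =
      expand ℝ 2 (((Finset.univ.val.map fun μ ↦ - z μ ^ 2).map fun a ↦ X - C a).prod) := by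
    intro z
    rw [Multiset.map_map]
    change _ = expand ℝ 2 (∏ μ, _)
    rw [map_prod]
    refine Finset.prod_congr rfl fun μ _ ↦ ?_
    simp
  rw [e, e] at h1
  have h2 := congrArg roots (expand_injective two_pos h1)
  rw [roots_multiset_prod_X_sub_C, roots_multiset_prod_X_sub_C] at h2
  obtain ⟨σ, hσ⟩ := exists_perm_of_map_univ_eq h2
  exact ⟨σ, fun μ ↦ by simpa using hσ μ⟩

/-- A complex eigenvector of a real matrix for a root of its characteristic polynomial. -/
lemma exists_complex_eigenvector {m : Type*} [Fintype m] [DecidableEq m] (A : Matrix m m ℝ) {z : ℂ}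
    (hz : (A.charpoly.map Complex.ofRealHom).eval z = 0) :
    ∃ v : m → ℂ, v ≠ 0 ∧ (A.map Complex.ofReal).mulVec v = z • v := by
  have h : (A.map Complex.ofRealHom).charpoly.eval z = 0 := by rw [Matrix.charpoly_map, hz]
  rw [Matrix.eval_charpoly] at h
  obtain ⟨v, hv, hv'⟩ := Matrix.exists_mulVec_eq_zero_iff.2 h
  refine ⟨v, hv, ?_⟩
  rw [Matrix.sub_mulVec, sub_eq_zero] at hv'
  refine hv'.symm.trans ?_
  funext i
  simp [Matrix.scalar_apply, Matrix.mulVec_diagonal]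

lemma eval_prod_eq_zero {n ε : ℕ} (y : Fin n → ℝ) (μ : Fin n) :
    ((X ^ ε * ∏ μ, (X ^ 2 + C (y μ ^ 2)) : ℝ[X]).map Complex.ofRealHom).eval
      (Complex.I * (y μ : ℂ)) = 0 := by
  rw [Polynomial.map_mul, eval_mul, Polynomial.map_prod, eval_prod,
    Finset.prod_eq_zero (Finset.mem_univ μ), mul_zero]
  simp [mul_pow]

end Charpoly

/-! ### Spectral facts for skew maps. -/

section SkewMaps

variable {V : Type*} [NormedAddCommGroup V] [InnerProductSpace ℝ V]

/-- A skew-adjoint endomorphism. -/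
def IsSkew (L : V →ₗ[ℝ] V) : Prop := ∀ v w, inner ℝ (L v) w = - inner ℝ v (L w)

lemma IsSkew.inner_self {L : V →ₗ[ℝ] V} (hL : IsSkew L) (v : V) : inner ℝ (L v) v = 0 := by
  have := hL v v
  rw [real_inner_comm] at this
  rw [real_inner_comm]
  linarith

lemma IsSkew.ker_sq {L : V →ₗ[ℝ] V} (hL : IsSkew L) {v : V} (h : L (L v) = 0) : L v = 0 := by
  have := hL v (L v)
  rw [h, inner_zero_right, neg_zero] at this
  exact inner_self_eq_zero.1 this

variable [FiniteDimensional ℝ V]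

/-- The square of L is real with real eigenvalue -y_μ², so the real and imaginary parts of a complex
eigenvector for i y_μ both satisfy the equation, and one of them is nonzero. -/
lemma exists_unit_eigenvector {L : V →ₗ[ℝ] V} {n ε : ℕ} {y : Fin n → ℝ}
    (h : L.charpoly = X ^ ε * ∏ μ, (X ^ 2 + C (y μ ^ 2))) (μ : Fin n) :
    ∃ v : V, ‖v‖ = 1 ∧ L (L v) = - (y μ ^ 2) • v := by
  suffices ∃ v : V, v ≠ 0 ∧ L (L v) = - (y μ ^ 2) • v by
    obtain ⟨v, hv, hv'⟩ := this
    refine ⟨‖v‖⁻¹ • v, ?_, ?_⟩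
    · rw [norm_smul, norm_inv, norm_norm, inv_mul_cancel₀ (norm_ne_zero_iff.2 hv)]
    · rw [map_smul, map_smul, hv', smul_comm]
  let b := Module.finBasis ℝ V
  let A := LinearMap.toMatrix b b L
  have hz : (A.charpoly.map Complex.ofRealHom).eval (Complex.I * (y μ : ℂ)) = 0 := by
    rw [LinearMap.charpoly_toMatrix, h, eval_prod_eq_zero]
  obtain ⟨v, hv, hv'⟩ := exists_complex_eigenvector A hz
  have h2 : ((A * A).map Complex.ofReal).mulVec v = ((-(y μ ^ 2) : ℝ) : ℂ) • v := by
    have : (A * A).map Complex.ofReal = A.map Complex.ofReal * A.map Complex.ofReal :=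
      Matrix.map_mul (f := Complex.ofRealHom)
    rw [this, ← Matrix.mulVec_mulVec, hv', Matrix.mulVec_smul, hv', smul_smul]
    congr 1
    push_cast
    linear_combination (y μ : ℂ) ^ 2 * Complex.I_sq
  have hre : (A * A).mulVec (fun i ↦ (v i).re) = -(y μ ^ 2) • fun i ↦ (v i).re := by
    funext i
    have := congrArg Complex.re (congrFun h2 i)
    simpa [Matrix.mulVec, dotProduct, -Complex.ofReal_neg, -Complex.ofReal_pow] using this
  have him : (A * A).mulVec (fun i ↦ (v i).im) = -(y μ ^ 2) • fun i ↦ (v i).im := by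
    funext i
    have := congrArg Complex.im (congrFun h2 i)
    simpa [Matrix.mulVec, dotProduct, -Complex.ofReal_neg, -Complex.ofReal_pow] using this
  have back : ∀ r : Fin (Module.finrank ℝ V) → ℝ, r ≠ 0 → (A * A).mulVec r = -(y μ ^ 2) • r →
      ∃ v : V, v ≠ 0 ∧ L (L v) = - (y μ ^ 2) • v := by
    intro r hr hr'
    refine ⟨b.equivFun.symm r, (LinearEquiv.map_ne_zero_iff _).2 hr, ?_⟩
    have hAA : A * A = LinearMap.toMatrix b b (L * L) := (LinearMap.toMatrix_mul b L L).symm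
    apply b.equivFun.injective
    rw [map_smul, LinearEquiv.apply_symm_apply, ← hr', hAA]
    have := LinearMap.toMatrix_mulVec_repr b b (L * L) (b.equivFun.symm r)
    have h3 : ⇑(b.repr (b.equivFun.symm r)) = r := b.equivFun.apply_symm_apply r
    rw [h3] at this
    rw [this]
    rfl
  by_cases hr : (fun i ↦ (v i).re) = 0
  · refine back _ (fun hi ↦ hv ?_) him
    funext i
    exact Complex.ext (congrFun hr i) (congrFun hi i)
  · exact back _ hr hre

lemma exists_unit_kernel {L : V →ₗ[ℝ] V} {n ε : ℕ} {y : Fin n → ℝ}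
    (h : L.charpoly = X ^ ε * ∏ μ, (X ^ 2 + C (y μ ^ 2))) (hε : ε ≠ 0) :
    ∃ v : V, ‖v‖ = 1 ∧ L v = 0 := by
  have h0 : L.charpoly.IsRoot 0 := by
    rw [h, IsRoot, eval_mul, eval_pow, eval_X, zero_pow hε, zero_mul]
  obtain ⟨v, hv⟩ := ((Module.End.hasEigenvalue_iff_isRoot_charpoly L 0).2 h0).exists_hasEigenvector
  refine ⟨‖v‖⁻¹ • v, ?_, ?_⟩
  · rw [norm_smul, norm_inv, norm_norm, inv_mul_cancel₀ (norm_ne_zero_iff.2 hv.2)]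
  · have := hv.apply_eq_smul
    rw [map_smul, this, zero_smul, smul_zero]

/-- A skew map of maximal rank has nonzero eigenvalues. -/
lemma eigenvalue_ne_zero {L : V →ₗ[ℝ] V} (hL : IsSkew L) {n ε : ℕ} {y : Fin n → ℝ}
    (h : L.charpoly = X ^ ε * ∏ μ, (X ^ 2 + C (y μ ^ 2)))
    (hr : Module.finrank ℝ (LinearMap.range L) = 2 * n) (hV : Module.finrank ℝ V = 2 * n + ε)
    (μ : Fin n) : y μ ≠ 0 := by
  intro hy
  have h1 := LinearMap.finrank_maxGenEigenspace_zero_eq L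
  -- By skewness the kernel of L is its whole generalized kernel, so 0 has algebraic multiplicity D
  -- - 2n = ε. A vanishing y_μ would force multiplicity at least ε + 1.
  have h2 : Module.End.maxGenEigenspace L 0 = LinearMap.ker L := by
    apply le_antisymm
    · intro v hv
      rw [Module.End.mem_maxGenEigenspace] at hv
      obtain ⟨k, hk⟩ := hv
      rw [zero_smul, sub_zero] at hk
      rw [LinearMap.mem_ker]
      induction k with
      | zero => simp at hk; simp [hk]
      | succ k ih =>
        rcases k with _ | k
        · simpa using hk
        · apply ih
          rw [pow_succ', Module.End.mul_apply] at hk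
          rw [pow_succ', Module.End.mul_apply] at hk ⊢
          exact hL.ker_sq hk
    · intro v hv
      rw [Module.End.mem_maxGenEigenspace]
      exact ⟨1, by simpa using hv⟩
  have h3 := LinearMap.finrank_range_add_finrank_ker L
  rw [h2, h] at h1
  have h4 : (X : ℝ[X]) ^ (ε + 1) ∣ X ^ ε * ∏ μ, (X ^ 2 + C (y μ ^ 2)) := by
    rw [pow_succ]
    refine mul_dvd_mul_left _ ((Dvd.intro X ?_).trans (Finset.dvd_prod_of_mem _ (Finset.mem_univ μ)))
    rw [hy]; simp [sq]
  have h5 : ε + 1 ≤ (X ^ ε * ∏ μ, (X ^ 2 + C (y μ ^ 2)) : ℝ[X]).natTrailingDegree := by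
    apply le_natTrailingDegree
    · rw [← h]; exact (LinearMap.charpoly_monic L).ne_zero
    · intro m hm
      exact X_pow_dvd_iff.1 h4 m hm
  omega

end SkewMaps

/-! ### Orthonormal Darboux families from eigenvectors of the square of a skew map. -/

section DarbouxFamily

variable {V : Type*} [NormedAddCommGroup V] [InnerProductSpace ℝ V]

lemma IsSkew.inner_sq {L : V →ₗ[ℝ] V} (hL : IsSkew L) (v w : V) :
    inner ℝ (L (L v)) w = inner ℝ v (L (L w)) := by
  rw [hL, hL, neg_neg]

lemma IsSkew.orthogonal {L : V →ₗ[ℝ] V} (hL : IsSkew L) {a b : ℝ} (hab : a ≠ b) {v w : V}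
    (hv : L (L v) = -a • v) (hw : L (L w) = -b • w) : inner ℝ v w = 0 := by
  have := hL.inner_sq v w
  rw [hv, hw, inner_smul_left, inner_smul_right] at this
  simp only [conj_trivial] at this
  have h2 : (a - b) * inner ℝ v w = 0 := by linear_combination -this
  exact (mul_eq_zero.1 h2).resolve_left (sub_ne_zero.2 hab)

/-- The family `e_μ`, `e_μ̂ = x_μ⁻¹ L e_μ`, `e_0`. -/
noncomputable def darbouxFam {n ε : ℕ} (L : V →ₗ[ℝ] V) (x : Fin n → ℝ) (d : Fin n → V)
    (d₀ : Fin ε → V) : Idx n ε → V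
  | Sum.inl μ => d μ
  | Sum.inr (Sum.inl μ) => (x μ)⁻¹ • L (d μ)
  | Sum.inr (Sum.inr k) => d₀ k

/-- Unit eigenvectors of the square of a skew map. -/
structure IsDarbouxData {n ε : ℕ} (L : V →ₗ[ℝ] V) (x : Fin n → ℝ) (d : Fin n → V)
    (d₀ : Fin ε → V) : Prop where
  skew : IsSkew L
  x_ne : ∀ μ, x μ ≠ 0
  x_sq_ne : ∀ μ ν, μ ≠ ν → x μ ^ 2 ≠ x ν ^ 2
  unit : ∀ μ, inner ℝ (d μ) (d μ) = (1 : ℝ)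
  eigen : ∀ μ, L (L (d μ)) = -(x μ ^ 2) • d μ
  unit₀ : ∀ k, inner ℝ (d₀ k) (d₀ k) = (1 : ℝ)
  ker : ∀ k, L (d₀ k) = 0

namespace IsDarbouxData

variable {n ε : ℕ} {L : V →ₗ[ℝ] V} {x : Fin n → ℝ} {d : Fin n → V} {d₀ : Fin ε → V}

/-- L² is symmetric, so eigenvectors for different eigenvalues are orthogonal; within one plane,
skewness gives L v ⟂ v. The condition ε ≤ 1 leaves no two kernel vectors to compare. -/
lemma inner_darbouxFam (H : IsDarbouxData L x d d₀) (hε : ε ≤ 1) (a b : Idx n ε) :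
    inner ℝ (darbouxFam L x d d₀ a) (darbouxFam L x d d₀ b) = if a = b then (1 : ℝ) else 0 := by
  have hLd : ∀ μ, L (L (L (d μ))) = -(x μ ^ 2) • L (d μ) := fun μ ↦ by rw [H.eigen, map_smul]
  have h1 : ∀ μ ν, inner ℝ (d μ) (d ν) = if μ = ν then (1 : ℝ) else 0 := by
    intro μ ν
    split_ifs with h
    · rw [h, H.unit]
    · exact H.skew.orthogonal (H.x_sq_ne μ ν h) (H.eigen μ) (H.eigen ν)
  have h2 : ∀ μ ν, inner ℝ (d μ) (L (d ν)) = (0 : ℝ) := by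
    intro μ ν
    rcases eq_or_ne μ ν with rfl | h
    · rw [real_inner_comm, H.skew.inner_self]
    · exact H.skew.orthogonal (H.x_sq_ne μ ν h) (H.eigen μ) (hLd ν)
  have h3 : ∀ μ ν, inner ℝ (L (d μ)) (L (d ν)) = if μ = ν then x ν ^ 2 else 0 := by
    intro μ ν
    rw [H.skew, H.eigen, inner_smul_right, h1]
    split_ifs <;> simp
  have h4 : ∀ μ k, inner ℝ (d μ) (d₀ k) = (0 : ℝ) := fun μ k ↦
    H.skew.orthogonal (pow_ne_zero 2 (H.x_ne μ)) (H.eigen μ) (by rw [H.ker]; simp)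
  have h5 : ∀ μ k, inner ℝ (L (d μ)) (d₀ k) = (0 : ℝ) := fun μ k ↦ by
    rw [H.skew, H.ker, inner_zero_right, neg_zero]
  have h6 : ∀ k l, inner ℝ (d₀ k) (d₀ l) = (1 : ℝ) := fun k l ↦ by
    have : k = l := Fin.ext (by omega)
    rw [this, H.unit₀]
  have h7 : ∀ k l : Fin ε, k = l := fun k l ↦ Fin.ext (by omega)
  rcases a with μ | μ | k <;> rcases b with ν | ν | l <;>
    simp only [darbouxFam, inner_smul_left, inner_smul_right, conj_trivial, h1, h2, h3, h4, h5, h6,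
      Sum.inl.injEq, Sum.inr.injEq, reduceCtorEq, if_false, mul_zero]
  · rw [real_inner_comm, h2, mul_zero]
  · split_ifs with h
    · subst h
      have := H.x_ne μ
      field_simp
    · simp
  · rw [real_inner_comm, h4]
  · rw [real_inner_comm, h5, mul_zero]
  · rw [if_pos (h7 k l)]

lemma apply_un (H : IsDarbouxData L x d d₀) (μ : Fin n) :
    L (darbouxFam L x d d₀ (un μ)) = x μ • darbouxFam L x d d₀ (hat μ) := by
  simp only [darbouxFam]
  rw [smul_inv_smul₀ (H.x_ne μ)]

lemma apply_hat (H : IsDarbouxData L x d d₀) (μ : Fin n) :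
    L (darbouxFam L x d d₀ (hat μ)) = - x μ • darbouxFam L x d d₀ (un μ) := by
  simp only [darbouxFam]
  rw [map_smul, H.eigen, smul_smul]
  congr 1
  have := H.x_ne μ
  field_simp

lemma apply_zer (H : IsDarbouxData L x d d₀) (k : Fin ε) :
    L (darbouxFam L x d d₀ (zer k)) = 0 := H.ker k

lemma inner_apply_darbouxFam (H : IsDarbouxData L x d d₀) (hε : ε ≤ 1) (a b : Idx n ε) :
    inner ℝ (L (darbouxFam L x d d₀ a)) (darbouxFam L x d d₀ b) = darbouxMat x a b := by
  have h := H.inner_darbouxFam hε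
  rcases a with μ | μ | k
  · rw [H.apply_un, inner_smul_left, h]
    rcases b with ν | ν | l <;> simp [darbouxMat]
  · rw [H.apply_hat, inner_smul_left, h]
    rcases b with ν | ν | l <;> simp [darbouxMat]
  · rw [H.apply_zer, inner_zero_left]
    rcases b with ν | ν | l <;> simp [darbouxMat]

end IsDarbouxData

end DarbouxFamily

/-! ### The skew endomorphism attached to h. -/

section Sharp

variable {D : ℕ} {M : Type*} [TopologicalSpace M] [ChartedSpace (EuclideanSpace ℝ (Fin D)) M]
  [RiemannianBundle (fun p : M ↦ TangentSpace (𝓡 D) p)]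

/-- The endomorphism of the tangent space that corresponds to a 2-form by means of the metric. -/
noncomputable def sharp (h : Form D M 2) (q : M) :
    TangentSpace (𝓡 D) q →ₗ[ℝ] TangentSpace (𝓡 D) q :=
  ∑ a, ((bil (h q)).flip (onb q a)).smulRight (onb q a)

lemma inner_sharp (h : Form D M 2) (q : M) (v w : TangentSpace (𝓡 D) q) :
    inner ℝ (sharp h q v) w = h q ![v, w] := by
  conv_rhs => rw [← (onb q).sum_repr' w, ← bil_apply, map_sum]
  simp only [sharp, LinearMap.sum_apply, LinearMap.smulRight_apply, sum_inner, inner_smul_left,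
    map_smul, conj_trivial, LinearMap.flip_apply, smul_eq_mul]
  exact Finset.sum_congr rfl fun a _ ↦ mul_comm _ _

lemma isSkew_sharp (h : Form D M 2) (q : M) : IsSkew (sharp h q) := by
  intro v w
  rw [real_inner_comm (sharp h q w), inner_sharp, inner_sharp, form₂_swap]

lemma toMatrix_sharp {ι : Type*} [Fintype ι] [DecidableEq ι] (h : Form D M 2) (q : M)
    (b : OrthonormalBasis ι ℝ (TangentSpace (𝓡 D) q)) :
    (LinearMap.toMatrix b.toBasis b.toBasis (sharp h q)).transpose =
      Matrix.of fun a c ↦ h q ![b a, b c] := by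
  ext a c
  rw [Matrix.transpose_apply, LinearMap.toMatrix_apply, Matrix.of_apply, ← inner_sharp,
    OrthonormalBasis.coe_toBasis, OrthonormalBasis.coe_toBasis_repr_apply,
    OrthonormalBasis.repr_apply_apply, real_inner_comm]

lemma charpoly_sharp {ι : Type*} [Fintype ι] [DecidableEq ι] (h : Form D M 2) (q : M)
    (b : OrthonormalBasis ι ℝ (TangentSpace (𝓡 D) q)) :
    (Matrix.of fun a c ↦ h q ![b a, b c]).charpoly = (sharp h q).charpoly := by
  rw [← toMatrix_sharp, Matrix.charpoly_transpose, LinearMap.charpoly_toMatrix]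

lemma charpoly_formMatrix (h : Form D M 2) (q : M) :
    (formMatrix h q).charpoly = (sharp h q).charpoly :=
  charpoly_sharp h q (onb q)

lemma rank_formMatrix (h : Form D M 2) (q : M) :
    (formMatrix h q).rank = Module.finrank ℝ (LinearMap.range (sharp h q)) := by
  have : formMatrix h q = Matrix.of fun a c ↦ h q ![onb q a, onb q c] := rfl
  rw [this, ← toMatrix_sharp, Matrix.rank_transpose,
    Matrix.rank_eq_finrank_range_toLin _ (onb q).toBasis (onb q).toBasis, Matrix.toLin_toMatrix]

variable [IsManifold (𝓡 D) ∞ M]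
  [IsContMDiffRiemannianBundle (𝓡 D) ∞ (EuclideanSpace ℝ (Fin D))
      (fun p : M ↦ TangentSpace (𝓡 D) p)]

lemma IsSmoothForm.sharp_smooth {h : Form D M 2} (hh : IsSmoothForm h) {X : VecField D M} {q : M}
    (hX : SmoothField X q) : SmoothField (fun r ↦ sharp h r (X r)) q := by
  obtain ⟨E, U, hE, hq⟩ := exists_isONFrame (D := D) q
  refine SmoothField.congr (X := fun r ↦ ∑ a, h r ![X r, E a r] • E a r)
    (SmoothField.sum fun a _ ↦ (hE.smooth q hq a).smul (hh.smoothFun hX (hE.smooth q hq a))) ?_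
  filter_upwards [hE.eventually_mem hq] with r hr
  conv_lhs => rw [← hE.sum_inner_smul hr (sharp h r (X r))]
  refine Finset.sum_congr rfl fun a _ ↦ ?_
  rw [real_inner_comm, inner_sharp]

end Sharp

/-! ### Eigenvectors obtained from the Cayley–Hamilton theorem. -/

section QuadraticFactors

variable {V : Type*} [AddCommGroup V] [Module ℝ V]

lemma aeval_prod_insert {ι : Type*} [DecidableEq ι] (L : V →ₗ[ℝ] V) {s : Finset ι} {i : ι}
    (hi : i ∉ s) (a : ι → ℝ) (v : V) :
    aeval L (∏ j ∈ insert i s, (X ^ 2 + C (a j))) v =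
      L (L (aeval L (∏ j ∈ s, (X ^ 2 + C (a j))) v))
        + a i • aeval L (∏ j ∈ s, (X ^ 2 + C (a j))) v := by
  rw [Finset.prod_insert hi, map_mul, Module.End.mul_apply, map_add, map_pow, aeval_X, aeval_C,
    LinearMap.add_apply, pow_two, Module.End.mul_apply]
  rfl

lemma aeval_prod_eigen {ι : Type*} (L : V →ₗ[ℝ] V) (s : Finset ι) (a : ι → ℝ) {v : V} {c : ℝ}
    (hv : L (L v) = c • v) :
    aeval L (∏ j ∈ s, (X ^ 2 + C (a j))) v = (∏ j ∈ s, (c + a j)) • v := by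
  classical
  induction s using Finset.induction_on with
  | empty => simp
  | insert i s hi ih =>
    rw [aeval_prod_insert L hi, ih, map_smul, map_smul, hv, Finset.prod_insert hi, smul_smul,
      smul_smul, ← add_smul]
    congr 1; ring

lemma pow_two_mul_eigen (L : V →ₗ[ℝ] V) (k : ℕ) {v : V} {c : ℝ}
    (hv : L (L v) = c • v) : (L ^ (2 * k)) v = c ^ k • v := by
  induction k with
  | zero => simp
  | succ k ih =>
    rw [mul_add, mul_one, pow_add, Module.End.mul_apply, pow_two, Module.End.mul_apply, hv,
      map_smul, ih, smul_smul, pow_succ']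

variable {n ε : ℕ}

/-- With its own factor removed, the characteristic polynomial maps every vector into the
corresponding eigenspace of L². The power L^(2ε) in place of L^ε keeps the operator a polynomial in
L², so that it acts on eigenvectors of L² by scalars. -/
lemma eigen_of_cayleyHamilton {V : Type*} [AddCommGroup V] [Module ℝ V] [FiniteDimensional ℝ V]
    {L : V →ₗ[ℝ] V} {y : Fin n → ℝ} (hL : L.charpoly = X ^ ε * ∏ μ, (X ^ 2 + C (y μ ^ 2)))
    (μ : Fin n) (v : V) {w : V}
    (hw : w = (L ^ (2 * ε)) (aeval L (∏ ν ∈ Finset.univ.erase μ, (X ^ 2 + C (y ν ^ 2))) v)) :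
    L (L w) = -(y μ ^ 2) • w := by
  have h1 := aeval_prod_insert L (Finset.notMem_erase μ Finset.univ) (fun ν ↦ y ν ^ 2) v
  rw [Finset.insert_erase (Finset.mem_univ μ)] at h1
  have h2 : aeval L (X ^ (ε + ε) * ∏ μ, (X ^ 2 + C (y μ ^ 2))) v = 0 := by
    rw [pow_add, mul_assoc, ← hL, map_mul, LinearMap.aeval_self_charpoly, mul_zero,
      LinearMap.zero_apply]
  rw [map_mul, Module.End.mul_apply, map_pow, aeval_X, h1, map_add, map_smul, ← two_mul] at h2
  rw [neg_smul, eq_neg_iff_add_eq_zero, hw, ← h2]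
  congr 1
  rw [← Module.End.mul_apply L, ← Module.End.mul_apply, ← Module.End.mul_apply L,
    ← Module.End.mul_apply (L ^ (2 * ε))]
  congr 1
  rw [← pow_two, ← pow_add, ← pow_add, add_comm]

lemma kernel_of_cayleyHamilton {V : Type*} [AddCommGroup V] [Module ℝ V] [FiniteDimensional ℝ V]
    {L : V →ₗ[ℝ] V} {y : Fin n → ℝ} (hL : L.charpoly = X ^ ε * ∏ μ, (X ^ 2 + C (y μ ^ 2)))
    (hε : ε = 1) (v : V) :
    L (aeval L (∏ ν, (X ^ 2 + C (y ν ^ 2))) v) = 0 := by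
  have h2 : aeval L (X ^ ε * ∏ μ, (X ^ 2 + C (y μ ^ 2))) v = 0 := by
    rw [← hL, LinearMap.aeval_self_charpoly, LinearMap.zero_apply]
  rwa [map_mul, hε, pow_one, aeval_X] at h2

lemma inner_normalize {V : Type*} [NormedAddCommGroup V] [InnerProductSpace ℝ V] {v : V}
    (h : inner ℝ v v ≠ (0 : ℝ)) :
    inner ℝ ((√(inner ℝ v v))⁻¹ • v) ((√(inner ℝ v v))⁻¹ • v) = (1 : ℝ) := by
  have h1 : 0 < inner ℝ v v := lt_of_le_of_ne real_inner_self_nonneg h.symm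
  have h2 := Real.sq_sqrt h1.le
  have h3 := (Real.sqrt_pos.2 h1).ne'
  rw [inner_smul_left, inner_smul_right]
  simp only [conj_trivial]
  field_simp
  exact h2.symm

end QuadraticFactors

/-! ### Smooth eigenvector fields and the differentials of the eigenvalues. -/

section AdaptedFrames

variable {D : ℕ} {M : Type*} [TopologicalSpace M] [ChartedSpace (EuclideanSpace ℝ (Fin D)) M]
  [IsManifold (𝓡 D) ∞ M] [RiemannianBundle (fun p : M ↦ TangentSpace (𝓡 D) p)]

/-- Smooth, nonzero and distinct eigenvalue functions with independent differentials on an open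
set. -/
structure IsEigenSystem {n : ℕ} (ε : ℕ) (h : Form D M 2) (U : Set M) (y : Fin n → M → ℝ) :
    Prop where
  isOpen : IsOpen U
  smooth : ∀ q ∈ U, ∀ μ, SmoothFun D (y μ) q
  charpoly : ∀ q ∈ U, (sharp h q).charpoly = X ^ ε * ∏ μ, (X ^ 2 + C (y μ q ^ 2))
  diff_ne : ∀ q ∈ U, ∀ μ, ∃ v : TangentSpace (𝓡 D) q, dirDeriv (y μ) q v ≠ 0
  ne : ∀ q ∈ U, ∀ μ, y μ q ≠ 0
  sq_ne : ∀ q ∈ U, ∀ μ ν, μ ≠ ν → y μ q ^ 2 ≠ y ν q ^ 2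

/-- Smooth unit eigenvector fields for the square of a 2-form. -/
structure IsEigenFields {n ε : ℕ} (h : Form D M 2) (U : Set M) (y : Fin n → M → ℝ)
    (d : Fin n → VecField D M) (d₀ : Fin ε → VecField D M) : Prop where
  smooth : ∀ q ∈ U, ∀ μ, SmoothField (d μ) q
  smooth₀ : ∀ q ∈ U, ∀ k, SmoothField (d₀ k) q
  data : ∀ q ∈ U, IsDarbouxData (sharp h q) (fun μ ↦ y μ q) (fun μ ↦ d μ q) (fun k ↦ d₀ k q)

/-- The Darboux frame made from eigenvector fields. -/
noncomputable def darbouxFrame {n ε : ℕ} (h : Form D M 2) (y : Fin n → M → ℝ)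
    (d : Fin n → VecField D M) (d₀ : Fin ε → VecField D M) : Idx n ε → VecField D M :=
  fun a q ↦ darbouxFam (sharp h q) (fun μ ↦ y μ q) (fun μ ↦ d μ q) (fun k ↦ d₀ k q) a

variable {n ε : ℕ} {T : Form D M 3} {h : Form D M 2} {U : Set M} {y : Fin n → M → ℝ}

lemma IsEigenFields.darboux {d : Fin n → VecField D M} {d₀ : Fin ε → VecField D M}
    (H : IsEigenFields h U y d d₀) (hε : ε ≤ 1) {q : M} (hq : q ∈ U) (a b : Idx n ε) :
    h q ![darbouxFrame h y d d₀ a q, darbouxFrame h y d d₀ b q] =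
      darbouxMat (fun μ ↦ y μ q) a b := by
  rw [← inner_sharp]
  exact (H.data q hq).inner_apply_darbouxFam hε a b

variable [IsContMDiffRiemannianBundle (𝓡 D) ∞ (EuclideanSpace ℝ (Fin D))
      (fun p : M ↦ TangentSpace (𝓡 D) p)]

lemma SmoothField.aeval_prod (hh : IsSmoothForm h) {q : M} {a : Fin n → M → ℝ}
    (ha : ∀ μ, SmoothFun D (a μ) q) {X : VecField D M} (hX : SmoothField X q)
    (s : Finset (Fin n)) :
    SmoothField (fun r ↦ aeval (sharp h r) (∏ j ∈ s, (Polynomial.X ^ 2 + C (a j r))) (X r)) q := by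
  induction s using Finset.induction_on with
  | empty => simpa using hX
  | insert i s hi ih =>
    simp only [aeval_prod_insert _ hi]
    exact (hh.sharp_smooth (hh.sharp_smooth ih)).add (ih.smul (ha i))

lemma SmoothField.sharp_pow (hh : IsSmoothForm h) {q : M} {X : VecField D M}
    (hX : SmoothField X q) (k : ℕ) : SmoothField (fun r ↦ (sharp h r ^ k) (X r)) q := by
  induction k with
  | zero => simpa using hX
  | succ k ih =>
    simp only [pow_succ', Module.End.mul_apply]
    exact hh.sharp_smooth ih

lemma SmoothField.normalize {X : VecField D M} {q : M} (hX : SmoothField X q)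
    (h : inner ℝ (X q) (X q) ≠ (0 : ℝ)) :
    SmoothField (fun r ↦ (√(inner ℝ (X r) (X r)))⁻¹ • X r) q := by
  refine hX.smul (((hX.innerFun hX).sqrt h).inv ?_)
  exact (Real.sqrt_pos.2 (lt_of_le_of_ne real_inner_self_nonneg h.symm)).ne'

/-- Eigenvectors at a point extend to smooth eigenvector fields. -/
lemma IsEigenSystem.exists_eigenFields (H : IsEigenSystem ε h U y) (hε : ε ≤ 1)
    (hh : IsSmoothForm h) {p : M} (hp : p ∈ U) {v : Fin n → TangentSpace (𝓡 D) p}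
    {v₀ : Fin ε → TangentSpace (𝓡 D) p}
    (hv : IsDarbouxData (sharp h p) (fun μ ↦ y μ p) v v₀) :
    ∃ (U' : Set M) (d : Fin n → VecField D M) (d₀ : Fin ε → VecField D M),
      IsOpen U' ∧ U' ⊆ U ∧ p ∈ U' ∧ IsEigenFields h U' y d d₀ ∧
      (∀ μ, d μ p = v μ) ∧ ∀ k, d₀ k p = v₀ k := by
  -- The scalar by which the Cayley–Hamilton operator acts on the given eigenvector at `p`. Dividing
  -- by it makes the field pass through that vector; it is nonzero because the eigenvalues are
  -- nonzero with distinct squares.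
  let κ : Fin n → ℝ := fun μ ↦
    (-(y μ p ^ 2)) ^ ε * ∏ ν ∈ Finset.univ.erase μ, (-(y μ p ^ 2) + y ν p ^ 2)
  let κ₀ : ℝ := ∏ ν, (0 + y ν p ^ 2)
  have hκ : ∀ μ, κ μ ≠ 0 := fun μ ↦ by
    refine mul_ne_zero (pow_ne_zero _ (neg_ne_zero.2 (pow_ne_zero _ (H.ne p hp μ))))
      (Finset.prod_ne_zero_iff.2 fun ν hν ↦ ?_)
    rw [neg_add_eq_sub]
    exact sub_ne_zero.2 (H.sq_ne p hp ν μ (Finset.ne_of_mem_erase hν))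
  have hκ₀ : κ₀ ≠ 0 := Finset.prod_ne_zero_iff.2 fun ν _ ↦ by
    simpa using H.ne p hp ν
  let G : Fin n → VecField D M := fun μ q ↦ (κ μ)⁻¹ • (sharp h q ^ (2 * ε))
    (aeval (sharp h q) (∏ ν ∈ Finset.univ.erase μ, (X ^ 2 + C (y ν q ^ 2))) (ext (v μ) q))
  let G₀ : Fin ε → VecField D M := fun k q ↦ κ₀⁻¹ •
    (aeval (sharp h q) (∏ ν, (X ^ 2 + C (y ν q ^ 2))) (ext (v₀ k) q))
  have hGp : ∀ μ, G μ p = v μ := fun μ ↦ by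
    simp only [G, ext_apply_self]
    rw [aeval_prod_eigen _ _ _ (hv.eigen μ), map_smul, pow_two_mul_eigen _ _ (hv.eigen μ),
      smul_smul, smul_smul, mul_assoc, mul_comm (Finset.prod _ _)]
    change ((κ μ)⁻¹ * κ μ) • v μ = v μ
    rw [inv_mul_cancel₀ (hκ μ), one_smul]
  have hG₀p : ∀ k, G₀ k p = v₀ k := fun k ↦ by
    have h0 : sharp h p (sharp h p (v₀ k)) = (0 : ℝ) • v₀ k := by rw [hv.ker]; simp
    simp only [G₀, ext_apply_self]
    rw [aeval_prod_eigen _ _ _ h0, smul_smul]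
    change (κ₀⁻¹ * κ₀) • v₀ k = v₀ k
    rw [inv_mul_cancel₀ hκ₀, one_smul]
  have hysq : ∀ q ∈ U, ∀ μ, SmoothFun D (fun r ↦ y μ r ^ 2) q := fun q hq μ ↦ by
    simpa [pow_two] using (H.smooth q hq μ).mul (H.smooth q hq μ)
  have hU := H.isOpen.mem_nhds hp
  have hGs : ∀ μ, ∀ᶠ q in nhds p, SmoothField (G μ) q := fun μ ↦ by
    filter_upwards [hU, eventually_smoothField_ext (v μ)] with q hq hs
    exact SmoothField.smul contMDiffAt_const
      (SmoothField.sharp_pow hh (SmoothField.aeval_prod hh (hysq q hq) hs _) _)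
  have hG₀s : ∀ k, ∀ᶠ q in nhds p, SmoothField (G₀ k) q := fun k ↦ by
    filter_upwards [hU, eventually_smoothField_ext (v₀ k)] with q hq hs
    exact SmoothField.smul contMDiffAt_const (SmoothField.aeval_prod hh (hysq q hq) hs _)
  have hGn : ∀ μ, ∀ᶠ q in nhds p, inner ℝ (G μ q) (G μ q) ≠ (0 : ℝ) := fun μ ↦ by
    have := (hGs μ).self_of_nhds
    refine (this.innerFun this).continuousAt.eventually_ne ?_
    rw [hGp, hv.unit]; exact one_ne_zero
  have hG₀n : ∀ k, ∀ᶠ q in nhds p, inner ℝ (G₀ k q) (G₀ k q) ≠ (0 : ℝ) := fun k ↦ by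
    have := (hG₀s k).self_of_nhds
    refine (this.innerFun this).continuousAt.eventually_ne ?_
    rw [hG₀p, hv.unit₀]; exact one_ne_zero
  have hall := (Filter.eventually_all.2 hGs).and ((Filter.eventually_all.2 hG₀s).and
    ((Filter.eventually_all.2 hGn).and ((Filter.eventually_all.2 hG₀n).and hU)))
  obtain ⟨U', hU', hUo, hpU⟩ := eventually_nhds_iff.1 hall
  refine ⟨U', fun μ r ↦ (√(inner ℝ (G μ r) (G μ r)))⁻¹ • G μ r,
    fun k r ↦ (√(inner ℝ (G₀ k r) (G₀ k r)))⁻¹ • G₀ k r, hUo, fun q hq ↦ (hU' q hq).2.2.2.2, hpU,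
    ⟨?_, ?_, ?_⟩, ?_, ?_⟩
  · intro q hq μ
    exact ((hU' q hq).1 μ).normalize ((hU' q hq).2.2.1 μ)
  · intro q hq k
    exact ((hU' q hq).2.1 k).normalize ((hU' q hq).2.2.2.1 k)
  · intro q hq
    have hqU := (hU' q hq).2.2.2.2
    refine ⟨isSkew_sharp h q, H.ne q hqU, H.sq_ne q hqU, ?_, ?_, ?_, ?_⟩
    · exact fun μ ↦ inner_normalize ((hU' q hq).2.2.1 μ)
    · intro μ
      beta_reduce
      rw [map_smul, map_smul, smul_comm (-(y μ q ^ 2))]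
      congr 1
      simp only [G]
      rw [map_smul, map_smul, smul_comm (-(y μ q ^ 2))]
      congr 1
      exact eigen_of_cayleyHamilton (H.charpoly q hqU) μ _ rfl
    · exact fun k ↦ inner_normalize ((hU' q hq).2.2.2.1 k)
    · intro k
      have hε1 : ε = 1 := by have := k.isLt; omega
      simp only [G₀]
      rw [map_smul, map_smul, kernel_of_cayleyHamilton (H.charpoly q hqU) hε1, smul_zero, smul_zero]
  · intro μ
    beta_reduce
    rw [hGp, hv.unit, Real.sqrt_one, inv_one, one_smul]
  · intro k
    beta_reduce
    rw [hG₀p, hv.unit₀, Real.sqrt_one, inv_one, one_smul]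

lemma IsEigenFields.isONFrame {d : Fin n → VecField D M} {d₀ : Fin ε → VecField D M}
    (H : IsEigenFields h U y d d₀) (hU : IsOpen U) (hε : ε ≤ 1) (hD : D = 2 * n + ε)
    (hh : IsSmoothForm h) (hy : ∀ q ∈ U, ∀ μ, SmoothFun D (y μ) q) :
    IsONFrame (darbouxFrame h y d d₀) U where
  isOpen := hU
  smooth q hq a := by
    rcases a with μ | μ | k
    · exact H.smooth q hq μ
    · exact (hh.sharp_smooth (H.smooth q hq μ)).smul ((hy q hq μ).inv ((H.data q hq).x_ne μ))
    · exact H.smooth₀ q hq k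
  inner_eq q hq := (H.data q hq).inner_darbouxFam hε
  card := by simp [hD]; ring

/-- The differentials of the eigenvalue functions in a Darboux frame. -/
lemma IsEigenFields.dirDeriv_eq {d : Fin n → VecField D M} {d₀ : Fin ε → VecField D M}
    (H : IsEigenFields h U y d d₀) (hU : IsOpen U) (hε : ε ≤ 1) (hD : D = 2 * n + ε)
    (hy : ∀ q ∈ U, ∀ μ, SmoothFun D (y μ) q)
    (hh : IsSmoothForm h) (hg : IsGCKY T h)
    (hc : ∀ (p : M) (u v w : TangentSpace (𝓡 D) p), dT T h p u v w = 0) {q : M} (hq : q ∈ U)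
    (μ : Fin n) (a : Idx n ε) :
    dirDeriv (y μ) q (darbouxFrame h y d d₀ a q) =
      (if a = un μ then assocForm T h q (darbouxFrame h y d d₀ (hat μ) q) else 0)
      - (if a = hat μ then assocForm T h q (darbouxFrame h y d d₀ (un μ) q) else 0) := by
  have hE := H.isONFrame hU hε hD hh hy
  rw [← hE.gcky_frame hq hh hg hc]
  have h1 : dirDeriv (fun r ↦ h r ![darbouxFrame h y d d₀ (un μ) r,
      darbouxFrame h y d d₀ (hat μ) r]) q (darbouxFrame h y d d₀ a q) =
      dirDeriv (y μ) q (darbouxFrame h y d d₀ a q) := by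
    refine dirDeriv_congr ?_ _
    filter_upwards [hE.eventually_mem hq] with r hr
    rw [H.darboux hε hr]
    simp [darbouxMat]
  -- In the component μμ̂ only Γ_{aμμ} and Γ_{aμ̂μ̂} multiply nonzero entries of h, and both vanish
  -- by skewness.
  have hs : ∀ a b, connFun T (darbouxFrame h y d d₀) a b b q = 0 := fun a b ↦ by
    linarith [hE.connFun_skew hq T a b b]
  simp only [h1, H.darboux hε hq]
  simp [Fintype.sum_sum_type, darbouxMat, hs]

end AdaptedFrames

/-! ### Rotating each eigenplane so that e_μ points along the gradient of x_μ. -/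

section Rotation

variable {D : ℕ} {M : Type*} [TopologicalSpace M] [ChartedSpace (EuclideanSpace ℝ (Fin D)) M]
  [IsManifold (𝓡 D) ∞ M] [RiemannianBundle (fun p : M ↦ TangentSpace (𝓡 D) p)]
  [IsContMDiffRiemannianBundle (𝓡 D) ∞ (EuclideanSpace ℝ (Fin D))
      (fun p : M ↦ TangentSpace (𝓡 D) p)]
  {n ε : ℕ} {T : Form D M 3} {h : Form D M 2} {U : Set M} {y : Fin n → M → ℝ}

lemma IsEigenSystem.exists_adaptedFrame (H : IsEigenSystem ε h U y) (hε : ε ≤ 1)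
    (hD : D = 2 * n + ε) (hh : IsSmoothForm h) (hg : IsGCKY T h)
    (hc : ∀ (p : M) (u v w : TangentSpace (𝓡 D) p), dT T h p u v w = 0) {p : M} (hp : p ∈ U)
    {v : Fin n → TangentSpace (𝓡 D) p} {v₀ : Fin ε → TangentSpace (𝓡 D) p}
    (hv : IsDarbouxData (sharp h p) (fun μ ↦ y μ p) v v₀) :
    ∃ (U' : Set M) (E : Idx n ε → VecField D M) (s : Fin n → M → ℝ),
      IsAdaptedFrame T h E U' y s ∧ p ∈ U' ∧ (∀ μ, 0 < s μ p) ∧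
      ((∀ μ, assocForm T h p (v μ) = 0) →
        (∀ μ, 0 ≤ assocForm T h p (darbouxFam (sharp h p) (fun μ ↦ y μ p) v v₀ (hat μ))) →
        ∀ a, E a p = darbouxFam (sharp h p) (fun μ ↦ y μ p) v v₀ a) := by
  obtain ⟨U', d, d₀, hUo, hUU, hpU, hd, hdp, hd₀p⟩ := H.exists_eigenFields hε hh hp hv
  have hy : ∀ q ∈ U', ∀ μ, SmoothFun D (y μ) q := fun q hq ↦ H.smooth q (hUU hq)
  set F := darbouxFrame h y d d₀ with hF
  have hFr : IsONFrame F U' := hd.isONFrame hUo hε hD hh hy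
  have hFd : ∀ q ∈ U', ∀ μ a, dirDeriv (y μ) q (F a q) =
      (if a = un μ then assocForm T h q (F (hat μ) q) else 0)
      - (if a = hat μ then assocForm T h q (F (un μ) q) else 0) := fun q hq ↦
    hd.dirDeriv_eq hUo hε hD hy hh hg hc hq
  have hFp : ∀ a, F a p = darbouxFam (sharp h p) (fun μ ↦ y μ p) v v₀ a := fun a ↦ by
    simp only [hF, darbouxFrame, hdp, hd₀p]
  -- (A, B) = (ξ_μ̂, -ξ_μ) are the only components of dy_μ, so A² + B² > 0 and the rotation angle is
  -- smooth wherever dy_μ ≠ 0.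
  let A : Fin n → M → ℝ := fun μ q ↦ dirDeriv (y μ) q (F (un μ) q)
  let B : Fin n → M → ℝ := fun μ q ↦ dirDeriv (y μ) q (F (hat μ) q)
  let N : Fin n → M → ℝ := fun μ q ↦ A μ q * A μ q + B μ q * B μ q
  let s : Fin n → M → ℝ := fun μ q ↦ √(N μ q)
  have hev : ∀ q ∈ U', ∀ μ, ∀ᶠ r in nhds q, SmoothFun D (y μ) r := fun q hq μ ↦ by
    filter_upwards [hUo.mem_nhds hq] with r hr using hy r hr μ
  have hA : ∀ q ∈ U', ∀ μ, SmoothFun D (A μ) q := fun q hq μ ↦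
    (hFr.smooth q hq (un μ)).dirDerivFun (hy q hq μ) (hev q hq μ)
  have hB : ∀ q ∈ U', ∀ μ, SmoothFun D (B μ) q := fun q hq μ ↦
    (hFr.smooth q hq (hat μ)).dirDerivFun (hy q hq μ) (hev q hq μ)
  have hoff : ∀ q ∈ U', ∀ μ a, a ≠ un μ → a ≠ hat μ → dirDeriv (y μ) q (F a q) = 0 := by
    intro q hq μ a h1 h2
    rw [hFd q hq, if_neg h1, if_neg h2, sub_zero]
  have hNpos : ∀ q ∈ U', ∀ μ, 0 < N μ q := by
    intro q hq μ
    refine lt_of_le_of_ne (add_nonneg (mul_self_nonneg _) (mul_self_nonneg _)) fun h0 ↦ ?_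
    have hA0 : A μ q = 0 := by nlinarith [mul_self_nonneg (A μ q), mul_self_nonneg (B μ q), h0]
    have hB0 : B μ q = 0 := by nlinarith [mul_self_nonneg (A μ q), mul_self_nonneg (B μ q), h0]
    obtain ⟨w, hw⟩ := H.diff_ne q (hUU hq) μ
    apply hw
    rw [← hFr.sum_inner_smul hq w, dirDeriv_sum]
    refine Finset.sum_eq_zero fun a _ ↦ ?_
    rw [dirDeriv_smul]
    by_cases h1 : a = un μ
    · subst h1; exact mul_eq_zero_of_right _ hA0
    by_cases h2 : a = hat μ
    · subst h2; exact mul_eq_zero_of_right _ hB0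
    rw [hoff q hq μ a h1 h2, mul_zero]
  have hspos : ∀ q ∈ U', ∀ μ, 0 < s μ q := fun q hq μ ↦ Real.sqrt_pos.2 (hNpos q hq μ)
  have hss : ∀ q ∈ U', ∀ μ, s μ q * s μ q = A μ q * A μ q + B μ q * B μ q := fun q hq μ ↦
    Real.mul_self_sqrt (hNpos q hq μ).le
  have hsm : ∀ q ∈ U', ∀ μ, SmoothFun D (s μ) q := fun q hq μ ↦
    SmoothFun.sqrt (((hA q hq μ).mul (hA q hq μ)).add ((hB q hq μ).mul (hB q hq μ)))
      (hNpos q hq μ).ne'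
  let d' : Fin n → VecField D M := fun μ q ↦
    (A μ q * (s μ q)⁻¹) • F (un μ) q + (B μ q * (s μ q)⁻¹) • F (hat μ) q
  have hLun : ∀ q ∈ U', ∀ μ, sharp h q (F (un μ) q) = y μ q • F (hat μ) q := fun q hq ↦
    (hd.data q hq).apply_un
  have hLhat : ∀ q ∈ U', ∀ μ, sharp h q (F (hat μ) q) = - y μ q • F (un μ) q := fun q hq ↦
    (hd.data q hq).apply_hat
  have hd' : IsEigenFields h U' y d' d₀ := by
    refine ⟨fun q hq μ ↦ ?_, hd.smooth₀, fun q hq ↦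
      ⟨isSkew_sharp h q, (hd.data q hq).x_ne, (hd.data q hq).x_sq_ne, fun μ ↦ ?_, fun μ ↦ ?_,
        (hd.data q hq).unit₀, (hd.data q hq).ker⟩⟩
    · have hinv := (hsm q hq μ).inv (hspos q hq μ).ne'
      exact ((hFr.smooth q hq _).smul ((hA q hq μ).mul hinv)).add
        ((hFr.smooth q hq _).smul ((hB q hq μ).mul hinv))
    · simp only [d', inner_add_left, inner_add_right, inner_smul_left, inner_smul_right,
        conj_trivial, hFr.inner_eq q hq]
      simp only [if_true, reduceCtorEq, if_false]
      have h1 := hss q hq μ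
      have h2 := (hspos q hq μ).ne'
      field_simp
      linear_combination -h1
    · simp only [d', map_add, map_smul, hLun q hq, hLhat q hq, smul_add, smul_smul]
      congr 1
      · congr 1; ring
      · congr 1; ring
  set E := darbouxFrame h y d' d₀ with hEdef
  have hE : IsONFrame E U' := hd'.isONFrame hUo hε hD hh hy
  have hEd : ∀ q ∈ U', ∀ μ a, dirDeriv (y μ) q (E a q) =
      (if a = un μ then assocForm T h q (E (hat μ) q) else 0)
      - (if a = hat μ then assocForm T h q (E (un μ) q) else 0) := fun q hq ↦
    hd'.dirDeriv_eq hUo hε hD hy hh hg hc hq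
  have hEun : ∀ μ q, E (un μ) q =
      (A μ q * (s μ q)⁻¹) • F (un μ) q + (B μ q * (s μ q)⁻¹) • F (hat μ) q := fun μ q ↦ rfl
  have hEhat : ∀ q ∈ U', ∀ μ, E (hat μ) q =
      (A μ q * (s μ q)⁻¹) • F (hat μ) q - (B μ q * (s μ q)⁻¹) • F (un μ) q := by
    intro q hq μ
    have : E (hat μ) q = (y μ q)⁻¹ • sharp h q (d' μ q) := rfl
    rw [this]
    simp only [d', map_add, map_smul, hLun q hq, hLhat q hq, smul_add, smul_smul, sub_eq_add_neg,
      ← neg_smul]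
    have := (hd.data q hq).x_ne μ
    congr 1
    · congr 1; field_simp
    · congr 1; field_simp
  have hdun : ∀ q ∈ U', ∀ μ, dirDeriv (y μ) q (E (un μ) q) = s μ q := by
    intro q hq μ
    rw [hEun, dirDeriv_add, dirDeriv_smul, dirDeriv_smul]
    change A μ q * (s μ q)⁻¹ * A μ q + B μ q * (s μ q)⁻¹ * B μ q = s μ q
    have h1 := hss q hq μ
    have h2 := (hspos q hq μ).ne'
    field_simp
    linear_combination -h1
  have hdhat : ∀ q ∈ U', ∀ μ, dirDeriv (y μ) q (E (hat μ) q) = 0 := by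
    intro q hq μ
    rw [hEhat q hq, sub_eq_add_neg, ← neg_smul, dirDeriv_add, dirDeriv_smul, dirDeriv_smul]
    change A μ q * (s μ q)⁻¹ * B μ q + -(B μ q * (s μ q)⁻¹) * A μ q = 0
    ring
  refine ⟨U', E, s, ⟨hE, hy, hsm, (hd.data · · |>.x_ne), fun q hq μ ν hμν ↦
    sub_ne_zero.2 ((hd.data q hq).x_sq_ne μ ν hμν), fun q hq μ ↦ (hspos q hq μ).ne',
    fun q hq ↦ hd'.darboux hε hq, ?_, ?_, ?_⟩, hpU, hspos p hpU, ?_⟩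
  · intro q hq μ
    have := hEd q hq μ (hat μ)
    rw [hdhat q hq, if_neg (by simp), if_pos rfl] at this
    linarith
  · intro q hq μ
    have := hEd q hq μ (un μ)
    rw [hdun q hq, if_pos rfl, if_neg (by simp)] at this
    linarith
  · intro q hq μ a
    split_ifs with h1
    · rw [h1, hdun q hq]
    · by_cases h2 : a = hat μ
      · rw [h2, hdhat q hq]
      · rw [hEd q hq, if_neg h1, if_neg h2, sub_zero]
  · intro h1 h2 a
    -- If ξ already has canonical form at `p`, then B = 0 and A = s > 0 there, so the rotation is
    -- the identity at `p`.
    have hB0 : ∀ μ, B μ p = 0 := fun μ ↦ by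
      have := hFd p hpU μ (hat μ)
      rw [if_neg (by simp), if_pos rfl, hFp (un μ)] at this
      change B μ p = _ at this
      rw [this]
      have : darbouxFam (sharp h p) (fun μ ↦ y μ p) v v₀ (un μ) = v μ := rfl
      rw [this, h1]; simp
    have hA0 : ∀ μ, 0 ≤ A μ p := fun μ ↦ by
      have := hFd p hpU μ (un μ)
      rw [if_neg (show un μ ≠ hat μ by simp), if_pos rfl, hFp (hat μ), sub_zero] at this
      change A μ p = _ at this
      rw [this]
      exact h2 μ
    have hAs : ∀ μ, A μ p * (s μ p)⁻¹ = 1 := fun μ ↦ by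
      have h3 := hss p hpU μ
      have h4 := hspos p hpU μ
      rw [hB0, mul_zero, add_zero] at h3
      have : s μ p = A μ p := by nlinarith [hA0 μ]
      rw [this] at h4 ⊢
      exact mul_inv_cancel₀ h4.ne'
    rcases a with μ | μ | k
    · change E (un μ) p = _
      rw [hEun, hAs, hB0, one_smul, zero_mul, zero_smul, add_zero, hFp]
    · change E (hat μ) p = _
      rw [hEhat p hpU, hAs, hB0, one_smul, zero_mul, zero_smul, sub_zero, hFp]
    · exact hFp (zer k)

end Rotation

/-! ### Perturbation of possibly multiple eigenvalues. -/

section EigenvalueCurves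

lemma eval_prod_eq_zero_of_sq_eq {n ε : ℕ} (y : Fin n → ℝ) (μ : Fin n) {z : ℝ}
    (hz : z ^ 2 = y μ ^ 2) :
    ((X ^ ε * ∏ μ, (X ^ 2 + C (y μ ^ 2)) : ℝ[X]).map Complex.ofRealHom).eval
      (Complex.I * (z : ℂ)) = 0 := by
  rcases sq_eq_sq_iff_eq_or_eq_neg.1 hz with h | h
  · rw [h, eval_prod_eq_zero]
  · have := eval_prod_eq_zero (ε := ε) (fun ν ↦ - y ν) μ
    simp only [neg_sq] at this
    rw [h, this]

lemma star_dotProduct_mulVec_of_skew {m : Type*} [Fintype m] {A : Matrix m m ℝ}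
    (hA : A.transpose = - A) {z : ℝ} {w : m → ℂ}
    (hw : (A.map Complex.ofReal).mulVec w = (Complex.I * (z : ℂ)) • w) (u : m → ℂ) :
    star w ⬝ᵥ (A.map Complex.ofReal).mulVec u = Complex.I * (z : ℂ) * (star w ⬝ᵥ u) := by
  have hA' : (A.map Complex.ofReal).conjTranspose = - A.map Complex.ofReal := by
    ext a b
    have := congrFun (congrFun hA a) b
    simp only [Matrix.transpose_apply, Matrix.neg_apply] at this
    simp [this]
  have h1 := congrArg star hw
  rw [Matrix.star_mulVec, hA', Matrix.vecMul_neg, star_smul] at h1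
  rw [Matrix.dotProduct_mulVec, ← neg_neg (Matrix.vecMul _ _), h1, neg_dotProduct,
    smul_dotProduct]
  simp

/-- First-order perturbation theory for an eigenvalue, without any assumption on its
multiplicity. -/
lemma exists_limit_eigenvector {m : Type*} [Fintype m] [DecidableEq m] {H : ℝ → Matrix m m ℝ}
    {H' : Matrix m m ℝ} {z : ℝ → ℝ} {z' : ℝ} (hskew : (H 0).transpose = - H 0)
    (hH : ∀ a b, HasDerivAt (fun t ↦ H t a b) (H' a b) 0) (hz : HasDerivAt z z' 0)
    (hroot : ∀ᶠ t in nhds 0,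
      (((H t).charpoly.map Complex.ofRealHom).eval (Complex.I * (z t : ℂ)) = 0)) :
    ∃ v : m → ℂ, v ≠ 0 ∧
      ((H 0).map Complex.ofReal).mulVec v = (Complex.I * (z 0 : ℂ)) • v ∧
      ∀ w : m → ℂ, ((H 0).map Complex.ofReal).mulVec w = (Complex.I * (z 0 : ℂ)) • w →
        star w ⬝ᵥ (H'.map Complex.ofReal).mulVec v = Complex.I * (z' : ℂ) * (star w ⬝ᵥ v) := by
  have hτ : Filter.Tendsto (fun k : ℕ ↦ (1 / ((k : ℝ) + 1))) Filter.atTop (nhds 0) :=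
    tendsto_one_div_add_atTop_nhds_zero_nat
  obtain ⟨K, hK⟩ := Filter.eventually_atTop.1 (hτ.eventually hroot)
  let τ : ℕ → ℝ := fun k ↦ 1 / (((k + K : ℕ) : ℝ) + 1)
  have hτ0 : Filter.Tendsto τ Filter.atTop (nhds 0) := hτ.comp (Filter.tendsto_add_atTop_nat K)
  have hτne : ∀ k, τ k ≠ 0 := fun k ↦ by positivity
  have hex : ∀ k, ∃ v : m → ℂ, v ∈ Metric.sphere (0 : m → ℂ) 1 ∧
      ((H (τ k)).map Complex.ofReal).mulVec v = (Complex.I * (z (τ k) : ℂ)) • v := by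
    intro k
    obtain ⟨v, hv, hv'⟩ := exists_complex_eigenvector _ (hK (k + K) (Nat.le_add_left _ _))
    refine ⟨((‖v‖⁻¹ : ℝ) : ℂ) • v, ?_, ?_⟩
    · rw [mem_sphere_zero_iff_norm, norm_smul, Complex.norm_real, norm_inv, norm_norm,
        inv_mul_cancel₀ (norm_ne_zero_iff.2 hv)]
    · rw [Matrix.mulVec_smul, hv', smul_comm]
  choose v hv1 hv2 using hex
  -- Nothing is known about continuity of the eigenvectors; compactness of the unit sphere supplies
  -- a limit along a sequence of nonzero times.
  obtain ⟨v₀, hv₀, φ, hφ, hlim⟩ := (isCompact_sphere (0 : m → ℂ) 1).tendsto_subseq hv1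
  have hτφ : Filter.Tendsto (τ ∘ φ) Filter.atTop (nhds 0) := hτ0.comp hφ.tendsto_atTop
  have hlimc : ∀ a, Filter.Tendsto (fun k ↦ v (φ k) a) Filter.atTop (nhds (v₀ a)) :=
    fun a ↦ (tendsto_pi_nhds.1 hlim) a
  have hzlim : Filter.Tendsto (fun k ↦ ((z (τ (φ k)) : ℝ) : ℂ)) Filter.atTop (nhds (z 0 : ℂ)) :=
    (Complex.continuous_ofReal.tendsto _).comp (hz.continuousAt.tendsto.comp hτφ)
  have hHlim : ∀ a b, Filter.Tendsto (fun k ↦ ((H (τ (φ k)) a b : ℝ) : ℂ)) Filter.atTop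
      (nhds (H 0 a b : ℂ)) := fun a b ↦
    (Complex.continuous_ofReal.tendsto _).comp ((hH a b).continuousAt.tendsto.comp hτφ)
  have hslope : ∀ {f : ℝ → ℝ} {f' : ℝ}, HasDerivAt f f' 0 →
      Filter.Tendsto (fun k ↦ (((τ (φ k))⁻¹ * (f (τ (φ k)) - f 0) : ℝ) : ℂ)) Filter.atTop
        (nhds (f' : ℂ)) := by
    intro f f' hf
    refine (Complex.continuous_ofReal.tendsto _).comp ?_
    have h1 := hf.tendsto_slope_zero
    have h2 : Filter.Tendsto (τ ∘ φ) Filter.atTop (nhdsWithin 0 {0}ᶜ) :=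
      tendsto_nhdsWithin_iff.2 ⟨hτφ, Filter.Eventually.of_forall fun k ↦ hτne _⟩
    simpa [Function.comp_def] using h1.comp h2
  refine ⟨v₀, ?_, ?_, ?_⟩
  · rintro rfl
    simp at hv₀
  · funext a
    have h1 : Filter.Tendsto (fun k ↦ ∑ b, ((H (τ (φ k)) a b : ℝ) : ℂ) * v (φ k) b) Filter.atTop
        (nhds (∑ b, (H 0 a b : ℂ) * v₀ b)) :=
      tendsto_finsetSum _ fun b _ ↦ (hHlim a b).mul (hlimc b)
    have h2 : Filter.Tendsto (fun k ↦ Complex.I * ((z (τ (φ k)) : ℝ) : ℂ) * v (φ k) a) Filter.atTop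
        (nhds (Complex.I * (z 0 : ℂ) * v₀ a)) :=
      (tendsto_const_nhds.mul hzlim).mul (hlimc a)
    have h3 : (fun k ↦ ∑ b, ((H (τ (φ k)) a b : ℝ) : ℂ) * v (φ k) b) =
        fun k ↦ Complex.I * ((z (τ (φ k)) : ℝ) : ℂ) * v (φ k) a := by
      funext k
      exact congrFun (hv2 (φ k)) a
    rw [h3] at h1
    exact tendsto_nhds_unique h1 h2
  · intro w hw
    -- Pairing with an eigenvector w of H(0) turns H(0) into the scalar i z(0), so the difference
    -- quotient of H between w and v_k equals that of i z times their product.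
    have hleft := star_dotProduct_mulVec_of_skew hskew hw
    have h1 : Filter.Tendsto (fun k ↦ ∑ a, star w a *
        ∑ b, (((τ (φ k))⁻¹ * (H (τ (φ k)) a b - H 0 a b) : ℝ) : ℂ) * v (φ k) b) Filter.atTop
        (nhds (star w ⬝ᵥ (H'.map Complex.ofReal).mulVec v₀)) :=
      tendsto_finsetSum _ fun a _ ↦ tendsto_const_nhds.mul
        (tendsto_finsetSum _ fun b _ ↦ (hslope (hH a b)).mul (hlimc b))
    have h2 : Filter.Tendsto (fun k ↦ Complex.I *
        (((τ (φ k))⁻¹ * (z (τ (φ k)) - z 0) : ℝ) : ℂ) * ∑ a, star w a * v (φ k) a) Filter.atTop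
        (nhds (Complex.I * (z' : ℂ) * (star w ⬝ᵥ v₀))) :=
      (tendsto_const_nhds.mul (hslope hz)).mul
        (tendsto_finsetSum _ fun a _ ↦ tendsto_const_nhds.mul (hlimc a))
    refine tendsto_nhds_unique h1 (h2.congr fun k ↦ ?_)
    have e1 := hleft (v (φ k))
    have e2 : star w ⬝ᵥ ((H (τ (φ k))).map Complex.ofReal).mulVec (v (φ k)) =
        Complex.I * (z (τ (φ k)) : ℂ) * (star w ⬝ᵥ v (φ k)) := by
      rw [hv2, dotProduct_smul, smul_eq_mul]
    simp only [dotProduct, Matrix.mulVec, Matrix.map_apply] at e1 e2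
    have e3 : ∀ a, ∑ b, (((τ (φ k))⁻¹ * (H (τ (φ k)) a b - H 0 a b) : ℝ) : ℂ) * v (φ k) b =
        ((τ (φ k) : ℂ))⁻¹ * (∑ b, (H (τ (φ k)) a b : ℂ) * v (φ k) b
          - ∑ b, (H 0 a b : ℂ) * v (φ k) b) := by
      intro a
      rw [← Finset.sum_sub_distrib, Finset.mul_sum]
      refine Finset.sum_congr rfl fun b _ ↦ ?_
      push_cast
      ring
    simp only [e3]
    have e4 : ∀ a, star w a * ((τ (φ k) : ℂ)⁻¹ * (∑ b, (H (τ (φ k)) a b : ℂ) * v (φ k) b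
          - ∑ b, (H 0 a b : ℂ) * v (φ k) b)) = (τ (φ k) : ℂ)⁻¹ *
        (star w a * ∑ b, (H (τ (φ k)) a b : ℂ) * v (φ k) b
          - star w a * ∑ b, (H 0 a b : ℂ) * v (φ k) b) := fun a ↦ by ring
    simp only [e4]
    rw [← Finset.mul_sum, Finset.sum_sub_distrib, e1, e2]
    push_cast
    ring

open ComplexConjugate in
-- The hermitian form -i(ā b - b̄ a) has at most one positive direction. With values 1 and 2
-- relative to the norm, the two vectors are orthogonal (m = 0); then conj a₁ · b₂ = conj b₁ · a₂
-- forces opposite signs of Im(conj a₁ · b₁) and Im(conj a₂ · b₂), although both are positive.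
lemma no_two_definite {a₁ b₁ a₂ b₂ m : ℂ} {n₁ n₂ : ℝ} (hn₁ : 0 < n₁) (hn₂ : 0 < n₂)
    (h₁₁ : conj a₁ * b₁ - conj b₁ * a₁ = Complex.I * n₁)
    (h₂₂ : conj a₂ * b₂ - conj b₂ * a₂ = Complex.I * 2 * n₂)
    (h₂₁ : conj a₂ * b₁ - conj b₂ * a₁ = Complex.I * conj m)
    (h₁₂ : conj a₁ * b₂ - conj b₁ * a₂ = Complex.I * 2 * m) : False := by
  have hm : m = 0 := by
    have := congrArg conj h₁₂
    simp only [map_sub, map_mul, Complex.conj_conj, Complex.conj_I, Complex.conj_ofNat] at this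
    have h0 : Complex.I * conj m = 0 := by linear_combination this + h₂₁
    simpa using h0
  rw [hm, mul_zero, sub_eq_zero] at h₁₂
  have i1 := congrArg Complex.im h₁₁
  have i2 := congrArg Complex.im h₂₂
  have key : conj a₁ * a₁ * (conj a₂ * b₂) = conj a₂ * a₂ * (conj b₁ * a₁) := by
    linear_combination a₁ * conj a₂ * h₁₂
  have i3 := congrArg Complex.im key
  simp [mul_comm] at i1 i2 i3
  have ha : 0 < a₁.re * a₁.re + a₁.im * a₁.im := by
    rcases eq_or_ne a₁ 0 with h | h
    · rw [h] at i1; simp at i1; linarith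
    · rw [← Complex.normSq_apply]; exact Complex.normSq_pos.2 h
  have hb : 0 ≤ a₂.re * a₂.re + a₂.im * a₂.im :=
    add_nonneg (mul_self_nonneg _) (mul_self_nonneg _)
  nlinarith [mul_pos ha hn₂, mul_nonneg hb hn₁.le]

end EigenvalueCurves

lemma exists_apply_eq_of_linearIndependent {V : Type*} [AddCommGroup V] [Module ℝ V]
    {f g : V →ₗ[ℝ] ℝ} (h : LinearIndependent ℝ ![f, g]) (a b : ℝ) : ∃ v, f v = a ∧ g v = b := by
  have hp := LinearIndependent.pair_iff.1 h
  have hf : f ≠ 0 := by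
    rintro rfl
    have := hp 1 0 (by simp)
    simp at this
  obtain ⟨u, hu⟩ : ∃ u, f u ≠ 0 := by
    by_contra! hcon
    exact hf (LinearMap.ext hcon)
  obtain ⟨w, hw⟩ : ∃ w, f u * g w - g u * f w ≠ 0 := by
    by_contra! hcon
    have := hp (- g u) (f u) (by
      ext w
      have := hcon w
      simp only [LinearMap.add_apply, LinearMap.smul_apply, smul_eq_mul, LinearMap.zero_apply]
      linarith)
    exact hu this.2
  -- Cramer's rule in the span of u and w.
  refine ⟨((f u * g w - g u * f w)⁻¹ * (a * g w - b * f w)) • u +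
    ((f u * g w - g u * f w)⁻¹ * (b * f u - a * g u)) • w, ?_, ?_⟩ <;>
  · simp only [map_add, map_smul, smul_eq_mul]
    field_simp
    ring

/-! ### Test curves for directional derivatives. -/

section ChartCurves

variable {D : ℕ} {M : Type*} [TopologicalSpace M] [ChartedSpace (EuclideanSpace ℝ (Fin D)) M]

/-- The curve through `p` which is affine in the preferred chart, with velocity `v`. -/
noncomputable def chartCurve (p : M) (v : EuclideanSpace ℝ (Fin D)) (t : ℝ) : M :=
  (extChartAt (𝓡 D) p).symm (extChartAt (𝓡 D) p p + t • v)

lemma chartCurve_zero (p : M) (v : EuclideanSpace ℝ (Fin D)) : chartCurve p v 0 = p := by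
  simp [chartCurve]

lemma hasDerivAt_comp_chartCurve {f : M → ℝ} {p : M} (hf : DiffFun D f p)
    (v : EuclideanSpace ℝ (Fin D)) :
    HasDerivAt (fun t ↦ f (chartCurve p v t)) (dirDeriv f p v) 0 := by
  let L : EuclideanSpace ℝ (Fin D) →L[ℝ] ℝ := mfderiv (𝓡 D) 𝓘(ℝ, ℝ) f p
  have h1 : HasFDerivWithinAt (f ∘ (extChartAt (𝓡 D) p).symm) L (Set.range (𝓡 D))
    (extChartAt (𝓡 D) p p) := hf.hasMFDerivAt.2
  rw [ModelWithCorners.range_eq_univ, hasFDerivWithinAt_univ] at h1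
  have h2 : HasDerivAt (fun t : ℝ ↦ extChartAt (𝓡 D) p p + t • v) v 0 := by
    simpa using ((hasDerivAt_id (0 : ℝ)).smul_const v).const_add (extChartAt (𝓡 D) p p)
  have h3 := HasFDerivAt.comp_hasDerivAt (0 : ℝ)
    (f := fun t : ℝ ↦ extChartAt (𝓡 D) p p + t • v) (by simpa using h1) h2
  exact h3

lemma tendsto_chartCurve (p : M) (v : EuclideanSpace ℝ (Fin D)) :
    Filter.Tendsto (chartCurve p v) (nhds 0) (nhds p) := by
  have h1 : ContinuousAt (extChartAt (𝓡 D) p).symm (extChartAt (𝓡 D) p p) :=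
    continuousAt_extChartAt_symm p
  have h2 : Filter.Tendsto (fun t : ℝ ↦ extChartAt (𝓡 D) p p +
      t • v) (nhds 0) (nhds (extChartAt (𝓡 D) p p)) := by
    have : Continuous (fun t : ℝ ↦ extChartAt (𝓡 D) p p +
      t • v) := by fun_prop
    simpa using this.tendsto 0
  have h3 := h1.tendsto.comp h2
  rwa [extChartAt_to_inv] at h3

end ChartCurves

open ComplexConjugate in
-- Between eigenvectors of a skew H for the same eigenvalue the commutator with Ω cancels, so only
-- the rank-two term is seen. This makes the unknown connection coefficients irrelevant.
lemma star_dotProduct_commutator {m : Type*} [Fintype m] {H Ω H' : Matrix m m ℝ} {x ξ : m → ℝ}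
    (hH : H.transpose = - H)
    (hH' : H' = Ω * H - H * Ω + (Matrix.vecMulVec x ξ - Matrix.vecMulVec ξ x)) {z : ℝ}
    {v w : m → ℂ} (hw : (H.map Complex.ofReal).mulVec w = (Complex.I * (z : ℂ)) • w)
    (hv : (H.map Complex.ofReal).mulVec v = (Complex.I * (z : ℂ)) • v) :
    star w ⬝ᵥ (H'.map Complex.ofReal).mulVec v =
      conj (∑ b, (x b : ℂ) * w b) * (∑ b, (ξ b : ℂ) * v b)
      - conj (∑ b, (ξ b : ℂ) * w b) * (∑ b, (x b : ℂ) * v b) := by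
  have e : H'.map Complex.ofReal = Ω.map Complex.ofReal * H.map Complex.ofReal -
      H.map Complex.ofReal * Ω.map Complex.ofReal +
      (Matrix.vecMulVec (fun a ↦ (x a : ℂ)) (fun a ↦ (ξ a : ℂ))
        - Matrix.vecMulVec (fun a ↦ (ξ a : ℂ)) (fun a ↦ (x a : ℂ))) := by
    ext a b
    simp [hH', Matrix.mul_apply, Matrix.vecMulVec_apply]
  have h1 : star w ⬝ᵥ ((Ω.map Complex.ofReal * H.map Complex.ofReal).mulVec v) =
      Complex.I * (z : ℂ) * (star w ⬝ᵥ (Ω.map Complex.ofReal).mulVec v) := by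
    rw [← Matrix.mulVec_mulVec, hv, Matrix.mulVec_smul, dotProduct_smul, smul_eq_mul]
  have h2 : star w ⬝ᵥ ((H.map Complex.ofReal * Ω.map Complex.ofReal).mulVec v) =
      Complex.I * (z : ℂ) * (star w ⬝ᵥ (Ω.map Complex.ofReal).mulVec v) := by
    rw [← Matrix.mulVec_mulVec, star_dotProduct_mulVec_of_skew hH hw]
  have h3 : ∀ a b : m → ℝ, star w ⬝ᵥ (Matrix.vecMulVec (fun i ↦ (a i : ℂ))
      (fun i ↦ (b i : ℂ))).mulVec v = conj (∑ i, (a i : ℂ) * w i) * (∑ i, (b i : ℂ) * v i) := by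
    intro a b
    simp only [dotProduct, Matrix.mulVec, Matrix.vecMulVec_apply, map_sum, map_mul,
      Complex.conj_ofReal, Finset.sum_mul, Finset.mul_sum, Pi.star_apply, RCLike.star_def]
    rw [Finset.sum_comm]
    refine Finset.sum_congr rfl fun i _ ↦ Finset.sum_congr rfl fun j _ ↦ ?_
    ring
  rw [e, Matrix.add_mulVec, Matrix.sub_mulVec, Matrix.sub_mulVec, dotProduct_add, dotProduct_sub,
    dotProduct_sub, h1, h2, h3, h3]
  ring

/-! ### Distinctness of the eigenvalues. -/

section Distinct

variable {D : ℕ} {M : Type*} [TopologicalSpace M] [ChartedSpace (EuclideanSpace ℝ (Fin D)) M]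
  [IsManifold (𝓡 D) ∞ M] [RiemannianBundle (fun p : M ↦ TangentSpace (𝓡 D) p)]
  [IsContMDiffRiemannianBundle (𝓡 D) ∞ (EuclideanSpace ℝ (Fin D))
      (fun p : M ↦ TangentSpace (𝓡 D) p)]

/-- The derivative of the component matrix of a closed GCKY tensor in an orthonormal frame. -/
lemma IsONFrame.dirDeriv_matrix {ι : Type*} [Fintype ι] [DecidableEq ι] {E : ι → VecField D M}
    {U : Set M} (hE : IsONFrame E U) {q : M} (hq : q ∈ U) {T : Form D M 3} {h : Form D M 2}
    (hh : IsSmoothForm h) (hg : IsGCKY T h)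
    (hc : ∀ (p : M) (u v w : TangentSpace (𝓡 D) p), dT T h p u v w = 0)
    (X : TangentSpace (𝓡 D) q) :
    (Matrix.of fun b c ↦ dirDeriv (fun r ↦ h r ![E b r, E c r]) q X) =
      (Matrix.of fun b d ↦ ∑ a, inner ℝ (E a q) X * connFun T E a b d q) *
        (Matrix.of fun b c ↦ h q ![E b q, E c q]) -
      (Matrix.of fun b c ↦ h q ![E b q, E c q]) *
        (Matrix.of fun b d ↦ ∑ a, inner ℝ (E a q) X * connFun T E a b d q) +
      (Matrix.vecMulVec (fun b ↦ inner ℝ (E b q) X) (fun c ↦ assocForm T h q (E c q))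
        - Matrix.vecMulVec (fun c ↦ assocForm T h q (E c q)) (fun b ↦ inner ℝ (E b q) X)) := by
  ext b c
  have N := fun a ↦ hE.gcky_frame hq hh hg hc a b c
  have hX : dirDeriv (fun r ↦ h r ![E b r, E c r]) q X =
      ∑ a, inner ℝ (E a q) X * dirDeriv (fun r ↦ h r ![E b r, E c r]) q (E a q) := by
    conv_lhs => rw [← hE.sum_inner_smul hq X, dirDeriv_sum]
    simp only [dirDeriv_smul]
  have N' : ∀ a, dirDeriv (fun r ↦ h r ![E b r, E c r]) q (E a q) =
      ∑ d, connFun T E a b d q * h q ![E d q, E c q] -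
      ∑ d, h q ![E b q, E d q] * connFun T E a d c q +
      ((if a = b then assocForm T h q (E c q) else 0)
      - (if a = c then assocForm T h q (E b q) else 0)) := by
    intro a
    rw [← N a]
    have : ∑ d, h q ![E b q, E d q] * connFun T E a d c q =
        - ∑ d, connFun T E a c d q * h q ![E b q, E d q] := by
      rw [← Finset.sum_neg_distrib]
      refine Finset.sum_congr rfl fun d _ ↦ ?_
      rw [hE.connFun_skew hq T a d c]
      ring
    rw [this]
    ring
  simp only [Matrix.of_apply, Matrix.add_apply, Matrix.sub_apply, Matrix.mul_apply,
    Matrix.vecMulVec_apply]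
  rw [hX]
  simp only [N', mul_add, mul_sub, Finset.sum_add_distrib, Finset.sum_sub_distrib, Finset.mul_sum,
    Finset.sum_mul]
  congr 1
  · congr 1
    · rw [Finset.sum_comm]
      exact Finset.sum_congr rfl fun _ _ ↦ Finset.sum_congr rfl fun _ _ ↦ by ring
    · rw [Finset.sum_comm]
      exact Finset.sum_congr rfl fun _ _ ↦ Finset.sum_congr rfl fun _ _ ↦ by ring
  · simp [mul_comm]

/-- Functionally independent eigenvalues of a closed GCKY tensor are distinct. -/
lemma eigenvalue_sq_ne {n ε : ℕ} {T : Form D M 3} {h : Form D M 2} (hh : IsSmoothForm h)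
    (hg : IsGCKY T h) (hc : ∀ (p : M) (u v w : TangentSpace (𝓡 D) p), dT T h p u v w = 0)
    {p : M} {y : Fin n → M → ℝ} (hy : ∀ μ, DiffFun D (y μ) p)
    (hchar : ∀ᶠ q in nhds p, (sharp h q).charpoly = X ^ ε * ∏ μ, (X ^ 2 + C (y μ q ^ 2)))
    (hind : LinearIndependent ℝ (fun μ ↦ mvfderiv (𝓡 D) (y μ) p)) {μ ν : Fin n} (hμν : μ ≠ ν) :
    y μ p ^ 2 ≠ y ν p ^ 2 := by
  intro heq
  obtain ⟨σ, hσ, hσy⟩ : ∃ σ : ℝ, σ ^ 2 = 1 ∧ y μ p = σ * y ν p := by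
    rcases sq_eq_sq_iff_eq_or_eq_neg.1 heq with h | h
    · exact ⟨1, by norm_num, by rw [h, one_mul]⟩
    · exact ⟨-1, by norm_num, by rw [h, neg_one_mul]⟩
  -- The branches y_μ and σ y_ν start at the same value; X gives them speeds 1 and σ · 2σ = 2. Equal
  -- signs contradict indefiniteness, and unequal speeds make the limit eigenvectors orthogonal.
  obtain ⟨X, hX1, hX2⟩ : ∃ X : TangentSpace (𝓡 D) p, dirDeriv (y μ) p X = 1 ∧
      dirDeriv (y ν) p X = σ * 2 := by
    have h1 : LinearIndependent ℝ
        (fun i : Fin 2 ↦ (mvfderiv (𝓡 D) (y (![μ, ν] i)) p).toLinearMap) := by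
      have h2 : Function.Injective ![μ, ν] := by
        intro i j hij
        fin_cases i <;> fin_cases j <;> simp_all
      exact (hind.comp _ h2).map' (ContinuousLinearMap.coeLM ℝ)
        (LinearMap.ker_eq_bot.2 ContinuousLinearMap.coe_injective)
    have h2 : (fun i : Fin 2 ↦ (mvfderiv (𝓡 D) (y (![μ, ν] i)) p).toLinearMap) =
        ![(mvfderiv (𝓡 D) (y μ) p).toLinearMap, (mvfderiv (𝓡 D) (y ν) p).toLinearMap] := by
      funext i
      fin_cases i <;> rfl
    rw [h2] at h1
    exact exists_apply_eq_of_linearIndependent h1 1 (σ * 2)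
  obtain ⟨E, U, hE, hp⟩ := exists_isONFrame (D := D) p
  let c := chartCurve p X
  have hc0 : c 0 = p := chartCurve_zero p X
  have hctend : Filter.Tendsto c (nhds 0) (nhds p) := tendsto_chartCurve p X
  let H : ℝ → Matrix (Fin D) (Fin D) ℝ := fun t ↦
    Matrix.of fun a b ↦ h (c t) ![E a (c t), E b (c t)]
  let H' : Matrix (Fin D) (Fin D) ℝ :=
    Matrix.of fun b c ↦ dirDeriv (fun r ↦ h r ![E b r, E c r]) p X
  have hskew : (H 0).transpose = - H 0 := by
    ext a b
    exact form₂_swap _ _ _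
  have hH : ∀ a b, HasDerivAt (fun t ↦ H t a b) (H' a b) 0 := fun a b ↦
    hasDerivAt_comp_chartCurve
      (hh.smoothFun (hE.smooth p hp a) (hE.smooth p hp b)).diff X
  have hroot : ∀ (μ : Fin n) (τ : ℝ), τ ^ 2 = 1 → ∀ᶠ t in nhds 0,
      (((H t).charpoly.map Complex.ofRealHom).eval (Complex.I * ((τ * y μ (c t) : ℝ) : ℂ)) = 0) := by
    intro μ τ hτ
    filter_upwards [hctend.eventually hchar, hctend.eventually (hE.eventually_mem hp)] with t h1 h2
    have h3 := charpoly_sharp h (c t) (hE.basis h2)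
    simp only [IsONFrame.basis_apply] at h3
    have h4 : H t = Matrix.of fun a b ↦ h (c t) ![E a (c t), E b (c t)] := rfl
    rw [h4, h3, h1]
    exact eval_prod_eq_zero_of_sq_eq (fun μ ↦ y μ (c t)) μ (by rw [mul_pow, hτ, one_mul])
  have hz : ∀ (μ : Fin n) (τ : ℝ),
      HasDerivAt (fun t ↦ τ * y μ (c t)) (τ * dirDeriv (y μ) p X) 0 := fun μ τ ↦
    (hasDerivAt_comp_chartCurve (hy μ) X).const_mul τ
  obtain ⟨v₁, hv₁, hv₁', hv₁''⟩ := exists_limit_eigenvector hskew hH (hz μ 1)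
    (hroot μ 1 (one_pow 2))
  obtain ⟨v₂, hv₂, hv₂', hv₂''⟩ := exists_limit_eigenvector hskew hH (hz ν σ) (hroot ν σ hσ)
  simp only [hc0, one_mul, ← hσy, hX1, hX2, ← mul_assoc, ← pow_two, hσ] at hv₁' hv₁'' hv₂' hv₂''
  have hH' := hE.dirDeriv_matrix hp hh hg hc X
  have hH0 : H 0 = Matrix.of fun a b ↦ h p ![E a p, E b p] := by
    have : ∀ q, q = p → (Matrix.of fun a b ↦ h q ![E a q, E b q]) =
        Matrix.of fun a b ↦ h p ![E a p, E b p] := by rintro q rfl; rfl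
    exact this _ hc0
  rw [← hH0] at hH'
  have key := fun {v w : Fin D → ℂ} hw hv ↦
    star_dotProduct_commutator (H' := H') (v := v) (w := w) (z := y μ p) hskew hH' hw hv
  have hnorm : ∀ v : Fin D → ℂ, v ≠ 0 →
      ∃ r : ℝ, 0 < r ∧ star v ⬝ᵥ v = (r : ℂ) := by
    intro v hv
    refine ⟨∑ i, Complex.normSq (v i), ?_, ?_⟩
    · obtain ⟨i, hi⟩ := Function.ne_iff.1 hv
      exact Finset.sum_pos' (fun i _ ↦ Complex.normSq_nonneg _)
        ⟨i, Finset.mem_univ i, Complex.normSq_pos.2 hi⟩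
    · simp [dotProduct, Complex.normSq_eq_conj_mul_self]
  obtain ⟨n₁, hn₁, hn₁'⟩ := hnorm v₁ hv₁
  obtain ⟨n₂, hn₂, hn₂'⟩ := hnorm v₂ hv₂
  have h₁₁ := hv₁'' v₁ hv₁'
  have h₂₁ := hv₁'' v₂ hv₂'
  have h₁₂ := hv₂'' v₁ hv₁'
  have h₂₂ := hv₂'' v₂ hv₂'
  rw [key hv₁' hv₁'] at h₁₁
  rw [key hv₂' hv₁'] at h₂₁
  rw [key hv₁' hv₂'] at h₁₂
  rw [key hv₂' hv₂'] at h₂₂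
  refine no_two_definite (m := star v₁ ⬝ᵥ v₂) hn₁ hn₂ (h₁₁.trans ?_) (h₂₂.trans ?_) (h₂₁.trans ?_)
    (h₁₂.trans ?_)
  · rw [hn₁']; push_cast; ring
  · rw [hn₂']; push_cast; ring
  · have : star v₂ ⬝ᵥ v₁ = (starRingEnd ℂ) (star v₁ ⬝ᵥ v₂) := by
      simp [dotProduct, mul_comm]
    rw [this]; push_cast; ring
  · push_cast; ring

end Distinct

/-! ### Trilinear functions are determined on a basis. -/

section Trilinear

variable {V : Type*} [AddCommGroup V] [Module ℝ V]

/-- A trilinear function. -/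
structure IsTrilinear (f : V → V → V → ℝ) : Prop where
  left : ∀ v w, IsLinearMap ℝ fun u ↦ f u v w
  mid : ∀ u w, IsLinearMap ℝ fun v ↦ f u v w
  right : ∀ u v, IsLinearMap ℝ fun w ↦ f u v w

lemma IsTrilinear.add {f g : V → V → V → ℝ} (hf : IsTrilinear f) (hg : IsTrilinear g) :
    IsTrilinear fun u v w ↦ f u v w + g u v w where
  left v w := ((hf.left v w).mk' _ + (hg.left v w).mk' _).isLinear
  mid u w := ((hf.mid u w).mk' _ + (hg.mid u w).mk' _).isLinear
  right u v := ((hf.right u v).mk' _ + (hg.right u v).mk' _).isLinear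

lemma IsTrilinear.const_mul {f : V → V → V → ℝ} (hf : IsTrilinear f) (c : ℝ) :
    IsTrilinear fun u v w ↦ c * f u v w where
  left v w := (c • (hf.left v w).mk' _).isLinear
  mid u w := (c • (hf.mid u w).mk' _).isLinear
  right u v := (c • (hf.right u v).mk' _).isLinear

lemma IsTrilinear.sum {ι : Type*} {s : Finset ι} {f : ι → V → V → V → ℝ}
    (hf : ∀ i, IsTrilinear (f i)) : IsTrilinear fun u v w ↦ ∑ i ∈ s, f i u v w := by
  classical
  induction s using Finset.induction_on with
  | empty =>
    have h0 : IsLinearMap ℝ fun _ : V ↦ (0 : ℝ) := (0 : V →ₗ[ℝ] ℝ).isLinear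
    exact ⟨fun _ _ ↦ h0, fun _ _ ↦ h0, fun _ _ ↦ h0⟩
  | insert i s hi ih =>
    simp only [Finset.sum_insert hi]
    exact (hf i).add ih

lemma IsTrilinear.ext_basis {ι : Type*} (b : Module.Basis ι ℝ V) {f g : V → V → V → ℝ}
    (hf : IsTrilinear f) (hg : IsTrilinear g) (h : ∀ i j k, f (b i) (b j) (b k) = g (b i) (b j) (b k))
    (u v w : V) : f u v w = g u v w := by
  have ext : ∀ {φ ψ : V → ℝ}, IsLinearMap ℝ φ → IsLinearMap ℝ ψ → (∀ i, φ (b i) = ψ (b i)) →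
      ∀ x, φ x = ψ x := fun hφ hψ hi x ↦
    LinearMap.congr_fun (b.ext (f₁ := hφ.mk' _) (f₂ := hψ.mk' _) hi) x
  have h1 : ∀ i j w, f (b i) (b j) w = g (b i) (b j) w := fun i j ↦
    ext (hf.right _ _) (hg.right _ _) (h i j)
  have h2 : ∀ i v w, f (b i) v w = g (b i) v w := fun i v w ↦
    ext (hf.mid _ _) (hg.mid _ _) (fun j ↦ h1 i j w) v
  exact ext (hf.left _ _) (hg.left _ _) (fun i ↦ h2 i v w) u

end Trilinear

/-! ### Reconstruction of a 3-form from its allowed components. -/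

section TorsionFormulas

variable {D : ℕ} {M : Type*} [TopologicalSpace M] [ChartedSpace (EuclideanSpace ℝ (Fin D)) M]
lemma isTrilinear_form (T : Form D M 3) (p : M) :
    IsTrilinear fun u v w : TangentSpace (𝓡 D) p ↦ T p ![u, v, w] where
  left v w := ⟨fun u u' ↦ (T p).map_vecCons_add ![v, w] u u',
    fun c u ↦ (T p).map_vecCons_smul ![v, w] c u⟩
  mid u w := ((tri (T p) u).flip w).isLinear
  right u v := (tri (T p) u v).isLinear

variable [RiemannianBundle (fun p : M ↦ TangentSpace (𝓡 D) p)] {n ε : ℕ}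

lemma wedge₃_eq {p : M} (e : OrthonormalBasis (Idx n ε) ℝ (TangentSpace (𝓡 D) p))
    (a b c : Idx n ε) (u v w : TangentSpace (𝓡 D) p) :
    wedge₃ e a b c u v w =
      coframe e a u * coframe e b v * coframe e c w - coframe e a u * coframe e b w * coframe e c v
      - coframe e a v * coframe e b u * coframe e c w
      + coframe e a v * coframe e b w * coframe e c u
      + coframe e a w * coframe e b u * coframe e c v
      - coframe e a w * coframe e b v * coframe e c u := by
  simp [wedge₃, Matrix.det_fin_three]

lemma isTrilinear_wedge₃ {p : M} (e : OrthonormalBasis (Idx n ε) ℝ (TangentSpace (𝓡 D) p))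
    (a b c : Idx n ε) : IsTrilinear (wedge₃ e a b c) := by
  refine ⟨fun _ _ ↦ ⟨fun _ _ ↦ ?_, fun _ _ ↦ ?_⟩, fun _ _ ↦ ⟨fun _ _ ↦ ?_, fun _ _ ↦ ?_⟩,
    fun _ _ ↦ ⟨fun _ _ ↦ ?_, fun _ _ ↦ ?_⟩⟩ <;>
  · simp only [wedge₃_eq, coframe, inner_add_right, inner_smul_right, smul_eq_mul]
    ring

lemma coframe_self {p : M} (e : OrthonormalBasis (Idx n ε) ℝ (TangentSpace (𝓡 D) p))
    (a b : Idx n ε) : coframe e a (e b) = if a = b then 1 else 0 :=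
  orthonormal_iff_ite.1 e.orthonormal a b

/-- A 3-form all of whose components in a Darboux frame are of the type `μμ̂ν̂` or `μμ̂0`. -/
lemma form_eq_sum_wedge₃ {p : M} (e : OrthonormalBasis (Idx n ε) ℝ (TangentSpace (𝓡 D) p))
    (T : Form D M 3)
    (h₁ : ∀ μ ν a, T p ![e (un μ), e (un ν), e a] = 0)
    (h₂ : ∀ (μ : Fin n) (i j : Fin n ⊕ Fin ε), i ≠ Sum.inl μ → j ≠ Sum.inl μ →
      T p ![e (un μ), e (Sum.inr i), e (Sum.inr j)] = 0)
    (h₃ : ∀ i j k : Fin n ⊕ Fin ε, T p ![e (Sum.inr i), e (Sum.inr j), e (Sum.inr k)] = 0)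
    (u v w : TangentSpace (𝓡 D) p) :
    T p ![u, v, w] = ∑ μ, ∑ i ∈ Finset.univ.erase (Sum.inl μ : Fin n ⊕ Fin ε),
      T p ![e (un μ), e (hat μ), e (Sum.inr i)] * wedge₃ e (un μ) (hat μ) (Sum.inr i) u v w := by
  have swap₁₂ : ∀ (a b c : Idx n ε) (u v w : TangentSpace (𝓡 D) p),
      wedge₃ e a b c v u w = - wedge₃ e a b c u v w := by
    intros; simp only [wedge₃_eq]; ring
  have swap₂₃ : ∀ (a b c : Idx n ε) (u v w : TangentSpace (𝓡 D) p),
      wedge₃ e a b c u w v = - wedge₃ e a b c u v w := by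
    intros; simp only [wedge₃_eq]; ring
  set R : TangentSpace (𝓡 D) p → TangentSpace (𝓡 D) p → TangentSpace (𝓡 D) p → ℝ := fun u v w ↦
    ∑ μ, ∑ i ∈ Finset.univ.erase (Sum.inl μ : Fin n ⊕ Fin ε),
      T p ![e (un μ), e (hat μ), e (Sum.inr i)] * wedge₃ e (un μ) (hat μ) (Sum.inr i) u v w with hR
  have hRt : IsTrilinear R :=
    IsTrilinear.sum fun μ ↦ IsTrilinear.sum fun i ↦ (isTrilinear_wedge₃ e _ _ _).const_mul _
  have R₁₂ : ∀ u v w, R v u w = - R u v w := fun u v w ↦ by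
    simp only [hR, swap₁₂ _ _ _ u v w, mul_neg, Finset.sum_neg_distrib]
  have R₂₃ : ∀ u v w, R u w v = - R u v w := fun u v w ↦ by
    simp only [hR, swap₂₃ _ _ _ u v w, mul_neg, Finset.sum_neg_distrib]
  have R1 : ∀ μ ν a, R (e (un μ)) (e (un ν)) (e a) = 0 := fun μ ν a ↦ by
    refine Finset.sum_eq_zero fun κ _ ↦ Finset.sum_eq_zero fun i _ ↦ ?_
    simp [wedge₃_eq, coframe_self]
  have R3 : ∀ i j k : Fin n ⊕ Fin ε, R (e (Sum.inr i)) (e (Sum.inr j)) (e (Sum.inr k)) = 0 := by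
    intro i j k
    refine Finset.sum_eq_zero fun κ _ ↦ Finset.sum_eq_zero fun l _ ↦ ?_
    simp [wedge₃_eq, coframe_self]
  have R2 : ∀ (μ : Fin n) (i j : Fin n ⊕ Fin ε), i ≠ Sum.inl μ →
      R (e (un μ)) (e (Sum.inr i)) (e (Sum.inr j)) =
        if j = Sum.inl μ then - T p ![e (un μ), e (hat μ), e (Sum.inr i)] else 0 := by
    intro μ i j hi
    simp only [hR]
    rw [Finset.sum_eq_single μ, Finset.sum_eq_single i]
    · simp [wedge₃_eq, coframe_self, hi, eq_comm]
      split_ifs <;> simp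
    · intro k _ hk
      simp [wedge₃_eq, coframe_self, hi.symm, hk]
    · intro h; simp [hi] at h
    · intro κ _ hκ
      refine Finset.sum_eq_zero fun l _ ↦ ?_
      simp [wedge₃_eq, coframe_self, hκ]
    · simp
  -- By antisymmetry of both sides every basis triple reduces to the vanishing types or to one
  -- unhatted index followed by two hatted ones.
  have key : ∀ (μ : Fin n) (i j : Fin n ⊕ Fin ε),
      T p ![e (un μ), e (Sum.inr i), e (Sum.inr j)] =
        R (e (un μ)) (e (Sum.inr i)) (e (Sum.inr j)) := by
    intro μ i j
    by_cases hi : i = Sum.inl μ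
    · by_cases hj : j = Sum.inl μ
      · rw [hi, hj]
        have h4 := form₃_swap₂₃ (T p) (e (un μ)) (e (hat μ)) (e (hat μ))
        have h5 := R₂₃ (e (un μ)) (e (hat μ)) (e (hat μ))
        linarith
      · rw [R₂₃, R2 μ j i hj, if_pos hi, hi, neg_neg]
    · rw [R2 μ i j hi]
      split_ifs with hj
      · rw [hj, form₃_swap₂₃]
      · exact h₂ μ i j hi hj
  refine IsTrilinear.ext_basis e.toBasis (isTrilinear_form T p) hRt ?_ u v w
  simp only [OrthonormalBasis.coe_toBasis]
  rintro (μ | i) (ν | j) (κ | k)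
  · rw [h₁, R1]
  · rw [h₁, R1]
  · rw [form₃_swap₂₃, R₂₃, h₁, R1]
  · exact key _ _ _
  · rw [form₃_swap₁₂, R₁₂, form₃_swap₂₃, R₂₃, form₃_swap₁₂, R₁₂, h₁, R1]
  · rw [form₃_swap₁₂, R₁₂, key]
  · rw [form₃_swap₂₃, R₂₃, form₃_swap₁₂, R₁₂, key]
  · rw [h₃, R3]

end TorsionFormulas

/-! ### The exterior derivative of h through the torsion. -/

section ExteriorDerivative

variable {D : ℕ} {M : Type*} [TopologicalSpace M] [ChartedSpace (EuclideanSpace ℝ (Fin D)) M]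
  [RiemannianBundle (fun p : M ↦ TangentSpace (𝓡 D) p)] {n ε : ℕ}

/-- The left side is the action of h as a derivation. It is an infinitesimal rotation of the μ-plane
and preserves e^μ ∧ e^μ̂, so only the third factor contributes: e^ν̂ goes to x_ν e^ν and e^0 to 0.
-/
lemma wedge₃_derivation {p : M} {e : OrthonormalBasis (Idx n ε) ℝ (TangentSpace (𝓡 D) p)}
    {h : Form D M 2} {x : Fin n → ℝ} (he : ∀ a b, h p ![e a, e b] = darbouxMat x a b)
    (μ : Fin n) (i : Fin n ⊕ Fin ε) (u v w : TangentSpace (𝓡 D) p) :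
    wedge₃ e (un μ) (hat μ) (Sum.inr i) u v (sharp h p w)
      - wedge₃ e (un μ) (hat μ) (Sum.inr i) u w (sharp h p v)
      + wedge₃ e (un μ) (hat μ) (Sum.inr i) v w (sharp h p u) =
    Sum.elim (fun ν ↦ x ν * wedge₃ e (un μ) (hat μ) (un ν) u v w) (fun _ ↦ 0) i := by
  have hco : ∀ a w, coframe e a (sharp h p w) = - ∑ b, darbouxMat x a b * coframe e b w := by
    intro a w
    simp only [coframe]
    rw [real_inner_comm, isSkew_sharp h p, real_inner_comm, inner_sharp]
    conv_lhs => rw [← e.sum_repr' w, ← bil_apply, map_sum]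
    simp only [map_smul, bil_apply, he, smul_eq_mul]
    congr 1
    exact Finset.sum_congr rfl fun b _ ↦ mul_comm _ _
  have h1 : ∀ μ w, coframe e (un μ) (sharp h p w) = - x μ * coframe e (hat μ) w := by
    intro μ w
    rw [hco]
    simp [Fintype.sum_sum_type, darbouxMat]
  have h2 : ∀ μ w, coframe e (hat μ) (sharp h p w) = x μ * coframe e (un μ) w := by
    intro μ w
    rw [hco]
    simp [Fintype.sum_sum_type, darbouxMat]
  have h3 : ∀ k w, coframe e (zer k) (sharp h p w) = 0 := by
    intro μ w
    rw [hco]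
    simp [darbouxMat]
  rcases i with ν | k
  · simp only [wedge₃_eq, h1, h2, Sum.elim_inl]
    ring
  · simp only [wedge₃_eq, h1, h2, h3, Sum.elim_inr]
    ring

variable [IsManifold (𝓡 D) ∞ M] [IsContMDiffRiemannianBundle (𝓡 D) ∞ (EuclideanSpace ℝ (Fin D))
      (fun p : M ↦ TangentSpace (𝓡 D) p)]

/-- The torsion of ∇ᵀ is T: the Levi-Civita part gives the bracket, and the two halves of T add up.
-/
lemma nablaT_sub (T : Form D M 3) {p : M} (u v : TangentSpace (𝓡 D) p) :
    nablaT T (ext v) p u - nablaT T (ext u) p v =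
      VectorField.mlieBracket (𝓡 D) (ext u) (ext v) p + torsionVec T p u v := by
  refine ext_inner_right ℝ fun w ↦ ?_
  have hs := fun u : TangentSpace (𝓡 D) p ↦ (smoothField_ext u).diff
  have h1 := inner_nablaT T (hs u) (hs v) (hs w)
  have h2 := inner_nablaT T (hs v) (hs u) (hs w)
  have h3 := koszul_swap (ext u) (ext v) (ext w) p
  simp only [ext_apply_self] at h1 h2 h3
  rw [inner_sub_left, inner_add_left, inner_torsionVec, h1, h2, h3,
    form₃_swap₁₂ (T p) u v w]
  ring

/-- The exterior derivative of a 2-form in terms of a connection with skew torsion. -/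
lemma extDeriv₂_eq (T : Form D M 3) (h : Form D M 2) {p : M} (u v w : TangentSpace (𝓡 D) p) :
    extDeriv₂ h p u v w = dT T h p u v w - (T p ![u, v, sharp h p w]
      - T p ![u, w, sharp h p v] + T p ![v, w, sharp h p u]) := by
  have key : ∀ u v w : TangentSpace (𝓡 D) p,
      h p ![nablaT T (ext v) p u, w] - h p ![nablaT T (ext u) p v, w] =
        h p ![VectorField.mlieBracket (𝓡 D) (ext u) (ext v) p, w] - T p ![u, v, sharp h p w] := by
    intro u v w
    have h1 : h p ![torsionVec T p u v, w] = - T p ![u, v, sharp h p w] := by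
      rw [form₂_swap, ← inner_sharp, real_inner_comm, inner_torsionVec]
    rw [sub_eq_add_neg _ (T p _), ← h1]
    simp only [← bil_apply]
    rw [← LinearMap.sub_apply, ← map_sub, nablaT_sub, map_add, LinearMap.add_apply]
  have k1 := key u v w
  have k2 := key u w v
  have k3 := key v w u
  simp only [dT, nablaTForm, extDeriv₂]
  rw [form₂_swap (h p) (nablaT T (ext w) p u) v, form₂_swap (h p) (nablaT T (ext w) p v) u,
    form₂_swap (h p) (nablaT T (ext v) p w) u]
  linarith

end ExteriorDerivative

/-! ### Matching eigenvalue functions with the data of a canonical frame. -/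

section Reindexing

lemma sum_erase_inl {n ε : ℕ} (μ : Fin n) (f : Fin n ⊕ Fin ε → ℝ) :
    ∑ i ∈ Finset.univ.erase (Sum.inl μ), f i =
      ∑ ν ∈ Finset.univ.erase μ, f (Sum.inl ν) + ∑ k, f (Sum.inr k) := by
  rw [← Finset.sum_disjSum]
  congr 1
  ext i
  rcases i with ν | k <;> simp

variable {D : ℕ} {M : Type*} [TopologicalSpace M] [ChartedSpace (EuclideanSpace ℝ (Fin D)) M]
  [RiemannianBundle (fun p : M ↦ TangentSpace (𝓡 D) p)]
  {n ε : ℕ} {T : Form D M 3} {h : Form D M 2}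

/-- Eigenvalue functions may be permuted, and their signs may be changed. -/
lemma IsEigenSystem.reindex {U : Set M} {y : Fin n → M → ℝ} (H : IsEigenSystem ε h U y)
    (σ : Equiv.Perm (Fin n)) {τ : Fin n → ℝ} (hτ : ∀ μ, τ μ ^ 2 = 1) :
    IsEigenSystem ε h U fun μ q ↦ τ μ * y (σ μ) q := by
  have hτ0 : ∀ μ, τ μ ≠ 0 := fun μ h0 ↦ by simpa [h0] using hτ μ
  refine ⟨H.isOpen, fun q hq μ ↦ SmoothFun.mul contMDiffAt_const (H.smooth q hq _),
    fun q hq ↦ ?_, fun q hq μ ↦ ?_, fun q hq μ ↦ mul_ne_zero (hτ0 μ) (H.ne q hq _),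
    fun q hq μ ν hμν ↦ ?_⟩
  · rw [H.charpoly q hq]
    simp only [mul_pow, hτ, one_mul]
    rw [Equiv.prod_comp σ fun μ ↦ X ^ 2 + C (y μ q ^ 2)]
  · obtain ⟨v, hv⟩ := H.diff_ne q hq (σ μ)
    refine ⟨v, ?_⟩
    rw [dirDeriv_mul_fun mdifferentiableAt_const (H.smooth q hq _).diff, dirDeriv_const, mul_zero,
      add_zero]
    exact mul_ne_zero (hτ0 μ) hv
  · simp only [mul_pow, hτ, one_mul]
    exact H.sq_ne q hq _ _ (σ.injective.ne hμν)

variable [IsManifold (𝓡 D) ∞ M]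

lemma IsCanonicalFrame.form_eq {p : M} {e : OrthonormalBasis (Idx n ε) ℝ (TangentSpace (𝓡 D) p)}
    {x Q : Fin n → ℝ} {Q₀ : ℝ} (he : IsCanonicalFrame T h p e x Q Q₀) (a b : Idx n ε) :
    h p ![e a, e b] = darbouxMat x a b := by
  rw [he.darboux]
  rcases a with μ | μ | k <;> rcases b with ν | ν | l <;>
    simp [wedge₂, coframe_self, darbouxMat, neg_ite, eq_comm]
  split_ifs with h
  · rw [h]
  · rfl

end Reindexing

/-! ### Assembly: adapted frames for PKY tensors and the formulas for T and dh. -/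

section Main

variable {D : ℕ} {M : Type*} [TopologicalSpace M] [ChartedSpace (EuclideanSpace ℝ (Fin D)) M]
  [IsManifold (𝓡 D) ∞ M] [RiemannianBundle (fun p : M ↦ TangentSpace (𝓡 D) p)]
  [IsContMDiffRiemannianBundle (𝓡 D) ∞ (EuclideanSpace ℝ (Fin D))
      (fun p : M ↦ TangentSpace (𝓡 D) p)]
  {n ε : ℕ} {T : Form D M 3} {h : Form D M 2}

lemma IsAdaptedFrame.torsion_eq {E : Idx n ε → VecField D M} {U : Set M} {x s : Fin n → M → ℝ}
    (hA : IsAdaptedFrame T h E U x s) (hε : ε ≤ 1) (hT : IsSmoothForm T) (hh : IsSmoothForm h)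
    (hg : IsGCKY T h) (hc : ∀ (p : M) (u v w : TangentSpace (𝓡 D) p), dT T h p u v w = 0)
    {p : M} (hp : p ∈ U) {e : OrthonormalBasis (Idx n ε) ℝ (TangentSpace (𝓡 D) p)}
    (he : ∀ a, e a = E a p) (u v w : TangentSpace (𝓡 D) p) :
    T p ![u, v, w] = ∑ μ, ∑ i ∈ Finset.univ.erase (Sum.inl μ : Fin n ⊕ Fin ε),
      T p ![e (un μ), e (hat μ), e (Sum.inr i)] * wedge₃ e (un μ) (hat μ) (Sum.inr i) u v w := by
  have hF := hA.frameEqs hh hg hc hp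
  -- Since ε ≤ 1, three distinct hatted labels include some μ̂, which antisymmetry moves to the
  -- front.
  have t₀ : ∀ i j k : Fin n ⊕ Fin ε, i ≠ j → j ≠ k → i ≠ k →
      T p ![E (Sum.inr i) p, E (Sum.inr j) p, E (Sum.inr k) p] = 0 := by
    intro i j k hij hjk hik
    rcases i with μ | a
    · exact hA.torsion_hat_hat_hat hε hT hh hg hc hp hij.symm hik.symm hjk
    · rcases j with ν | b
      · rw [form₃_swap₁₂, hA.torsion_hat_hat_hat hε hT hh hg hc hp hij hjk.symm hik, neg_zero]
      · exact absurd (congrArg Sum.inr (Fin.ext (by omega))) hij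
  apply form_eq_sum_wedge₃
  · intro μ ν a
    rw [he, he, he]
    rcases eq_or_ne μ ν with rfl | hμν
    · exact hF.T_self₁₂ _ _
    · exact hF.T_un_un a hμν
  · intro μ i j hi hj
    rw [he, he, he, form₃_swap₁₂, form₃_swap₂₃, neg_neg]
    exact hF.T_un_off (by simp) (by simpa using hi) (by simp) (by simpa using hj)
  · intro i j k
    rw [he, he, he]
    rcases eq_or_ne i j with rfl | hij
    · exact hF.T_self₁₂ _ _
    rcases eq_or_ne j k with rfl | hjk
    · exact hF.T_self₂₃ _ _
    rcases eq_or_ne i k with rfl | hik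
    · exact hF.T_self₁₃ _ _
    exact t₀ i j k hij hjk hik

/-- Nonvanishing and distinct squares are not part of non-degeneracy: the former comes from the
rank, the latter from functional independence and the GCKY equation. -/
lemma IsPKY.exists_eigenSystem (hD : D = 2 * n + ε) (hh : IsPKY n ε T h) (p : M) :
    ∃ (U : Set M) (y : Fin n → M → ℝ), IsEigenSystem ε h U y ∧ p ∈ U := by
  obtain ⟨U, hU, hp, y, hy, hchar, hind⟩ := hh.nondegenerate.2 p
  have hy' : ∀ q ∈ U, ∀ μ, SmoothFun D (y μ) q := fun q hq μ ↦
    (hy μ).contMDiffAt (hU.mem_nhds hq)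
  have hchar' : ∀ q ∈ U, (sharp h q).charpoly = X ^ ε * ∏ μ, (X ^ 2 + C (y μ q ^ 2)) :=
    fun q hq ↦ by rw [← charpoly_formMatrix, hchar q hq]
  refine ⟨U, y, ⟨hU, hy', hchar', ?_, ?_, ?_⟩, hp⟩
  · intro q hq μ
    by_contra! hcon
    exact (hind q hq).ne_zero μ (ContinuousLinearMap.ext hcon)
  · intro q hq μ
    exact eigenvalue_ne_zero (isSkew_sharp h q) (hchar' q hq)
      (by rw [← rank_formMatrix, hh.nondegenerate.1]) (by rw [finrank_tangentSpace, hD]) μ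
  · intro q hq μ ν hμν
    refine eigenvalue_sq_ne (ε := ε) hh.smooth hh.gcky hh.closed (fun μ ↦ (hy' q hq μ).diff) ?_
      (hind q hq) hμν
    filter_upwards [hU.mem_nhds hq] with r hr using hchar' r hr

/-- A canonical frame knows its x_μ only at `p`, and the characteristic polynomial fixes them up to
order and sign. The smooth eigenvalue functions are permuted and re-signed accordingly, so that e_μ̂
= x_μ⁻¹ h(e_μ) matches the given frame. -/
lemma IsCanonicalFrame.exists_adaptedFrame (hε : ε ≤ 1) (hD : D = 2 * n + ε) (hh : IsPKY n ε T h)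
    {p : M} {e : OrthonormalBasis (Idx n ε) ℝ (TangentSpace (𝓡 D) p)}
    {x Q : Fin n → ℝ} {Q₀ : ℝ} (he : IsCanonicalFrame T h p e x Q Q₀) :
    ∃ (U : Set M) (E : Idx n ε → VecField D M) (y s : Fin n → M → ℝ),
      IsAdaptedFrame T h E U y s ∧ p ∈ U ∧ (∀ a, e a = E a p) ∧ ∀ μ, y μ p = x μ := by
  obtain ⟨U, y, H, hp⟩ := hh.exists_eigenSystem hD p
  have hx : (X ^ ε * ∏ μ, (X ^ 2 + C (x μ ^ 2)) : ℝ[X]) =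
      X ^ ε * ∏ μ, (X ^ 2 + C (y μ p ^ 2)) := by
    rw [← H.charpoly p hp, ← charpoly_sharp h p e, ← charpoly_darbouxMat]
    congr 1
    ext a b
    exact (he.form_eq a b).symm
  obtain ⟨σ, hσ⟩ := exists_perm_of_prod_eq hx
  have hτ : ∀ μ, ∃ τ : ℝ, τ ^ 2 = 1 ∧ τ * y (σ μ) p = x μ := fun μ ↦ by
    rcases sq_eq_sq_iff_eq_or_eq_neg.1 (hσ μ) with h | h
    · exact ⟨1, by norm_num, by rw [h, one_mul]⟩
    · exact ⟨-1, by norm_num, by rw [h, neg_one_mul]⟩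
  choose τ hτ hτx using hτ
  have H' := H.reindex σ hτ
  set z : Fin n → M → ℝ := fun μ q ↦ τ μ * y (σ μ) q
  have hzx : (fun μ ↦ z μ p) = x := funext hτx
  have hx0 : ∀ μ, x μ ≠ 0 := fun μ ↦ by rw [← hzx]; exact H'.ne p hp μ
  have hsharp : ∀ a v, (∀ b, inner ℝ v (e b) = darbouxMat x a b) → sharp h p (e a) = v := by
    intro a v hv
    refine InnerProductSpace.ext_inner_right_basis e.toBasis fun b ↦ ?_
    rw [OrthonormalBasis.coe_toBasis, inner_sharp, he.form_eq, hv]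
  have ho := orthonormal_iff_ite.1 e.orthonormal
  have hun : ∀ μ, sharp h p (e (un μ)) = x μ • e (hat μ) := fun μ ↦ hsharp _ _ fun b ↦ by
    rw [inner_smul_left, ho]
    rcases b with ν | ν | k <;> simp [darbouxMat]
  have hhat : ∀ μ, sharp h p (e (hat μ)) = - x μ • e (un μ) := fun μ ↦ hsharp _ _ fun b ↦ by
    rw [inner_smul_left, ho]
    rcases b with ν | ν | k <;> simp [darbouxMat]
  have hzer : ∀ k, sharp h p (e (zer k)) = 0 := fun k ↦ hsharp _ _ fun b ↦ by
    rw [inner_zero_left]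
    rcases b with ν | ν | l <;> simp [darbouxMat]
  have hdata : IsDarbouxData (sharp h p) (fun μ ↦ z μ p) (fun μ ↦ e (un μ))
      (fun k : Fin ε ↦ e (zer k)) := by
    refine ⟨isSkew_sharp h p, H'.ne p hp, H'.sq_ne p hp, fun μ ↦ by simp, fun μ ↦ ?_,
      fun k ↦ by simp, hzer⟩
    rw [hun, map_smul, hhat, smul_smul, ← congrFun hzx μ]
    congr 1
    ring
  have hfam : ∀ a, darbouxFam (sharp h p) (fun μ ↦ z μ p) (fun μ ↦ e (un μ))
      (fun k : Fin ε ↦ e (zer k)) a = e a := by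
    rintro (μ | μ | k)
    · rfl
    · simp only [darbouxFam]
      rw [hun, congrFun hzx μ, inv_smul_smul₀ (hx0 μ)]
    · rfl
  obtain ⟨U', E, s, hA, hpU', -, hE⟩ := H'.exists_adaptedFrame hε hD hh.smooth hh.gcky hh.closed
    hp hdata
  refine ⟨U', E, z, s, hA, hpU', fun a ↦ ?_, hτx⟩
  rw [hE, hfam]
  · intro μ
    rw [he.assoc]
    simp [coframe_self]
  · intro μ
    rw [hfam, he.assoc]
    simp [coframe_self, Real.sqrt_nonneg]

/-- Every point has an adapted frame. -/
lemma IsPKY.exists_adaptedFrame (hε : ε ≤ 1) (hD : D = 2 * n + ε) (hh : IsPKY n ε T h) (p : M) :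
    ∃ (U : Set M) (E : Idx n ε → VecField D M) (y s : Fin n → M → ℝ),
      IsAdaptedFrame T h E U y s ∧ p ∈ U := by
  obtain ⟨U, y, H, hp⟩ := hh.exists_eigenSystem hD p
  choose v hv hv' using fun μ ↦ exists_unit_eigenvector (H.charpoly p hp) μ
  choose v₀ hv₀ hv₀' using fun k : Fin ε ↦
    exists_unit_kernel (H.charpoly p hp) (by have := k.isLt; omega)
  have hdata : IsDarbouxData (sharp h p) (fun μ ↦ y μ p) v v₀ :=
    ⟨isSkew_sharp h p, H.ne p hp, H.sq_ne p hp,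
      fun μ ↦ by rw [real_inner_self_eq_norm_sq, hv, one_pow], hv',
      fun k ↦ by rw [real_inner_self_eq_norm_sq, hv₀, one_pow], hv₀'⟩
  obtain ⟨U', E, s, hA, hpU', -⟩ := H.exists_adaptedFrame hε hD hh.smooth hh.gcky hh.closed
    hp hdata
  exact ⟨U', E, y, s, hA, hpU'⟩

/-- The exterior derivative of a closed 2-form in a frame of Darboux form. -/
lemma extDeriv₂_frame {p : M} (hc : ∀ u v w : TangentSpace (𝓡 D) p, dT T h p u v w = 0)
    {e : OrthonormalBasis (Idx n ε) ℝ (TangentSpace (𝓡 D) p)} {x : Fin n → ℝ}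
    (he : ∀ a b, h p ![e a, e b] = darbouxMat x a b)
    (hT : ∀ u v w : TangentSpace (𝓡 D) p, T p ![u, v, w] =
      ∑ μ, ∑ i ∈ Finset.univ.erase (Sum.inl μ : Fin n ⊕ Fin ε),
        T p ![e (un μ), e (hat μ), e (Sum.inr i)] * wedge₃ e (un μ) (hat μ) (Sum.inr i) u v w)
    (u v w : TangentSpace (𝓡 D) p) :
    extDeriv₂ h p u v w = -∑ μ, ∑ ν ∈ Finset.univ.erase μ,
      x μ * T p ![e (un ν), e (hat ν), e (hat μ)] * wedge₃ e (un ν) (hat ν) (un μ) u v w := by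
  have e1 := hT u v (sharp h p w)
  have e2 := hT u w (sharp h p v)
  have e3 := hT v w (sharp h p u)
  rw [extDeriv₂_eq T, hc, zero_sub, e1, e2, e3]
  simp only [← Finset.sum_sub_distrib, ← Finset.sum_add_distrib, ← mul_sub, ← mul_add,
    wedge₃_derivation he]
  simp only [sum_erase_inl, Sum.elim_inl, Sum.elim_inr, mul_zero,
    Finset.sum_const_zero, add_zero]
  congr 1
  rw [Finset.sum_comm' (t' := Finset.univ) (s' := fun ν ↦ Finset.univ.erase ν)
    (by simp [eq_comm])]
  exact Finset.sum_congr rfl fun μ _ ↦ Finset.sum_congr rfl fun ν _ ↦ by ring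

/-- The exterior derivative of a closed 2-form determines the components `μμ̂ν̂` of the torsion. -/
lemma torsion_of_extDeriv₂ {p : M} (hc : ∀ u v w : TangentSpace (𝓡 D) p, dT T h p u v w = 0)
    (hd : ∀ u v w : TangentSpace (𝓡 D) p, extDeriv₂ h p u v w = 0)
    {e : OrthonormalBasis (Idx n ε) ℝ (TangentSpace (𝓡 D) p)} {x : Fin n → ℝ}
    (hx : ∀ μ, x μ ≠ 0) (he : ∀ a b, h p ![e a, e b] = darbouxMat x a b)
    (hT : ∀ u v w : TangentSpace (𝓡 D) p, T p ![u, v, w] =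
      ∑ μ, ∑ i ∈ Finset.univ.erase (Sum.inl μ : Fin n ⊕ Fin ε),
        T p ![e (un μ), e (hat μ), e (Sum.inr i)] * wedge₃ e (un μ) (hat μ) (Sum.inr i) u v w)
    (u v w : TangentSpace (𝓡 D) p) :
    T p ![u, v, w] = ∑ k : Fin ε, ∑ μ, T p ![e (un μ), e (hat μ), e (zer k)] *
      wedge₃ e (un μ) (hat μ) (zer k) u v w := by
  have h0 : ∀ μ ν, ν ≠ μ → T p ![e (un μ), e (hat μ), e (hat ν)] = 0 := by
    intro μ ν hμν
    -- These arguments single out the term -x_ν T_{μμ̂ν̂}.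
    have h1 := extDeriv₂_frame hc he hT (e (un μ)) (e (hat μ)) (e (un ν))
    rw [hd, Finset.sum_eq_single ν, Finset.sum_eq_single μ] at h1
    · simpa [wedge₃_eq, coframe_self, hμν, hμν.symm, hx] using h1
    · intro κ _ hκ
      simp [wedge₃_eq, coframe_self, hκ]
    · intro h; simp [hμν.symm] at h
    · intro κ _ hκ
      refine Finset.sum_eq_zero fun ρ hρ ↦ ?_
      rcases eq_or_ne ρ μ with rfl | hρμ
      · simp [wedge₃_eq, coframe_self, hκ, hμν.symm]
      · simp [wedge₃_eq, coframe_self, hρμ]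
    · simp
  rw [hT u v w, Finset.sum_comm]
  refine Finset.sum_congr rfl fun μ _ ↦ ?_
  rw [sum_erase_inl, Finset.sum_eq_zero, zero_add]
  intro ν hν
  rw [h0 μ ν (Finset.ne_of_mem_erase hν), zero_mul]

end Main

end PKYTorsion

open PKYTorsion
theorem lemma2p1 {n ε D : ℕ} (hε : ε ≤ 1) (hD : D = 2 * n + ε)
    {M : Type*} [TopologicalSpace M] [ChartedSpace (EuclideanSpace ℝ (Fin D)) M]
    [IsManifold (𝓡 D) ∞ M]
    [RiemannianBundle (fun p : M ↦ TangentSpace (𝓡 D) p)]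
    [IsContMDiffRiemannianBundle (𝓡 D) ∞ (EuclideanSpace ℝ (Fin D))
      (fun p : M ↦ TangentSpace (𝓡 D) p)]
    (T : Form D M 3) (hT : IsSmoothForm T)
    (h : Form D M 2) (hh : IsPKY n ε T h) :
    (∀ (p : M) (e : OrthonormalBasis (Idx n ε) ℝ (TangentSpace (𝓡 D) p))
      (x Q : Fin n → ℝ) (Q₀ : ℝ), IsCanonicalFrame T h p e x Q Q₀ →
      (∀ u v w : TangentSpace (𝓡 D) p, T p ![u, v, w] =
        (∑ μ, ∑ ν ∈ Finset.univ.erase μ,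
          T p ![e (un μ), e (hat μ), e (hat ν)] *
            wedge₃ e (un μ) (hat μ) (hat ν) u v w)
        + ∑ k : Fin ε, ∑ μ,
          T p ![e (un μ), e (hat μ), e (zer k)] *
            wedge₃ e (un μ) (hat μ) (zer k) u v w) ∧
      (∀ u v w : TangentSpace (𝓡 D) p, extDeriv₂ h p u v w =
        -∑ μ, ∑ ν ∈ Finset.univ.erase μ,
          x μ * T p ![e (un ν), e (hat ν), e (hat μ)] *
            wedge₃ e (un ν) (hat ν) (un μ) u v w) ∧
      ((∀ u v w : TangentSpace (𝓡 D) p, extDeriv₂ h p u v w = 0) →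
        ∀ u v w : TangentSpace (𝓡 D) p, T p ![u, v, w] =
          ∑ k : Fin ε, ∑ μ,
            T p ![e (un μ), e (hat μ), e (zer k)] *
              wedge₃ e (un μ) (hat μ) (zer k)
                u v w)) ∧
    (ε = 0 → (∀ (p : M) (u v w : TangentSpace (𝓡 D) p), extDeriv₂ h p u v w = 0) →
      ∀ p : M, T p = 0) := by
  have hg := hh.gcky
  have hc := hh.closed
  refine ⟨fun p e x Q Q₀ he ↦ ?_, fun hε0 hd p ↦ ?_⟩
  · obtain ⟨U, E, y, s, hA, hp, hE, hyx⟩ := he.exists_adaptedFrame hε hD hh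
    have hTe := hA.torsion_eq hε hT hh.smooth hg hc hp hE
    refine ⟨fun u v w ↦ ?_, extDeriv₂_frame (hc p) he.form_eq hTe, fun hd ↦
      torsion_of_extDeriv₂ (hc p) hd (fun μ ↦ hyx μ ▸ hA.x_ne p hp μ) he.form_eq hTe⟩
    rw [hTe u v w, Finset.sum_comm (s := (Finset.univ : Finset (Fin ε))),
      ← Finset.sum_add_distrib]
    exact Finset.sum_congr rfl fun μ _ ↦ sum_erase_inl μ _
  -- No canonical frame is given here, so one is constructed at `p`; for ε = 0 the remaining sum
  -- over `Fin ε` is empty.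
  · obtain ⟨U, E, y, s, hA, hp⟩ := hh.exists_adaptedFrame hε hD p
    have hE : ∀ a, hA.frame.basis hp a = E a p := hA.frame.basis_apply hp
    have hTe := hA.torsion_eq hε hT hh.smooth hg hc hp hE
    have h0 := torsion_of_extDeriv₂ (hc p) (hd p) (hA.x_ne p hp)
      (fun a b ↦ by rw [hE, hE, hA.darboux p hp]) hTe
    subst hε0
    ext v
    have hv : v = ![v 0, v 1, v 2] := by
      ext i; fin_cases i <;> rfl
    rw [hv, h0]
    simp
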